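/- **Setting.** Let $K\ge 1$, let $f_1,\dots,f_K\in[0,1)$ be distinct, $z_k=e^{i2\pi f_k}$, $\mathbf Z=\operatorname{diag}(z_1,\dots,z_K)$, and let $\mathbf A_m$ be the $m\times K$ Vandermonde matrix with entries $e^{i2\pi (n-1)f_k}$ ($1\le n\le m$); write $\mathbf A=\mathbf A_N$. Let $\mathbf Y=\mathbf A\mathbf S+\mathbf E$ be an $N\times L$ random matrix, where * (A1) the entries of $\mathbf E$ are i.i.d. circularly symmetric complex Gaussian with mean zero and variance $\sigma^2$, $\sigma\ge 0$; * (A2) the columns of the $K\times L$ matrix $\mathbf S$ are independent, circularly symmetric complex Gaussian with mean zero and positive semidefinite covariance matrix $\boldsymbol\Sigma$; * (A3) $\mathbf E$ and $\mathbf S$ are independent. $\|\cdot\|$ is the spectral norm; $\sigma_j(\cdot)$ and $\lambda_j(\cdot)$ are the $j$-th greatest singular value and eigenvalue. For $M\le N$ put $P=N-M+1$ and $$\boldsymbol\Sigma_{SS}=\frac1P\sum_{p=1}^P\mathbf Z^{p-1}\boldsymbol\Sigma\mathbf Z^{1-p},\qquad \boldsymbol\Sigma'_{SS}=\tfrac12\bigl(\boldsymbol\Sigma_{SS}+\mathbf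 Z^{1-M}\overline{\boldsymbol\Sigma_{SS}}\mathbf Z^{M-1}\bigr).$$ **Algorithms.** For a Hermitian $m\times m$ matrix $\mathbf R$ with $m\ge K$, let $\widehat{\mathbf U}$ consist of the first $K$ eigenvectors of an orthonormal eigen-decomposition of $\mathbf R$ with eigenvalues in descending order, let $\widehat{\mathbf U}_1,\widehat{\mathbf U}_2$ be $\widehat{\mathbf U}$ without its last, respectively first, row, and let $\hat z_1,\dots,\hat z_K$ be the eigenvalues, with multiplicity, of $\widehat{\mathbf U}_1^{\dagger}\widehat{\mathbf U}_2$; the estimated frequencies $\hat f_k\in[0,1)$ are given by $\hat z_k=|\hat z_k|e^{i2\pi\hat f_k}$. With $\mathbf Y_{(p)}$ the rows $p,\dots,p+M-1$ of $\mathbf Y$ and $\mathbf J$ the reversal matrix, ESPRIT uses $\mathbf R=\widehat{\mathbf R}=\frac1L\mathbf Y\mathbf Y^H$, FOSS-ESPRIT uses $\widehat{\mathbf R}_{SS}=\frac1P\sum_{p=1}^P\frac1L\mathbf Y_{(p)}\mathbf Y_{(p)}^H$, and FBSS-ESPRIT uses $\frac12(\widehat{\mathbf R}_{SS}+\mathbf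 J\overline{\widehat{\mathbf R}_{SS}}\mathbf J)$. The bounds below hold for every possible result of the algorithm (every choice of the eigen-decomposition, and every choice of $\hat f_k$ if $\hat z_k=0$). Let $$\operatorname{md}(\widehat{\mathcal T},\mathcal T)=\min_{\psi}\max_k\min\{|\hat f_{\psi(k)}-f_k|,\,1-|\hat f_{\psi(k)}-f_k|\},$$ with $\psi$ ranging over the permutations of $\{1,\dots,K\}$. **Theorem 8.** 1. If $N\ge K+1$, $\boldsymbol\Sigma$ is positive definite and $L\ge\max\{N,16K\}$, then for ESPRIT $$\operatorname{md}(\widehat{\mathcal T},\mathcal T)\le\min\Bigl\{1,\ \frac{72\cdot2^{2K+5}K^{3/2}N}{\sigma_K^3(\mathbf A)\,\lambda_K(\boldsymbol\Sigma)}\cdot\frac{\max\{\sigma\|\mathbf A\|\|\boldsymbol\Sigma\|^{1/2},\sigma^2\}}{\sqrt L}\Bigr\}$$ with probability at least $1-3e^{-N/2}-2e^{-L/32}$. 2. If $K+1\le M\le N$, $\boldsymbol\Sigma_{SS}$ is positive definite and $L\ge\max\{M,16\operatorname{rank}(\boldsymbol\Sigma)\}$, then for FOSS-ESPRIT $$\operatorname{md}(\widehat{\mathcal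 T},\mathcal T)\le\min\Bigl\{1,\ \frac{72\cdot2^{2K+5}K^{3/2}M}{\sigma_K^3(\mathbf A_M)\,\lambda_K(\boldsymbol\Sigma_{SS})}\cdot\frac{\max\{\sigma\|\mathbf A_M\|\|\boldsymbol\Sigma\|^{1/2},\sigma^2\}}{\sqrt L}\Bigr\}$$ with probability at least $1-3Pe^{-M/2}-2e^{-L/32}$. 3. If $K+1\le M\le N$, $\boldsymbol\Sigma'_{SS}$ is positive definite and $L\ge\max\{M,16\operatorname{rank}(\boldsymbol\Sigma)\}$, then for FBSS-ESPRIT $$\operatorname{md}(\widehat{\mathcal T},\mathcal T)\le\min\Bigl\{1,\ \frac{72\cdot2^{2K+5}K^{3/2}M}{\sigma_K^3(\mathbf A_M)\,\lambda_K(\boldsymbol\Sigma'_{SS})}\cdot\frac{\max\{\sigma\|\mathbf A_M\|\|\boldsymbol\Sigma\|^{1/2},\sigma^2\}}{\sqrt L}\Bigr\}$$ with probability at least $1-3Pe^{-M/2}-2e^{-L/32}$. -/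

import Mathlib

open MeasureTheory ProbabilityTheory Matrix

open scoped ComplexOrder

namespace ESPRIT

noncomputable section

/-! ### Linear algebra -/

section Norm

open scoped Matrix.Norms.L2Operator

/-- Spectral norm `‖A‖` (largest singular value) of a rectangular complex matrix. -/
def specNorm {m n : ℕ} (A : Matrix (Fin m) (Fin n) ℂ) : ℝ := ‖A‖

end Norm

/-- `λ_j(A)`, the `j`-th greatest eigenvalue (with multiplicity, `1 ≤ j ≤ n`) of a Hermitian
`n × n` matrix `A`; the value `0` outside this range is never used. -/
def eigDesc {n : ℕ} (A : Matrix (Fin n) (Fin n) ℂ) (j : ℕ) : ℝ :=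
  if h : A.IsHermitian ∧ 1 ≤ j ∧ j ≤ n then
    h.1.eigenvalues₀ ⟨j - 1, by rw [Fintype.card_fin]; omega⟩
  else 0

/-- `σ_j(A)`, the `j`-th greatest singular value (`1 ≤ j`) of a complex matrix `A`.
Mathlib's sequence of singular values starts at the index `0`. -/
def singDesc {m n : ℕ} (A : Matrix (Fin m) (Fin n) ℂ) (j : ℕ) : ℝ :=
  (Matrix.toEuclideanLin A).singularValues (j - 1)

/-- `X` is the Moore–Penrose pseudo-inverse of `A`. -/
structure IsPseudoInverse {m n : ℕ} (A : Matrix (Fin m) (Fin n) ℂ)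
    (X : Matrix (Fin n) (Fin m) ℂ) : Prop where
  mul_mul_left : A * X * A = A
  mul_mul_right : X * A * X = X
  hermitian_left : (A * X).IsHermitian
  hermitian_right : (X * A).IsHermitian

/-! ### Frequencies, array manifold, subarrays -/

/-- `z = e^{i 2 π f}`. -/
def expFreq (f : ℝ) : ℂ := Complex.exp (2 * Real.pi * Complex.I * f)

/-- The `N × K` Vandermonde matrix with entries `e^{i 2 π n f_k}`, `n = 0, …, N - 1`. -/
def vander {K : ℕ} (N : ℕ) (f : Fin K → ℝ) : Matrix (Fin N) (Fin K) ℂ :=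
  Matrix.of fun n k => expFreq (f k) ^ (n : ℕ)

/-- `Z ^ e` for an integer `e`, where `Z = diag(z_1, …, z_K)`. -/
def zPow {K : ℕ} (f : Fin K → ℝ) (e : ℤ) : Matrix (Fin K) (Fin K) ℂ :=
  Matrix.diagonal fun k => expFreq (f k) ^ e

/-- The reversal matrix, with ones on the anti-diagonal. -/
def reversal (M : ℕ) : Matrix (Fin M) (Fin M) ℂ :=
  Matrix.of fun i j => if j = Fin.rev i then 1 else 0

/-- The `p`-th subarray of `Y` (`p = 0, …, N - M`): `M` consecutive rows starting with row `p`. -/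
def subarray {N M L : ℕ} (hM : M ≤ N) (p : Fin (N - M + 1)) (Y : Matrix (Fin N) (Fin L) ℂ) :
    Matrix (Fin M) (Fin L) ℂ :=
  Matrix.of fun i l => Y ⟨p.val + i.val, by omega⟩ l

/-! ### Covariance matrices -/

/-- Sample covariance matrix `(1 / L) Y Yᴴ`. -/
def sampleCov {N L : ℕ} (Y : Matrix (Fin N) (Fin L) ℂ) : Matrix (Fin N) (Fin N) ℂ :=
  (1 / (L : ℂ)) • (Y * Yᴴ)

/-- Forward-only smoothed sample covariance matrix: the average of the sample covariance
matrices of the `P = N - M + 1` subarrays. -/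
def sampleCovSS {N M L : ℕ} (hM : M ≤ N) (Y : Matrix (Fin N) (Fin L) ℂ) :
    Matrix (Fin M) (Fin M) ℂ :=
  (1 / ((N - M + 1 : ℕ) : ℂ)) • ∑ p : Fin (N - M + 1), sampleCov (subarray hM p Y)

/-- Forward-backward smoothed sample covariance matrix. -/
def sampleCovFB {N M L : ℕ} (hM : M ≤ N) (Y : Matrix (Fin N) (Fin L) ℂ) :
    Matrix (Fin M) (Fin M) ℂ :=
  (1 / 2 : ℂ) • (sampleCovSS hM Y +
    reversal M * (sampleCovSS hM Y).map (starRingEnd ℂ) * reversal M)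

/-- Smoothed source covariance `Σ_SS = (1 / P) ∑_{p = 0}^{P - 1} Z ^ p Σ Z ^ (-p)`. -/
def covSS {K : ℕ} (P : ℕ) (f : Fin K → ℝ) (C : Matrix (Fin K) (Fin K) ℂ) :
    Matrix (Fin K) (Fin K) ℂ :=
  (1 / (P : ℂ)) • ∑ p : Fin P, zPow f (p.val : ℤ) * C * zPow f (-(p.val : ℤ))

/-- Forward-backward smoothed source covariance
`Σ'_SS = (Σ_SS + Z ^ (1 - M) * conj Σ_SS * Z ^ (M - 1)) / 2`. -/
def covFB {K : ℕ} (M P : ℕ) (f : Fin K → ℝ) (C : Matrix (Fin K) (Fin K) ℂ) :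
    Matrix (Fin K) (Fin K) ℂ :=
  (1 / 2 : ℂ) • (covSS P f C +
    zPow f (1 - (M : ℤ)) * (covSS P f C).map (starRingEnd ℂ) * zPow f ((M : ℤ) - 1))

/-! ### The ESPRIT estimator -/

/-- `fhat` is a possible result of the ESPRIT procedure with `K` sources applied to the
(sample covariance) matrix `R`: there are an eigen-decomposition `R = V diag(d) Vᴴ` with `V`
unitary and `d` in descending order, the matrix `U` of the first `K` columns of `V`, the
submatrices `U₁`, `U₂` of `U` without its last and without its first row, and an enumeration `z`
with multiplicity of the eigenvalues of `U₁† U₂`, such that `2 π fhat k` is the angle of `z k`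
(any angle being allowed if `z k = 0`), normalized by `fhat k ∈ [0, 1)`. -/
def IsOutput {m K : ℕ} (hK : K ≤ m) (R : Matrix (Fin m) (Fin m) ℂ) (fhat : Fin K → ℝ) : Prop :=
  ∃ (V : Matrix (Fin m) (Fin m) ℂ) (d : Fin m → ℝ) (X : Matrix (Fin K) (Fin (m - 1)) ℂ)
    (z : Fin K → ℂ),
    V ∈ Matrix.unitaryGroup (Fin m) ℂ ∧
    Antitone d ∧
    R = V * Matrix.diagonal (fun j => (d j : ℂ)) * Vᴴ ∧
    (let U₁ : Matrix (Fin (m - 1)) (Fin K) ℂ :=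
        Matrix.of fun i k => V ⟨i.val, by omega⟩ (Fin.castLE hK k)
     let U₂ : Matrix (Fin (m - 1)) (Fin K) ℂ :=
        Matrix.of fun i k => V ⟨i.val + 1, by omega⟩ (Fin.castLE hK k)
     IsPseudoInverse U₁ X ∧
     (X * U₂).charpoly = ∏ k, (Polynomial.X - Polynomial.C (z k))) ∧
    ∀ k, fhat k ∈ Set.Ico (0 : ℝ) 1 ∧ z k = (‖z k‖ : ℂ) * expFreq (fhat k)

/-- Matched wrap-around distance between two families of `K` frequencies in `[0, 1)`: the minimum
over permutations of the maximum over `k` of the wrap-around distances. -/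
def matchedDist {K : ℕ} (fhat f : Fin K → ℝ) : ℝ :=
  ⨅ ψ : Equiv.Perm (Fin K), ⨆ k : Fin K,
    min |fhat (ψ k) - f k| (1 - |fhat (ψ k) - f k|)

/-! ### Complex Gaussian distributions -/

/-- The circularly symmetric complex Gaussian distribution `CN(0, v)`: real and imaginary parts
are independent, centered, of variance `v / 2`. -/
def complexGaussian (v : NNReal) : Measure ℂ :=
  ((gaussianReal 0 (v / 2)).prod (gaussianReal 0 (v / 2))).map fun p => (⟨p.1, p.2⟩ : ℂ)

section Vector

open scoped MatrixOrder

/-- The circularly symmetric complex Gaussian distribution `CN(0, C)` on `ℂ ^ K` for a positive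
semidefinite covariance matrix `C`: the law of `C ^ (1 / 2) w` with `w` having i.i.d. `CN(0, 1)`
entries. -/
def complexGaussianVec {K : ℕ} (C : Matrix (Fin K) (Fin K) ℂ) : Measure (Fin K → ℂ) :=
  (Measure.pi fun _ : Fin K => complexGaussian 1).map fun w => CFC.sqrt C *ᵥ w

end Vector

end

end ESPRIT

/-! The sample covariance matrix R of the (sub)array is compared with the model A T Aᴴ + σ² I, where
A is the Vandermonde matrix and T is the smoothed covariance of the realized sources, not of their
law. With this choice the fluctuation of the sources is not an error: what remains are the cross
terms between sources and noise and the deviation of the noise covariance from its mean, both of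
size √(M / L) times max{σ‖A‖‖Σ‖^(1/2), σ²}. Of the sources one only needs that their sample
covariance dominates Σ / 8 as a quadratic form and that ‖S‖ is at most a multiple of √L ‖Σ‖^(1/2).

Deterministic half (`matchedDist_le_of_isOutput`). If R is within ε of the model, the trailing
eigenvalues of R are within ε of s by Weyl's inequality. The signal part is bounded below by a² t on
the range of A, with a the least singular value of A and t a lower bound of T, so the trailing
eigenprojection shrinks that range by the factor 2ε / (a² t) (`vn_trailing_projection_le`). Hence A
is nearly U W with W = Uᴴ A, and the exact shift relation A₂ = A₁ Z becomes U₂ W ≈ U₁ W Z: the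
ESPRIT matrix is similar to Z + B with B small (`exists_charpoly_eq_diagonal_add`). Deleting a row
of A costs only a factor 2 ^ K, because vectors in its range satisfy the linear recurrence with
characteristic polynomial ∏ (X - z_k) (`vn_vander_succ_le`). Bauer–Fike and a homotopy argument
match the eigenvalues of Z + B with the nodes up to (2K - 1)‖B‖ (`exists_perm_eigenvalues_le`), and
a chord estimate turns eigenvalues into frequencies. The smallness assumption disappears in
`matchedDist_le_min_of_isOutput`: when the claimed bound is at least 1/2 it holds trivially, and
otherwise it forces ε to be small.

Probabilistic half (`exists_good_event`). Chernoff bounds for sums of squared moduli of complex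
Gaussians, with union bounds over 1/8-nets of spheres, control the noise covariance, the cross term
(for fixed sources, then by Fubini) and the sources. The net for the sources lives in the range of
Σ^(1/2), which is why L ≥ 16 rank Σ suffices.

Smoothing fits in because the subarray with offset p follows the same model with Z ^ p inserted
before S. Averaging over p and conjugate reversal do not increase the error and preserve the order
of quadratic forms. Plain ESPRIT is the case M = N. -/

namespace ESPRIT

/-- The Euclidean norm of a complex vector. -/
noncomputable def vn {ι : Type*} [Fintype ι] (x : ι → ℂ) : ℝ :=
  ‖(WithLp.toLp 2 x : EuclideanSpace ℂ ι)‖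

/-! ### Euclidean norm and spectral norm. -/

section Vn

variable {ι κ : Type*} [Fintype ι] [Fintype κ]

lemma vn_sq (x : ι → ℂ) : vn x ^ 2 = ∑ i, ‖x i‖ ^ 2 := by
  simp [vn, EuclideanSpace.norm_sq_eq]

lemma vn_nonneg (x : ι → ℂ) : 0 ≤ vn x := norm_nonneg _

lemma vn_add_le (x y : ι → ℂ) : vn (x + y) ≤ vn x + vn y := by
  simpa [vn] using norm_add_le (WithLp.toLp 2 x : EuclideanSpace ℂ ι) (WithLp.toLp 2 y)

lemma vn_sub_le (x y : ι → ℂ) : vn (x - y) ≤ vn x + vn y := by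
  simpa [vn] using norm_sub_le (WithLp.toLp 2 x : EuclideanSpace ℂ ι) (WithLp.toLp 2 y)

lemma vn_smul (c : ℂ) (x : ι → ℂ) : vn (c • x) = ‖c‖ * vn x := by
  simp [vn, norm_smul]

@[simp] lemma vn_zero : vn (0 : ι → ℂ) = 0 := by simp [vn]

lemma vn_eq_zero {x : ι → ℂ} : vn x = 0 ↔ x = 0 := by simp [vn]

lemma vn_pos {x : ι → ℂ} (hx : x ≠ 0) : 0 < vn x :=
  lt_of_le_of_ne (vn_nonneg x) (fun h => hx (vn_eq_zero.1 h.symm))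

lemma star_dotProduct_eq_inner (x y : ι → ℂ) :
    star x ⬝ᵥ y = inner ℂ (WithLp.toLp 2 x : EuclideanSpace ℂ ι) (WithLp.toLp 2 y) := by
  simp [EuclideanSpace.inner_eq_star_dotProduct, dotProduct_comm]

lemma norm_dotProduct_le (x y : ι → ℂ) : ‖star x ⬝ᵥ y‖ ≤ vn x * vn y := by
  rw [star_dotProduct_eq_inner]; exact norm_inner_le_norm _ _

lemma star_dotProduct_self (x : ι → ℂ) : star x ⬝ᵥ x = ((vn x ^ 2 : ℝ) : ℂ) := by
  rw [star_dotProduct_eq_inner, inner_self_eq_norm_sq_to_K]; simp [vn]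

lemma star_dotProduct_mulVec (A : Matrix ι κ ℂ) (x : ι → ℂ) (y : κ → ℂ) :
    star x ⬝ᵥ (A *ᵥ y) = star (Aᴴ *ᵥ x) ⬝ᵥ y := by
  rw [star_mulVec, conjTranspose_conjTranspose, dotProduct_mulVec]

lemma vn_mulVec_sq (A : Matrix ι κ ℂ) (x : κ → ℂ) :
    ((vn (A *ᵥ x) ^ 2 : ℝ) : ℂ) = star x ⬝ᵥ ((Aᴴ * A) *ᵥ x) := by
  rw [← star_dotProduct_self, ← mulVec_mulVec, star_dotProduct_mulVec Aᴴ,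
    conjTranspose_conjTranspose]

lemma norm_apply_le_vn (x : ι → ℂ) (i : ι) : ‖x i‖ ≤ vn x :=
  PiLp.norm_apply_le (WithLp.toLp 2 x : EuclideanSpace ℂ ι) i

lemma vn_le_of_forall_norm_le {x : ι → ℂ} {y : ι → ℂ} (h : ∀ i, ‖x i‖ ≤ ‖y i‖) : vn x ≤ vn y := by
  refine le_of_sq_le_sq ?_ (vn_nonneg y)
  rw [vn_sq, vn_sq]
  exact Finset.sum_le_sum fun i _ => pow_le_pow_left₀ (norm_nonneg _) (h i) 2

lemma vn_eq_of_forall_norm_eq {x : ι → ℂ} {y : ι → ℂ} (h : ∀ i, ‖x i‖ = ‖y i‖) : vn x = vn y :=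
  le_antisymm (vn_le_of_forall_norm_le fun i => (h i).le)
    (vn_le_of_forall_norm_le fun i => (h i).ge)

/-- Every vector is a nonnegative multiple of a unit vector or zero. -/
lemma exists_unit_smul {x : ι → ℂ} (hx : x ≠ 0) :
    ∃ u : ι → ℂ, vn u = 1 ∧ x = ((vn x : ℝ) : ℂ) • u := by
  have hp := vn_pos hx
  refine ⟨((vn x : ℝ) : ℂ)⁻¹ • x, ?_, ?_⟩
  · rw [vn_smul, norm_inv, Complex.norm_real, Real.norm_of_nonneg hp.le, inv_mul_cancel₀ hp.ne']
  · rw [smul_smul, mul_inv_cancel₀ (by exact_mod_cast hp.ne'), one_smul]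

end Vn

section SpecNorm

open scoped Matrix.Norms.L2Operator

variable {m n : ℕ}

lemma specNorm_nonneg (A : Matrix (Fin m) (Fin n) ℂ) : 0 ≤ specNorm A := norm_nonneg _

lemma vn_mulVec_le (A : Matrix (Fin m) (Fin n) ℂ) (x : Fin n → ℂ) :
    vn (A *ᵥ x) ≤ specNorm A * vn x :=
  l2_opNorm_mulVec A (WithLp.toLp 2 x)

lemma specNorm_le {A : Matrix (Fin m) (Fin n) ℂ} {c : ℝ} (hc : 0 ≤ c)
    (h : ∀ x, vn (A *ᵥ x) ≤ c * vn x) : specNorm A ≤ c := by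
  rw [specNorm, l2_opNorm_def]
  exact ContinuousLinearMap.opNorm_le_bound _ hc fun x => h x.ofLp

lemma specNorm_add_le (A B : Matrix (Fin m) (Fin n) ℂ) :
    specNorm (A + B) ≤ specNorm A + specNorm B := norm_add_le _ _

lemma specNorm_smul (c : ℂ) (A : Matrix (Fin m) (Fin n) ℂ) :
    specNorm (c • A) = ‖c‖ * specNorm A := norm_smul _ _

lemma specNorm_sum_le {ι : Type*} (s : Finset ι) (A : ι → Matrix (Fin m) (Fin n) ℂ) :
    specNorm (∑ i ∈ s, A i) ≤ ∑ i ∈ s, specNorm (A i) := norm_sum_le _ _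

lemma specNorm_conjTranspose (A : Matrix (Fin m) (Fin n) ℂ) : specNorm Aᴴ = specNorm A :=
  l2_opNorm_conjTranspose A

end SpecNorm

/-! ### Quadratic forms and the numerical radius. -/

/-- The quadratic form `Re (xᴴ H x)`. -/
noncomputable def qf {ι : Type*} [Fintype ι] (H : Matrix ι ι ℂ) (x : ι → ℂ) : ℝ :=
  (star x ⬝ᵥ (H *ᵥ x)).re

section Qf

variable {ι κ : Type*} [Fintype ι] [Fintype κ]

lemma qf_add (G H : Matrix ι ι ℂ) (x : ι → ℂ) : qf (G + H) x = qf G x + qf H x := by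
  simp [qf, add_mulVec, dotProduct_add]

lemma qf_sub (G H : Matrix ι ι ℂ) (x : ι → ℂ) : qf (G - H) x = qf G x - qf H x := by
  simp [qf, sub_mulVec, dotProduct_sub]

lemma qf_smul (c : ℝ) (H : Matrix ι ι ℂ) (x : ι → ℂ) : qf ((c : ℂ) • H) x = c * qf H x := by
  simp [qf, smul_mulVec, dotProduct_smul]

lemma qf_sum {α : Type*} (s : Finset α) (H : α → Matrix ι ι ℂ) (x : ι → ℂ) :
    qf (∑ i ∈ s, H i) x = ∑ i ∈ s, qf (H i) x := by
  simp [qf, Matrix.sum_mulVec, dotProduct_sum]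

lemma qf_one [DecidableEq ι] (x : ι → ℂ) : qf (1 : Matrix ι ι ℂ) x = vn x ^ 2 := by
  rw [qf, one_mulVec, star_dotProduct_self, Complex.ofReal_re]

lemma qf_mul_mul_conjTranspose (A : Matrix ι κ ℂ) (H : Matrix κ κ ℂ) (x : ι → ℂ) :
    qf (A * H * Aᴴ) x = qf H (Aᴴ *ᵥ x) := by
  rw [qf, qf, ← mulVec_mulVec, ← mulVec_mulVec, star_dotProduct_mulVec]

lemma qf_mul_conjTranspose (A : Matrix ι κ ℂ) (x : ι → ℂ) :
    qf (A * Aᴴ) x = vn (Aᴴ *ᵥ x) ^ 2 := by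
  rw [qf, ← mulVec_mulVec, star_dotProduct_mulVec, star_dotProduct_self, Complex.ofReal_re]

lemma abs_qf_le {n : ℕ} (H : Matrix (Fin n) (Fin n) ℂ) (x : Fin n → ℂ) :
    |qf H x| ≤ specNorm H * vn x ^ 2 := by
  calc |qf H x| ≤ ‖star x ⬝ᵥ (H *ᵥ x)‖ := Complex.abs_re_le_norm _
    _ ≤ vn x * vn (H *ᵥ x) := norm_dotProduct_le _ _
    _ ≤ vn x * (specNorm H * vn x) := by gcongr; exacts [vn_nonneg x, vn_mulVec_le H x]
    _ = _ := by ring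

/-- The norm of a Hermitian matrix is bounded by its numerical radius. -/
lemma specNorm_le_of_abs_qf_le {n : ℕ} {H : Matrix (Fin n) (Fin n) ℂ} (hH : H.IsHermitian) {c : ℝ}
    (hc : 0 ≤ c) (h : ∀ x, |qf H x| ≤ c * vn x ^ 2) : specNorm H ≤ c := by
  -- Polarization: 4 Re⟨y, H x⟩ = q(x + y) - q(x - y), and the parallelogram law adds up the two
  -- bounds.
  have key : ∀ x y : Fin n → ℂ, (star y ⬝ᵥ (H *ᵥ x)).re ≤ c / 2 * (vn x ^ 2 + vn y ^ 2) := by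
    intro x y
    have hs : (star x ⬝ᵥ (H *ᵥ y)).re = (star y ⬝ᵥ (H *ᵥ x)).re := by
      rw [star_dotProduct_mulVec, hH.eq, ← Complex.conj_re]
      congr 1
      change star _ = _
      rw [← star_dotProduct_star, star_star, dotProduct_comm]
    have e1 : qf H (x + y) - qf H (x - y) = 4 * (star y ⬝ᵥ (H *ᵥ x)).re := by
      simp only [qf, mulVec_add, mulVec_sub, star_add, star_sub, add_dotProduct, sub_dotProduct,
        dotProduct_add, dotProduct_sub, Complex.add_re, Complex.sub_re]
      linarith
    have e2 : vn (x + y) ^ 2 + vn (x - y) ^ 2 = 2 * (vn x ^ 2 + vn y ^ 2) := by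
      have := parallelogram_law_with_norm ℂ (WithLp.toLp 2 x : EuclideanSpace ℂ (Fin n))
        (WithLp.toLp 2 y)
      simp only [vn, WithLp.toLp_add, WithLp.toLp_sub]
      nlinarith
    have h1 := abs_le.1 (h (x + y))
    have h2 := abs_le.1 (h (x - y))
    nlinarith
  refine specNorm_le hc fun x => ?_
  by_cases hx : H *ᵥ x = 0
  · rw [hx, vn_zero]; exact mul_nonneg hc (vn_nonneg x)
  have hx0 : x ≠ 0 := by rintro rfl; simp at hx
  obtain ⟨u, hu, hxu⟩ := exists_unit_smul hx0
  obtain ⟨w, hw, hxw⟩ := exists_unit_smul hx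
  -- For u and w the unit vectors along x and H x, the bilinear form equals ‖H x‖ / ‖x‖.
  have h3 := key u w
  have h4 : H *ᵥ u = (((vn (H *ᵥ x) / vn x : ℝ)) : ℂ) • w := by
    have : ((vn x : ℝ) : ℂ) • (H *ᵥ u) = ((vn (H *ᵥ x) : ℝ) : ℂ) • w := by
      rw [← hxw, ← mulVec_smul, ← hxu]
    have hv : ((vn x : ℝ) : ℂ) ≠ 0 := by exact_mod_cast (vn_pos hx0).ne'
    push_cast
    rw [div_eq_inv_mul, mul_smul, ← this, smul_smul, inv_mul_cancel₀ hv, one_smul]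
  rw [h4, dotProduct_smul, star_dotProduct_self, hw, hu] at h3
  simp only [smul_eq_mul, ← Complex.ofReal_mul, Complex.ofReal_re] at h3
  have hp := vn_pos hx0
  have : vn (H *ᵥ x) / vn x ≤ c := by linarith
  rwa [div_le_iff₀ hp] at this

end Qf

end ESPRIT

namespace ESPRIT

/-! ### Least eigenvalue and least singular value as lower bounds. -/

section Extremal

/-- In the eigenbasis the form is a combination of eigenvalues with weights summing to ‖x‖². The
eigenvalues descend, so `hi` makes i the last index and its eigenvalue the least one. -/
lemma _root_.LinearMap.IsSymmetric.eigenvalues_mul_norm_sq_le {E : Type*} [NormedAddCommGroup E]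
    [InnerProductSpace ℂ E] [FiniteDimensional ℂ E] {T : E →ₗ[ℂ] E} (hT : T.IsSymmetric) {n : ℕ}
    (hn : Module.finrank ℂ E = n) (i : Fin n) (hi : ∀ j, j ≤ i) (x : E) :
    hT.eigenvalues hn i * ‖x‖ ^ 2 ≤ (inner ℂ x (T x)).re := by
  have h1 : inner ℂ x (T x) = ∑ j, ((hT.eigenvalues hn j *
      ‖inner ℂ (hT.eigenvectorBasis hn j) x‖ ^ 2 : ℝ) : ℂ) := by
    rw [← (hT.eigenvectorBasis hn).sum_inner_mul_inner]
    refine Finset.sum_congr rfl fun j _ => ?_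
    have h2 : inner ℂ (hT.eigenvectorBasis hn j) (T x) =
        hT.eigenvalues hn j * inner ℂ (hT.eigenvectorBasis hn j) x := by
      rw [← hT, hT.apply_eigenvectorBasis, inner_smul_left]
      simp
    rw [h2, ← inner_conj_symm]
    push_cast
    rw [← Complex.conj_mul']
    ring
  rw [h1, Complex.re_sum, ← (hT.eigenvectorBasis hn).sum_sq_norm_inner_right x, Finset.mul_sum]
  simp only [Complex.ofReal_re]
  exact Finset.sum_le_sum fun j _ => mul_le_mul_of_nonneg_right
    (hT.eigenvalues_antitone hn (hi j)) (sq_nonneg _)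

variable {m K : ℕ}

lemma eigDesc_mul_le_qf {C : Matrix (Fin K) (Fin K) ℂ} (hC : C.IsHermitian) (hK : 1 ≤ K)
    (x : Fin K → ℂ) : eigDesc C K * vn x ^ 2 ≤ qf C x := by
  rw [eigDesc, dif_pos ⟨hC, hK, le_rfl⟩]
  refine ((isSymmetric_toEuclideanLin_iff.mpr hC).eigenvalues_mul_norm_sq_le
    finrank_euclideanSpace _ (fun j => ?_) (WithLp.toLp 2 x)).trans_eq ?_
  · have := j.2
    rw [Fin.le_def]
    simp only [Fintype.card_fin] at this ⊢
    omega
  · rw [qf, star_dotProduct_eq_inner]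
    rfl

lemma eigDesc_pos {C : Matrix (Fin K) (Fin K) ℂ} (hC : C.PosDef) (hK : 1 ≤ K) :
    0 < eigDesc C K := by
  rw [eigDesc, dif_pos ⟨hC.1, hK, le_rfl⟩]
  set i : Fin (Fintype.card (Fin K)) := ⟨K - 1, by rw [Fintype.card_fin]; omega⟩
  have := hC.eigenvalues_pos ((Fintype.equivOfCardEq (Fintype.card_fin _)) i)
  simpa [IsHermitian.eigenvalues] using this

/-- The square of the last singular value is the least eigenvalue of the adjoint of A composed with
A, whose quadratic form is ‖A x‖². -/
lemma singDesc_mul_le (A : Matrix (Fin m) (Fin K) ℂ) (hK : 1 ≤ K) (x : Fin K → ℂ) :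
    singDesc A K * vn x ≤ vn (A *ᵥ x) := by
  have h := (Matrix.toEuclideanLin A).sq_singularValues_of_lt (n := K) (i := K - 1) (by simp)
    (by omega)
  have h1 := (Matrix.toEuclideanLin A).isSymmetric_adjoint_comp_self.eigenvalues_mul_norm_sq_le
    (n := K) (by simp) ⟨K - 1, by omega⟩ (fun j => by rw [Fin.le_def]; simp; omega)
    (WithLp.toLp 2 x)
  rw [← h] at h1
  refine le_of_sq_le_sq ?_ (vn_nonneg _)
  rw [mul_pow]
  refine h1.trans_eq ?_
  rw [LinearMap.comp_apply, LinearMap.adjoint_inner_right, inner_self_eq_norm_sq_to_K]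
  norm_cast

lemma singDesc_pos {A : Matrix (Fin m) (Fin K) ℂ} (hK : 1 ≤ K)
    (hA : ∀ x, A *ᵥ x = 0 → x = 0) : 0 < singDesc A K := by
  refine (Matrix.toEuclideanLin A).injective_iff_forall_lt_finrank_singularValues_pos.1 ?_ (K - 1)
    (by simp; omega)
  refine (injective_iff_map_eq_zero _).2 fun x hx => ?_
  have := hA x.ofLp (by simpa using congrArg WithLp.ofLp hx)
  ext i; exact congrFun this i

end Extremal

/-! ### Vandermonde matrices with nodes on the unit circle. -/

section Vander

variable {m K : ℕ} (f : Fin K → ℝ)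

lemma norm_expFreq (t : ℝ) : ‖expFreq t‖ = 1 := by
  rw [expFreq, show (2 * Real.pi * Complex.I * t : ℂ) = ((2 * Real.pi * t : ℝ) : ℂ) * Complex.I by
    push_cast; ring]
  exact Complex.norm_exp_ofReal_mul_I _

lemma expFreq_ne_zero (t : ℝ) : expFreq t ≠ 0 := Complex.exp_ne_zero _

lemma expFreq_injOn : Set.InjOn expFreq (Set.Ico (0 : ℝ) 1) := by
  intro a ha b hb h
  obtain ⟨n, hn⟩ := Complex.exp_eq_exp_iff_exists_int.1 h
  have h2 : (a : ℂ) = b + n := by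
    have : (2 * Real.pi * Complex.I : ℂ) ≠ 0 := by simp [Real.pi_ne_zero]
    refine mul_left_cancel₀ this ?_
    rw [hn]; ring
  have h3 : a = b + n := by exact_mod_cast h2
  have h4 : n < 1 := by
    have : (n : ℝ) < 1 := by linarith [ha.2, hb.1]
    exact_mod_cast this
  have h5 : -1 < n := by
    have : (-1 : ℝ) < n := by linarith [ha.1, hb.2]
    exact_mod_cast this
  have : n = 0 := by omega
  simpa [this] using h3

/-- The first K rows are a transposed square Vandermonde matrix with distinct nodes, hence
nonsingular. -/
lemma vander_mulVec_eq_zero (hf : ∀ k, f k ∈ Set.Ico (0 : ℝ) 1) (hfinj : Function.Injective f)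
    (hm : K ≤ m) (x : Fin K → ℂ) (hx : vander m f *ᵥ x = 0) : x = 0 := by
  have hinj : Function.Injective fun k => expFreq (f k) := fun a b h =>
    hfinj (expFreq_injOn (hf a) (hf b) h)
  refine eq_zero_of_vecMul_eq_zero (det_vandermonde_ne_zero_iff.mpr hinj) (funext fun i => ?_)
  have := congrFun hx (Fin.castLE hm i)
  simpa [mulVec, dotProduct, vander, vecMul, vandermonde_apply, mul_comm] using this

/-- All entries have modulus one, so Cauchy–Schwarz bounds each of the m squared entries of A x by
K‖x‖². -/
lemma specNorm_vander_le : specNorm (vander m f) ≤ √(m * K) := by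
  refine specNorm_le (Real.sqrt_nonneg _) fun x => ?_
  refine le_of_sq_le_sq ?_ (mul_nonneg (Real.sqrt_nonneg _) (vn_nonneg _))
  rw [mul_pow, Real.sq_sqrt (by positivity), vn_sq]
  calc ∑ i, ‖(vander m f *ᵥ x) i‖ ^ 2 ≤ ∑ _i : Fin m, (K : ℝ) * vn x ^ 2 := by
        refine Finset.sum_le_sum fun i _ => ?_
        have h1 : ‖(vander m f *ᵥ x) i‖ ≤ ∑ k, ‖x k‖ := by
          rw [mulVec, dotProduct]
          refine (norm_sum_le _ _).trans_eq (Finset.sum_congr rfl fun k _ => ?_)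
          simp [vander, norm_expFreq]
        have h2 := sq_sum_le_card_mul_sum_sq (s := Finset.univ) (f := fun k => ‖x k‖)
        rw [vn_sq]
        simpa using (pow_le_pow_left₀ (norm_nonneg _) h1 2).trans h2
    _ = _ := by simp; ring

-- Each factor X - z at most doubles the ℓ¹ norm of the coefficients. The length n stays free in the
-- induction because multiplication by X shifts the range.
open Polynomial in
lemma sum_norm_coeff_prod_X_sub_C_le {ι : Type*} (s : Finset ι) (z : ι → ℂ)
    (hz : ∀ i, ‖z i‖ ≤ 1) (n : ℕ) :
    ∑ j ∈ Finset.range n, ‖(∏ i ∈ s, (X - C (z i))).coeff j‖ ≤ 2 ^ s.card := by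
  classical
  induction s using Finset.induction_on generalizing n with
  | empty =>
    simp only [Finset.prod_empty, coeff_one, Finset.card_empty, pow_zero]
    calc _ ≤ ∑ j ∈ Finset.range n, if j = 0 then (1 : ℝ) else 0 :=
          Finset.sum_le_sum fun j _ => by split_ifs <;> simp
      _ ≤ 1 := by rw [Finset.sum_ite_eq']; split_ifs <;> simp
  | insert a s ha ih =>
    rw [Finset.prod_insert ha, Finset.card_insert_of_notMem ha, sub_mul]
    set p := ∏ i ∈ s, (X - C (z i))
    have h1 : ∑ j ∈ Finset.range n, ‖(X * p).coeff j‖ ≤ 2 ^ s.card := by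
      cases n with
      | zero => simp
      | succ n => rw [Finset.sum_range_succ']; simpa using ih n
    have h2 : ∑ j ∈ Finset.range n, ‖(C (z a) * p).coeff j‖ ≤ 2 ^ s.card := by
      refine (Finset.sum_le_sum fun j _ => ?_).trans (ih n)
      rw [coeff_C_mul, norm_mul]
      exact mul_le_of_le_one_left (norm_nonneg _) (hz a)
    calc _ ≤ ∑ j ∈ Finset.range n, (‖(X * p).coeff j‖ + ‖(C (z a) * p).coeff j‖) :=
          Finset.sum_le_sum fun j _ => by rw [coeff_sub]; exact norm_sub_le _ _
      _ ≤ _ := by rw [Finset.sum_add_distrib, pow_succ]; linarith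

/-- A vector in the range of a Vandermonde matrix with nodes on the unit circle is controlled by
all but its last entry. -/
lemma vn_vander_succ_le (hm : K ≤ m) (x : Fin K → ℂ) :
    vn (vander (m + 1) f *ᵥ x) ≤ 2 ^ K * vn (vander m f *ᵥ x) := by
  set v : ℕ → ℂ := fun n => ∑ k, expFreq (f k) ^ n * x k with hv
  set V := vn (vander m f *ᵥ x)
  have hvm : ∀ (n : ℕ) (i : Fin n), (vander n f *ᵥ x) i = v i := fun n i => rfl
  set p := ∏ k, (Polynomial.X - Polynomial.C (expFreq (f k))) with hp
  have hdeg : p.natDegree = K := by rw [hp, Polynomial.natDegree_finsetProd_X_sub_C_eq_card]; simp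
  have hmon : p.coeff K = 1 := by
    have : p.Monic := Polynomial.monic_prod_of_monic _ _ fun k _ => Polynomial.monic_X_sub_C _
    rw [← hdeg]; exact this
  -- The leading coefficient accounts for 1 of the total 2 ^ K.
  have hsum : ∑ j ∈ Finset.range K, ‖p.coeff j‖ ≤ 2 ^ K - 1 := by
    have := sum_norm_coeff_prod_X_sub_C_le Finset.univ (fun k => expFreq (f k))
      (fun k => (norm_expFreq _).le) (K + 1)
    rw [Finset.sum_range_succ, ← hp, hmon] at this
    simp only [Finset.card_univ, Fintype.card_fin, norm_one] at this
    linarith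
  -- Each geometric sequence z_k ^ n is annihilated by p, hence so is their combination v. The last
  -- entry is therefore determined by the K entries before it.
  have hrec : v m = -∑ j ∈ Finset.range K, p.coeff j * v (m - K + j) := by
    have h0 : ∑ j ∈ Finset.range (K + 1), p.coeff j * v (m - K + j) = 0 := by
      simp only [hv, Finset.mul_sum]
      rw [Finset.sum_comm]
      refine Finset.sum_eq_zero fun k _ => ?_
      have hroot : p.eval (expFreq (f k)) = 0 := by
        rw [hp, Polynomial.eval_prod]
        exact Finset.prod_eq_zero (Finset.mem_univ k) (by simp)
      rw [Polynomial.eval_eq_sum_range, hdeg] at hroot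
      calc _ = (expFreq (f k) ^ (m - K) * x k) *
            ∑ j ∈ Finset.range (K + 1), p.coeff j * expFreq (f k) ^ j := by
            rw [Finset.mul_sum]
            exact Finset.sum_congr rfl fun j _ => by rw [pow_add]; ring
        _ = 0 := by rw [hroot, mul_zero]
    rw [Finset.sum_range_succ, hmon, one_mul, Nat.sub_add_cancel hm] at h0
    linear_combination h0
  have hV : 0 ≤ V := vn_nonneg _
  have hlast : ‖v m‖ ≤ (2 ^ K - 1) * V := by
    rw [hrec, norm_neg]
    calc _ ≤ ∑ j ∈ Finset.range K, ‖p.coeff j‖ * V := by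
          refine (norm_sum_le _ _).trans (Finset.sum_le_sum fun j hj => ?_)
          rw [norm_mul]
          refine mul_le_mul_of_nonneg_left ?_ (norm_nonneg _)
          have := Finset.mem_range.1 hj
          exact norm_apply_le_vn (vander m f *ᵥ x) ⟨m - K + j, by omega⟩
      _ ≤ _ := by rw [← Finset.sum_mul]; gcongr
  refine le_of_sq_le_sq ?_ (by positivity)
  have hsplit : vn (vander (m + 1) f *ᵥ x) ^ 2 = V ^ 2 + ‖v m‖ ^ 2 := by
    rw [vn_sq, vn_sq, Fin.sum_univ_castSucc]
    rfl
  have h1 : (1 : ℝ) ≤ 2 ^ K := one_le_pow₀ (by norm_num)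
  have h2 := pow_le_pow_left₀ (norm_nonneg _) hlast 2
  rw [hsplit]
  -- This is 1 + (2 ^ K - 1)² ≤ (2 ^ K)².
  nlinarith [mul_nonneg (sub_nonneg.2 h1) (sq_nonneg V)]

end Vander
end ESPRIT

namespace ESPRIT

/-! ### Perturbation of the signal subspace. -/

section Perturbation

variable {m K : ℕ}

lemma vn_unitary_mulVec {V : Matrix (Fin m) (Fin m) ℂ} (hV : Vᴴ * V = 1) (x : Fin m → ℂ) :
    vn (V *ᵥ x) = vn x := by
  have h := vn_mulVec_sq V x
  rw [hV, one_mulVec, star_dotProduct_self] at h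
  have h1 : vn (V *ᵥ x) ^ 2 = vn x ^ 2 := by exact_mod_cast h
  exact (sq_eq_sq₀ (vn_nonneg _) (vn_nonneg _)).1 h1

lemma qf_diagonal {ι : Type*} [Fintype ι] [DecidableEq ι] (d : ι → ℝ) (x : ι → ℂ) :
    qf (Matrix.diagonal fun j => (d j : ℂ)) x = ∑ j, d j * ‖x j‖ ^ 2 := by
  rw [qf, dotProduct, Complex.re_sum]
  refine Finset.sum_congr rfl fun j _ => ?_
  rw [mulVec_diagonal, Pi.star_apply, show star (x j) * (d j * x j) = d j * (star (x j) * x j) by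
    ring, RCLike.star_def, Complex.conj_mul', Complex.re_ofReal_mul]
  norm_cast

lemma vn_diagonal_mulVec_le {ι : Type*} [Fintype ι] [DecidableEq ι] {e : ι → ℂ} {c : ℝ}
    (h : ∀ i, ‖e i‖ ≤ c) (hc : 0 ≤ c) (x : ι → ℂ) : vn (Matrix.diagonal e *ᵥ x) ≤ c * vn x := by
  have : c * vn x = vn ((c : ℂ) • x) := by
    rw [vn_smul, Complex.norm_real, Real.norm_of_nonneg hc]
  rw [this]
  refine vn_le_of_forall_norm_le fun i => ?_
  rw [mulVec_diagonal, Pi.smul_apply, norm_mul, smul_eq_mul, norm_mul, Complex.norm_real,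
    Real.norm_of_nonneg hc]
  exact mul_le_mul_of_nonneg_right (h i) (norm_nonneg _)

lemma vn_unitary_diagonal_le {V : Matrix (Fin m) (Fin m) ℂ} (hV : Vᴴ * V = 1) {e : Fin m → ℂ}
    {c : ℝ} (h : ∀ i, ‖e i‖ ≤ c) (hc : 0 ≤ c) (x : Fin m → ℂ) :
    vn ((V * Matrix.diagonal e * Vᴴ) *ᵥ x) ≤ c * vn x := by
  rw [← mulVec_mulVec, ← mulVec_mulVec, vn_unitary_mulVec hV]
  refine (vn_diagonal_mulVec_le h hc _).trans_eq ?_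
  rw [vn_unitary_mulVec]
  rw [conjTranspose_conjTranspose]
  exact mul_eq_one_comm.1 hV

/-- Weyl's inequality for the trailing eigenvalues of a perturbation of a matrix of rank `K` plus
a multiple of the identity. -/
lemma abs_trailing_eigenvalue_sub_le {V R : Matrix (Fin m) (Fin m) ℂ} (hV : Vᴴ * V = 1)
    {d : Fin m → ℝ} (hd : Antitone d) (hR : R = V * Matrix.diagonal (fun j => (d j : ℂ)) * Vᴴ)
    {A : Matrix (Fin m) (Fin K) ℂ} {T : Matrix (Fin K) (Fin K) ℂ} (hT : ∀ x, 0 ≤ qf T x)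
    {s ε : ℝ} (hε : specNorm (R - (A * T * Aᴴ + (s : ℂ) • 1)) ≤ ε) (j : Fin m) (hj : K ≤ j) :
    |d j - s| ≤ ε := by
  have hV' : V * Vᴴ = 1 := mul_eq_one_comm.1 hV
  have hq : ∀ c : Fin m → ℂ, qf R (V *ᵥ c) = ∑ i, d i * ‖c i‖ ^ 2 := fun c => by
    rw [hR, qf_mul_mul_conjTranspose, mulVec_mulVec, hV, one_mulVec, qf_diagonal]
  have hq0 : ∀ c : Fin m → ℂ, |qf R (V *ᵥ c) - (qf T (Aᴴ *ᵥ (V *ᵥ c)) + s * vn c ^ 2)|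
      ≤ ε * vn c ^ 2 := fun c => by
    have := (abs_qf_le _ (V *ᵥ c)).trans (mul_le_mul_of_nonneg_right hε (sq_nonneg _))
    rwa [qf_sub, qf_add, qf_smul, qf_one, vn_unitary_mulVec hV, qf_mul_mul_conjTranspose] at this
  rw [abs_le]
  constructor
  -- Lower bound: test with the j-th eigenvector, where the signal form is nonnegative.
  · have h1 := abs_le.1 (hq0 (Pi.single j 1))
    have h2 : vn (Pi.single j 1 : Fin m → ℂ) ^ 2 = 1 := by
      rw [vn_sq, Finset.sum_eq_single j] <;> simp +contextual
    rw [hq, h2, Finset.sum_eq_single j (by simp +contextual) (by simp)] at h1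
    have h3 := hT (Aᴴ *ᵥ (V *ᵥ Pi.single j 1))
    simp only [Pi.single_eq_same, norm_one] at h1
    linarith
  -- Upper bound: a vector in the span of the first K + 1 eigenvectors that Aᴴ kills. These are K +
  -- (m - K - 1) = m - 1 linear conditions on m coordinates, and only eigenvalues at least d j
  -- contribute since j ≥ K.
  · let φ : (Fin m → ℂ) →ₗ[ℂ] (Fin K → ℂ) × (Fin (m - K - 1) → ℂ) :=
      (Matrix.mulVecLin (Aᴴ * V)).prod
        (LinearMap.funLeft ℂ ℂ fun i : Fin (m - K - 1) => (⟨i + K + 1, by omega⟩ : Fin m))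
    have hφ : LinearMap.ker φ ≠ ⊥ := LinearMap.ker_ne_bot_of_finrank_lt (by
      have := j.2
      simp; omega)
    obtain ⟨c, hc, hc0⟩ := Submodule.exists_mem_ne_zero_of_ne_bot hφ
    have hc' : (Aᴴ * V) *ᵥ c = 0 ∧ ∀ i : Fin (m - K - 1), c ⟨i + K + 1, by omega⟩ = 0 := by
      have h := LinearMap.mem_ker.1 hc
      have h1 := congrArg Prod.fst h
      exact ⟨by simpa [φ] using h1, fun i => congrFun (congrArg Prod.snd h) i⟩
    have h1 := abs_le.1 (hq0 c)
    rw [mulVec_mulVec, hc'.1, hq] at h1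
    have h2 : d j * vn c ^ 2 ≤ ∑ i, d i * ‖c i‖ ^ 2 := by
      rw [vn_sq, Finset.mul_sum]
      refine Finset.sum_le_sum fun i _ => ?_
      by_cases hi : i ≤ j
      · exact mul_le_mul_of_nonneg_right (hd hi) (sq_nonneg _)
      · have hi' : (j : ℕ) < i := by simpa using hi
        have := hc'.2 ⟨i - K - 1, by omega⟩
        rw [show (⟨((⟨i - K - 1, by omega⟩ : Fin (m - K - 1)) : ℕ) + K + 1, by simp; omega⟩ : Fin m)
          = i by ext; simp; omega] at this
        simp [this]
    have h3 : 0 < vn c ^ 2 := pow_pos (vn_pos hc0) 2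
    have h4 : qf T 0 = 0 := by simp [qf]
    rw [h4] at h1
    refine le_of_mul_le_mul_right ?_ h3
    linarith

/-- The projection onto the trailing eigenvectors almost annihilates the signal subspace. -/
lemma vn_trailing_projection_le {V R : Matrix (Fin m) (Fin m) ℂ} (hV : Vᴴ * V = 1)
    {d : Fin m → ℝ} (hd : Antitone d) (hR : R = V * Matrix.diagonal (fun j => (d j : ℂ)) * Vᴴ)
    {A : Matrix (Fin m) (Fin K) ℂ} {T : Matrix (Fin K) (Fin K) ℂ} {t a : ℝ} (ht : 0 < t)
    (ha : 0 < a) (hT : ∀ x, t * vn x ^ 2 ≤ qf T x) (hA : ∀ x, a * vn x ≤ vn (A *ᵥ x))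
    {s ε : ℝ} (hε : specNorm (R - (A * T * Aᴴ + (s : ℂ) • 1)) ≤ ε) (x : Fin K → ℂ) :
    vn ((V * Matrix.diagonal (fun j : Fin m => if (j : ℕ) < K then (0 : ℂ) else 1) * Vᴴ) *ᵥ
      (A *ᵥ x)) ≤ 2 * ε / (a ^ 2 * t) * vn (A *ᵥ x) := by
  have hε0 : 0 ≤ ε := (specNorm_nonneg _).trans hε
  -- From ‖A b‖² = ⟨b, Aᴴ A b⟩ ≤ ‖b‖ ‖Aᴴ A b‖ and a‖b‖ ≤ ‖A b‖.
  have hAH : ∀ b, a * vn (A *ᵥ b) ≤ vn (Aᴴ *ᵥ (A *ᵥ b)) := fun b => by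
    have h1 : vn (A *ᵥ b) ^ 2 ≤ vn b * vn (Aᴴ *ᵥ (A *ᵥ b)) := by
      have h := vn_mulVec_sq A b
      rw [← mulVec_mulVec] at h
      have h' := norm_dotProduct_le b (Aᴴ *ᵥ (A *ᵥ b))
      rwa [← h, Complex.norm_real, Real.norm_of_nonneg (sq_nonneg _)] at h'
    by_cases h0 : vn (A *ᵥ b) = 0
    · rw [h0, mul_zero]; exact vn_nonneg _
    · have hp : 0 < vn (A *ᵥ b) := lt_of_le_of_ne (vn_nonneg _) (Ne.symm h0)
      refine le_of_mul_le_mul_right ?_ hp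
      have h2 := mul_le_mul_of_nonneg_right (hA b) (vn_nonneg (Aᴴ *ᵥ (A *ᵥ b)))
      nlinarith
  have hq : ∀ b, a ^ 2 * t * vn (A *ᵥ b) ^ 2 ≤ qf (A * T * Aᴴ) (A *ᵥ b) := fun b => by
    rw [qf_mul_mul_conjTranspose]
    refine le_trans ?_ (hT _)
    have := pow_le_pow_left₀ (mul_nonneg ha.le (vn_nonneg _)) (hAH b) 2
    nlinarith
  -- The signal matrix is inverted on the range of A: writing x = T Aᴴ A b gives A x = (A T Aᴴ) y
  -- with y = A b, and coercivity then bounds ‖y‖ by ‖A x‖ / (a² t).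
  have hsurj : Function.Surjective (Matrix.mulVecLin (T * Aᴴ * A)) := by
    rw [← LinearMap.injective_iff_surjective]
    refine (injective_iff_map_eq_zero _).2 fun b hb => ?_
    have h1 := hq b
    rw [Matrix.mulVecLin_apply] at hb
    rw [qf, mulVec_mulVec, show A * T * Aᴴ * A = A * (T * Aᴴ * A) by simp only [Matrix.mul_assoc],
      ← mulVec_mulVec, hb, mulVec_zero, dotProduct_zero, Complex.zero_re] at h1
    have h2 : vn (A *ᵥ b) ^ 2 ≤ 0 := by
      by_contra hcon
      have := mul_pos (mul_pos (pow_pos ha 2) ht) (not_le.1 hcon)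
      linarith
    have h3 : vn (A *ᵥ b) = 0 := by simpa using le_antisymm h2 (sq_nonneg _)
    have h4 := hA b
    rw [h3] at h4
    have : vn b = 0 := le_antisymm (by
      by_contra hcon
      have := mul_pos ha (not_le.1 hcon)
      linarith) (vn_nonneg _)
    exact vn_eq_zero.1 this
  obtain ⟨b, hb⟩ := hsurj x
  rw [Matrix.mulVecLin_apply] at hb
  set v := A *ᵥ x
  set y := A *ᵥ b with hy
  have hv : (A * T * Aᴴ) *ᵥ y = v := by
    rw [hy, mulVec_mulVec, show A * T * Aᴴ * A = A * (T * Aᴴ * A) by simp only [Matrix.mul_assoc],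
      ← mulVec_mulVec, hb]
  have hg : 0 < a ^ 2 * t := by positivity
  have hyv : a ^ 2 * t * vn y ≤ vn v := by
    have h1 := hq b
    have h2 : qf (A * T * Aᴴ) y ≤ vn y * vn v := by
      rw [qf, hv]; exact (Complex.re_le_norm _).trans (norm_dotProduct_le _ _)
    by_cases h0 : vn y = 0
    · rw [h0, mul_zero]; exact vn_nonneg _
    · have hp : 0 < vn y := lt_of_le_of_ne (vn_nonneg _) (Ne.symm h0)
      refine le_of_mul_le_mul_right ?_ hp
      nlinarith
  set e : Fin m → ℂ := fun j => if (j : ℕ) < K then (0 : ℂ) else 1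
  set Δ := R - (A * T * Aᴴ + (s : ℂ) • 1) with hΔ
  -- Substitute A T Aᴴ = (R - s) - Δ. On the trailing eigenspace R - s is at most ε by Weyl, and Δ
  -- is at most ε everywhere; this is the source of 2ε.
  have hdec : (V * Matrix.diagonal e * Vᴴ) *ᵥ v =
      (V * Matrix.diagonal (fun j => e j * (d j - s)) * Vᴴ) *ᵥ y -
        (V * Matrix.diagonal e * Vᴴ) *ᵥ (Δ *ᵥ y) := by
    have h1 : V * Matrix.diagonal (fun j => e j * (d j - s)) * Vᴴ =
        (V * Matrix.diagonal e * Vᴴ) * (R - (s : ℂ) • 1) := by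
      have h2 : R - (s : ℂ) • 1 = V * Matrix.diagonal (fun j => (d j : ℂ) - s) * Vᴴ := by
        have h3 : Matrix.diagonal (fun j => (d j : ℂ) - s) =
            Matrix.diagonal (fun j => (d j : ℂ)) - (s : ℂ) • (1 : Matrix (Fin m) (Fin m) ℂ) := by
          rw [smul_one_eq_diagonal, diagonal_sub]
        rw [h3, Matrix.mul_sub, Matrix.sub_mul, ← hR, Matrix.mul_smul, Matrix.mul_one,
          Matrix.smul_mul, mul_eq_one_comm.1 hV]
      rw [h2, show V * Matrix.diagonal e * Vᴴ * (V * Matrix.diagonal (fun j => (d j : ℂ) - s) * Vᴴ)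
        = V * (Matrix.diagonal e * (Vᴴ * V) * Matrix.diagonal (fun j => (d j : ℂ) - s)) * Vᴴ by
          simp only [Matrix.mul_assoc], hV, Matrix.mul_one, diagonal_mul_diagonal]
    rw [h1, ← mulVec_mulVec y _ (R - (s : ℂ) • 1), ← mulVec_sub, ← sub_mulVec, hΔ,
      sub_sub_sub_cancel_left,
      add_sub_cancel_right, hv]
  have hWeyl := abs_trailing_eigenvalue_sub_le (A := A) (T := T) hV hd hR
    (fun x => (mul_nonneg ht.le (sq_nonneg _)).trans (hT x)) hε
  have h5 : vn ((V * Matrix.diagonal (fun j => e j * (d j - s)) * Vᴴ) *ᵥ y) ≤ ε * vn y := by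
    refine vn_unitary_diagonal_le hV (fun i => ?_) hε0 y
    by_cases hi : (i : ℕ) < K
    · simp [e, hi, hε0]
    · have := hWeyl i (not_lt.1 hi)
      simp only [e, hi, if_false, one_mul]
      rw [← Complex.ofReal_sub, Complex.norm_real]
      exact this
  have h6 : vn ((V * Matrix.diagonal e * Vᴴ) *ᵥ (Δ *ᵥ y)) ≤ 1 * vn (Δ *ᵥ y) :=
    vn_unitary_diagonal_le hV (fun i => by by_cases hi : (i : ℕ) < K <;> simp [e, hi]) zero_le_one _
  have h7 : vn (Δ *ᵥ y) ≤ ε * vn y :=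
    (vn_mulVec_le _ _).trans (mul_le_mul_of_nonneg_right hε (vn_nonneg _))
  rw [hdec]
  calc _ ≤ 2 * ε * vn y := (vn_sub_le _ _).trans (by linarith)
    _ ≤ 2 * ε * (vn v / (a ^ 2 * t)) := by
        gcongr
        rw [le_div_iff₀ hg]; linarith
    _ = _ := by ring

end Perturbation
end ESPRIT

namespace ESPRIT

/-! ### From the signal subspace to the spectral matrix. -/

section ShiftInvariance

variable {m K : ℕ}

lemma vn_comp_le {ι κ : Type*} [Fintype ι] [Fintype κ] {e : ι → κ} (he : Function.Injective e)
    (x : κ → ℂ) : vn (fun i => x (e i)) ≤ vn x := by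
  classical
  refine le_of_sq_le_sq ?_ (vn_nonneg _)
  rw [vn_sq, vn_sq, ← Finset.sum_image (s := Finset.univ) (g := e) (f := fun i => ‖x i‖ ^ 2)
    (fun a _ b _ h => he h)]
  exact Finset.sum_le_sum_of_subset_of_nonneg (Finset.subset_univ _) fun _ _ _ => sq_nonneg _

lemma vn_mulVec_le_of_isHermitian_of_idempotent {P : Matrix (Fin m) (Fin m) ℂ}
    (hP : P.IsHermitian) (hPP : P * P = P) (x : Fin m → ℂ) : vn (P *ᵥ x) ≤ vn x := by
  have h := vn_mulVec_sq P x
  rw [hP.eq, hPP] at h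
  have h' := norm_dotProduct_le x (P *ᵥ x)
  rw [← h, Complex.norm_real, Real.norm_of_nonneg (sq_nonneg _)] at h'
  by_cases h0 : vn (P *ᵥ x) = 0
  · rw [h0]; exact vn_nonneg _
  · have hp : 0 < vn (P *ᵥ x) := lt_of_le_of_ne (vn_nonneg _) (Ne.symm h0)
    refine le_of_mul_le_mul_right ?_ hp
    nlinarith

/-- Splitting V Vᴴ = 1 into leading and trailing columns. This identifies the residual A - U Uᴴ A
with the trailing projection of A. -/
lemma leading_mul_conjTranspose {V : Matrix (Fin m) (Fin m) ℂ} (hV : Vᴴ * V = 1) (hK : K ≤ m) :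
    V.submatrix id (Fin.castLE hK) * (V.submatrix id (Fin.castLE hK))ᴴ =
      1 - V * Matrix.diagonal (fun j : Fin m => if (j : ℕ) < K then (0 : ℂ) else 1) * Vᴴ := by
  have h1 : (1 : Matrix (Fin m) (Fin m) ℂ) = V * Vᴴ := (mul_eq_one_comm.1 hV).symm
  rw [h1]
  ext i j
  have h3 : (V * Matrix.diagonal (fun j : Fin m => if (j : ℕ) < K then (0 : ℂ) else 1) * Vᴴ) i j =
      ∑ k, V i k * (if (k : ℕ) < K then (0 : ℂ) else 1) * star (V j k) := by
    rw [Matrix.mul_apply]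
    exact Finset.sum_congr rfl fun k _ => by rw [mul_diagonal, conjTranspose_apply]
  rw [Matrix.sub_apply, h3, Matrix.mul_apply, Matrix.mul_apply, ← Finset.sum_sub_distrib]
  simp only [conjTranspose_apply, submatrix_apply, id]
  have h2 : ∀ k : Fin m, V i k * star (V j k) - V i k * (if (k : ℕ) < K then (0 : ℂ) else 1) *
      star (V j k) = if (k : ℕ) < K then V i k * star (V j k) else 0 := fun k => by
    split_ifs <;> ring
  rw [Finset.sum_congr rfl fun k _ => h2 k, ← Finset.sum_filter]
  refine Finset.sum_bij (fun k _ => Fin.castLE hK k) (fun k _ => by simp)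
    (fun a _ b _ h => by simpa using h) (fun k hk => ?_) (fun _ _ => rfl)
  exact ⟨⟨k, (Finset.mem_filter.1 hk).2⟩, Finset.mem_univ _, rfl⟩

/-- If the leading eigenvectors almost span the range of a Vandermonde matrix, then the spectral
matrix of ESPRIT is similar to a small perturbation of the diagonal matrix of the nodes. -/
lemma exists_charpoly_eq_diagonal_add (f : Fin K → ℝ) (hKm : K ≤ m)
    {V : Matrix (Fin (m + 1)) (Fin (m + 1)) ℂ} (hV : Vᴴ * V = 1) {a δ : ℝ} (ha : 0 < a)
    (hA : ∀ x, a * vn x ≤ vn (vander (m + 1) f *ᵥ x)) (hδ0 : 0 ≤ δ) (hδ : δ * 2 ^ (K + 1) ≤ 1)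
    (hQ : ∀ x, vn ((V * Matrix.diagonal (fun j : Fin (m + 1) =>
      if (j : ℕ) < K then (0 : ℂ) else 1) * Vᴴ) *ᵥ (vander (m + 1) f *ᵥ x)) ≤
      δ * vn (vander (m + 1) f *ᵥ x))
    {U : Matrix (Fin (m + 1)) (Fin K) ℂ}
    (hU : U = V.submatrix id (Fin.castLE (hKm.trans m.le_succ)))
    {X : Matrix (Fin K) (Fin m) ℂ} (hX : IsPseudoInverse (U.submatrix Fin.castSucc id) X) :
    ∃ B : Matrix (Fin K) (Fin K) ℂ,
      (X * U.submatrix Fin.succ id).charpoly =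
        (Matrix.diagonal (fun k => expFreq (f k)) + B).charpoly ∧
      specNorm B ≤ 2 ^ (K + 2) * δ * specNorm (vander (m + 1) f) / a := by
  have hUU := leading_mul_conjTranspose hV (hKm.trans m.le_succ)
  rw [← hU] at hUU
  set Q := V * Matrix.diagonal (fun j : Fin (m + 1) => if (j : ℕ) < K then (0 : ℂ) else 1) * Vᴴ
  set A := vander (m + 1) f
  set A₁ := vander m f with hA₁
  set Z : Matrix (Fin K) (Fin K) ℂ := Matrix.diagonal (fun k => expFreq (f k)) with hZ
  set U₁ := U.submatrix Fin.castSucc id with hU₁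
  set U₂ := U.submatrix Fin.succ id with hU₂
  -- The coordinates of the columns of A in the basis U; W will be the similarity between the
  -- spectral matrix and Z + B.
  set W := Uᴴ * A with hW
  have hF : Q * A = A - U * W := by
    rw [hW, ← Matrix.mul_assoc, hUU, Matrix.sub_mul, Matrix.one_mul, sub_sub_cancel]
  have hF₁ : (Q * A).submatrix Fin.castSucc id = A₁ - U₁ * W := by rw [hF]; rfl
  have hF₂ : (Q * A).submatrix Fin.succ id = A₁ * Z - U₂ * W := by
    rw [hF]
    ext i k
    have h1 : A i.succ k = A₁ i k * expFreq (f k) := by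
      simp [A, A₁, vander, pow_succ]
    have h2 : (A₁ * Z) i k = A₁ i k * expFreq (f k) := mul_diagonal _ _ _ _
    change A i.succ k - (U * W) i.succ k = (A₁ * Z) i k - (U₂ * W) i k
    rw [h1, h2]; rfl
  set F₁ := (Q * A).submatrix Fin.castSucc id
  set F₂ := (Q * A).submatrix Fin.succ id
  have hFle : ∀ x, vn ((Q * A) *ᵥ x) ≤ δ * vn (A *ᵥ x) := fun x => by
    rw [← mulVec_mulVec]; exact hQ x
  have hF₁le : ∀ x, vn (F₁ *ᵥ x) ≤ δ * vn (A *ᵥ x) := fun x =>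
    (vn_comp_le (Fin.castSucc_injective m) ((Q * A) *ᵥ x)).trans (hFle x)
  have hF₂le : ∀ x, vn (F₂ *ᵥ x) ≤ δ * vn (A *ᵥ x) := fun x =>
    (vn_comp_le (Fin.succ_injective m) ((Q * A) *ᵥ x)).trans (hFle x)
  -- ‖A b‖ ≤ 2 ^ K ‖A₁ b‖ and A₁ b = U₁ W b + F₁ b. Since 2 ^ K δ ≤ 1/2, the contribution of F₁ is
  -- absorbed at the cost of doubling the constant.
  have hlow : ∀ b, a * vn b ≤ 2 ^ (K + 1) * vn (U₁ *ᵥ (W *ᵥ b)) := fun b => by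
    have h1 : U₁ *ᵥ (W *ᵥ b) = A₁ *ᵥ b - F₁ *ᵥ b := by
      rw [hF₁, ← sub_mulVec, sub_sub_cancel, mulVec_mulVec]
    have h2 : vn (A₁ *ᵥ b) ≤ vn (U₁ *ᵥ (W *ᵥ b)) + vn (F₁ *ᵥ b) := by
      refine le_trans (le_of_eq ?_) (vn_add_le _ _)
      rw [h1, sub_add_cancel]
    have h3 := vn_vander_succ_le f hKm b
    have h4 : (0 : ℝ) < 2 ^ K := by positivity
    have h5 := mul_le_mul_of_nonneg_left (h2.trans (add_le_add_right (hF₁le b) _)) h4.le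
    have h6 := mul_le_mul_of_nonneg_right hδ (vn_nonneg (A *ᵥ b))
    rw [pow_succ] at h6 ⊢
    have h7 : vn (A *ᵥ b) ≤ 2 ^ K * vn (A₁ *ᵥ b) := h3
    nlinarith [hA b]
  have hinj : ∀ b, U₁ *ᵥ (W *ᵥ b) = 0 → b = 0 := fun b hb => by
    have h1 := hlow b
    rw [hb, vn_zero, mul_zero] at h1
    by_contra hne
    exact absurd h1 (not_le.2 (mul_pos ha (vn_pos hne)))
  have hWunit : IsUnit W := by
    rw [← mulVec_injective_iff_isUnit]
    refine (injective_iff_map_eq_zero (mulVecLin W)).2 fun b hb => hinj b ?_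
    rw [mulVecLin_apply] at hb
    rw [hb, mulVec_zero]
  have hWdet := (isUnit_iff_isUnit_det W).1 hWunit
  -- By `hlow` U₁ W is injective and W is invertible, so U₁ has full column rank and its
  -- pseudo-inverse is a left inverse.
  have hXU : X * U₁ = 1 := by
    refine ext_of_mulVec_single fun j => ?_
    rw [one_mulVec]
    set y : Fin K → ℂ := Pi.single j 1
    have h1 : U₁ *ᵥ (W *ᵥ (W⁻¹ *ᵥ ((X * U₁) *ᵥ y - y))) = 0 := by
      rw [mulVec_mulVec _ W, mul_nonsing_inv W hWdet, one_mulVec, mulVec_sub, mulVec_mulVec,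
        ← Matrix.mul_assoc, hX.mul_mul_left, sub_self]
    have h2 := hinj _ h1
    have h3 := congrArg (fun v => W *ᵥ v) h2
    simp only [mulVec_zero] at h3
    rw [mulVec_mulVec, mul_nonsing_inv W hWdet, one_mulVec] at h3
    exact sub_eq_zero.1 h3
  set G := F₁ * Z - F₂ with hG
  -- The shift relation inherited by U: the terms A₁ Z cancel and only the residuals remain.
  have hGeq : U₂ * W = G + U₁ * W * Z := by
    rw [hG, hF₁, hF₂, Matrix.sub_mul]; abel
  have hGle : ∀ x, vn (G *ᵥ x) ≤ 2 * δ * specNorm A * vn x := fun x => by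
    have h1 : vn (Z *ᵥ x) ≤ 1 * vn x :=
      vn_diagonal_mulVec_le (fun k => (norm_expFreq _).le) zero_le_one x
    rw [hG, sub_mulVec, ← mulVec_mulVec]
    have h2 := (hF₁le (Z *ᵥ x)).trans (mul_le_mul_of_nonneg_left ((vn_mulVec_le A _).trans
      (mul_le_mul_of_nonneg_left h1 (specNorm_nonneg A))) hδ0)
    have h3 := (hF₂le x).trans (mul_le_mul_of_nonneg_left (vn_mulVec_le A x) hδ0)
    linarith [vn_sub_le (F₁ *ᵥ (Z *ᵥ x)) (F₂ *ᵥ x)]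
  refine ⟨W⁻¹ * (X * G), ?_, ?_⟩
  · have h1 : Z + W⁻¹ * (X * G) = W⁻¹ * (X * U₂) * W := by
      rw [Matrix.mul_assoc, Matrix.mul_assoc, hGeq, Matrix.mul_add, Matrix.mul_add,
        Matrix.mul_assoc U₁, ← Matrix.mul_assoc X U₁, hXU, Matrix.one_mul, ← Matrix.mul_assoc W⁻¹ W,
        nonsing_inv_mul W hWdet, Matrix.one_mul, add_comm]
    rw [h1]
    obtain ⟨u, hu⟩ := hWunit
    rw [← hu, charpoly_units_conj']
  · refine specNorm_le (by have := specNorm_nonneg A; positivity) fun x => ?_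
    -- Applying U₁ W to B x = W⁻¹ X G x yields U₁ X G x, and U₁ X is an orthogonal projection. Thus
    -- neither ‖X‖ nor ‖W⁻¹‖ has to be estimated separately.
    have h1 := hlow ((W⁻¹ * (X * G)) *ᵥ x)
    have h2 : U₁ *ᵥ (W *ᵥ ((W⁻¹ * (X * G)) *ᵥ x)) = (U₁ * X) *ᵥ (G *ᵥ x) := by
      simp only [mulVec_mulVec]
      rw [← Matrix.mul_assoc W, mul_nonsing_inv W hWdet, Matrix.one_mul, Matrix.mul_assoc]
    have h3 := vn_mulVec_le_of_isHermitian_of_idempotent hX.hermitian_left (by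
      rw [← Matrix.mul_assoc, hX.mul_mul_left]) (G *ᵥ x)
    rw [h2] at h1
    rw [div_mul_eq_mul_div, le_div_iff₀ ha]
    have h4 : (0 : ℝ) ≤ 2 ^ (K + 1) := by positivity
    have h5 := mul_le_mul_of_nonneg_left (h3.trans (hGle x)) h4
    calc _ = a * vn ((W⁻¹ * (X * G)) *ᵥ x) := mul_comm _ _
      _ ≤ _ := h1.trans h5
      _ = _ := by ring

end ShiftInvariance
end ESPRIT

namespace ESPRIT

/-! ### Matching eigenvalues with nodes. -/

section Matching

variable {K : ℕ}

/-- Fibres of equal cardinality are put in bijection one by one and the bijections are glued. -/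
lemma exists_perm_comp_eq {α β : Type*} [Fintype α] [DecidableEq β] {f g : α → β}
    (h : ∀ b, (Finset.univ.filter fun a => f a = b).card =
      (Finset.univ.filter fun a => g a = b).card) : ∃ ψ : Equiv.Perm α, ∀ a, f (ψ a) = g a := by
  have e : ∀ b, Nonempty ({a // g a = b} ≃ {a // f a = b}) := fun b =>
    ⟨Fintype.equivOfCardEq (by rw [Fintype.card_subtype, Fintype.card_subtype, h b])⟩
  let e' := fun b => (e b).some
  refine ⟨(Equiv.sigmaFiberEquiv g).symm.trans ((Equiv.sigmaCongrRight e').trans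
    (Equiv.sigmaFiberEquiv f)), fun a => ?_⟩
  exact (e' (g a) ⟨a, rfl⟩).2

/-- The Bauer–Fike bound for a diagonal matrix. -/
lemma exists_norm_sub_le_of_det_eq_zero {z : Fin K → ℂ} {B : Matrix (Fin K) (Fin K) ℂ} {η : ℝ}
    (hB : specNorm B ≤ η) {μ : ℂ}
    (hμ : (Matrix.scalar (Fin K) μ - (Matrix.diagonal z + B)).det = 0) :
    ∃ k, ‖μ - z k‖ ≤ η := by
  obtain ⟨v, hv0, hv⟩ := exists_mulVec_eq_zero_iff.2 hμ
  by_contra! hcon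
  have h1 : ∀ k, (μ - z k) * v k = (B *ᵥ v) k := fun k => by
    have := congrFun hv k
    rw [sub_mulVec, add_mulVec, scalar_apply, Pi.sub_apply, Pi.add_apply, mulVec_diagonal,
      mulVec_diagonal, Pi.zero_apply] at this
    linear_combination this
  have h2 : vn (B *ᵥ v) ^ 2 ≤ η ^ 2 * vn v ^ 2 := by
    rw [← mul_pow]
    exact pow_le_pow_left₀ (vn_nonneg _) ((vn_mulVec_le B v).trans
      (mul_le_mul_of_nonneg_right hB (vn_nonneg v))) 2
  have hη : 0 ≤ η := (specNorm_nonneg B).trans hB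
  obtain ⟨k, hk⟩ := Function.ne_iff.1 hv0
  rw [vn_sq, vn_sq, Finset.mul_sum] at h2
  refine absurd h2 (not_le.2 (Finset.sum_lt_sum (fun i _ => ?_) ⟨k, Finset.mem_univ k, ?_⟩))
  · rw [← h1, norm_mul, mul_pow]
    exact mul_le_mul_of_nonneg_right (pow_le_pow_left₀ hη (hcon i).le 2) (sq_nonneg _)
  · rw [← h1, norm_mul, mul_pow]
    exact mul_lt_mul_of_pos_right (pow_lt_pow_left₀ (hcon k) hη two_ne_zero)
      (pow_pos (norm_pos_iff.2 hk) 2)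

/-- Both families enumerate the roots of the same polynomial, so they agree as multisets. -/
lemma card_filter_eq_of_forall_prod_eq {w w' : Fin K → ℂ}
    (h : ∀ μ, ∏ k, (μ - w k) = ∏ k, (μ - w' k)) (D : Set ℂ) [DecidablePred (· ∈ D)] :
    (Finset.univ.filter fun k => w k ∈ D).card = (Finset.univ.filter fun k => w' k ∈ D).card := by
  have h1 : (∏ k, (Polynomial.X - Polynomial.C (w k))) =
      ∏ k, (Polynomial.X - Polynomial.C (w' k)) := by
    refine Polynomial.funext fun μ => ?_
    simpa [Polynomial.eval_prod] using h μ
  have hroots : ∀ u : Fin K → ℂ, (∏ k, (Polynomial.X - Polynomial.C (u k))).roots =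
      Finset.univ.val.map u := fun u => by
    rw [← Polynomial.roots_multiset_prod_X_sub_C (Finset.univ.val.map u), Multiset.map_map]
    rfl
  have h2 : Finset.univ.val.map w = Finset.univ.val.map w' := by rw [← hroots, ← hroots, h1]
  have h3 := congrArg (Multiset.countP (· ∈ D)) h2
  rwa [Multiset.countP_map, Multiset.countP_map] at h3

/-- Along a segment of matrices whose eigenvalues stay in the union of two disjoint compact sets,
the number of eigenvalues in each of the sets is constant. -/
lemma card_eigenvalues_mem_eq {M : ℝ → Matrix (Fin K) (Fin K) ℂ} (hM : Continuous M)
    {D₁ D₂ : Set ℂ} [DecidablePred (· ∈ D₁)] (h₁ : IsCompact D₁) (h₂ : IsCompact D₂)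
    (hD : Disjoint D₁ D₂)
    (hmem : ∀ t ∈ Set.Icc (0 : ℝ) 1, ∀ μ, (Matrix.scalar (Fin K) μ - M t).det = 0 → μ ∈ D₁ ∪ D₂)
    {w₀ w₁ : Fin K → ℂ} (hw₀ : ∀ μ, (Matrix.scalar (Fin K) μ - M 0).det = ∏ k, (μ - w₀ k))
    (hw₁ : ∀ μ, (Matrix.scalar (Fin K) μ - M 1).det = ∏ k, (μ - w₁ k)) :
    (Finset.univ.filter fun k => w₀ k ∈ D₁).card =
      (Finset.univ.filter fun k => w₁ k ∈ D₁).card := by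
  classical
  have hex : ∀ t, ∃ w : Fin K → ℂ, ∀ μ, (Matrix.scalar (Fin K) μ - M t).det = ∏ k, (μ - w k) := by
    intro t
    have hs := IsAlgClosed.splits (M t).charpoly
    have hcard : Multiset.card (M t).charpoly.roots = K := by
      rw [← hs.natDegree_eq_card_roots, charpoly_natDegree_eq_dim, Fintype.card_fin]
    obtain ⟨l, hl⟩ : ∃ l : List ℂ, (M t).charpoly.roots = l := ⟨_, (Multiset.coe_toList _).symm⟩
    rw [hl, Multiset.coe_card] at hcard
    subst hcard
    refine ⟨fun k => l[k], fun μ => ?_⟩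
    rw [← eval_charpoly, hs.eq_prod_roots_of_monic (charpoly_monic _), hl, Multiset.map_coe,
      Multiset.prod_coe, Polynomial.eval_list_prod, List.map_map, ← List.prod_ofFn]
    congr 1
    apply List.ext_getElem <;> simp
  -- Pairs of a parameter t and an enumeration of the eigenvalues of M t whose entries lie in D₁ for
  -- indices in I and in D₂ otherwise. Compactness of this set replaces any continuous choice of
  -- eigenvalues.
  let P : Finset (Fin K) → Set (ℝ × (Fin K → ℂ)) := fun I =>
    (Set.Icc (0 : ℝ) 1 ×ˢ Set.univ.pi fun k => if k ∈ I then D₁ else D₂) ∩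
      {p | ∀ μ, (Matrix.scalar (Fin K) μ - M p.1).det = ∏ k, (μ - p.2 k)}
  have hP : ∀ I, IsCompact (P I) := fun I => by
    refine IsCompact.inter_right (isCompact_Icc.prod (isCompact_univ_pi fun k => ?_)) ?_
    · split_ifs <;> assumption
    · rw [Set.ofPred_forall]
      exact isClosed_iInter fun μ => isClosed_eq (by fun_prop) (by fun_prop)
  -- Parameters admitting an enumeration whose count in D₁ satisfies p. If the counts at 0 and 1
  -- differed, the closed sets for "= n" and "≠ n" would both be nonempty and cover [0, 1];
  -- connectedness gives a common t, where two enumerations of one spectrum have different counts.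
  let S : (ℕ → Prop) → Set ℝ := fun p =>
    ⋃ I : {I : Finset (Fin K) // p I.card}, Prod.fst '' P I
  have hS : ∀ p, IsClosed (S p) := fun p =>
    isClosed_iUnion_of_finite fun I => ((hP I).image continuous_fst).isClosed
  have hcount : ∀ I t w, (t, w) ∈ P I → (Finset.univ.filter fun k => w k ∈ D₁) = I := by
    intro I t w h
    ext k
    have hk := h.1.2 k (Set.mem_univ k)
    simp only [Finset.mem_filter, Finset.mem_univ, true_and]
    by_cases hkI : k ∈ I
    · simpa [hkI] using hk
    · simp only [hkI, if_false, iff_false] at hk ⊢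
      exact fun hk' => Set.disjoint_left.1 hD hk' hk
  have hmemS : ∀ t ∈ Set.Icc (0 : ℝ) 1, ∀ w : Fin K → ℂ,
      (∀ μ, (Matrix.scalar (Fin K) μ - M t).det = ∏ k, (μ - w k)) →
      (t, w) ∈ P (Finset.univ.filter fun k => w k ∈ D₁) := by
    intro t ht w hw
    refine ⟨⟨ht, fun k _ => ?_⟩, hw⟩
    have : w k ∈ D₁ ∪ D₂ := hmem t ht _ (by
      rw [hw]; exact Finset.prod_eq_zero (Finset.mem_univ k) (sub_self _))
    simp only [Finset.mem_filter, Finset.mem_univ, true_and]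
    split_ifs with h
    · exact h
    · exact this.resolve_left h
  by_contra hne
  set n := (Finset.univ.filter fun k => w₀ k ∈ D₁).card with hn
  have hcover : Set.Icc (0 : ℝ) 1 ⊆ S (· = n) ∪ S (· ≠ n) := fun t ht => by
    obtain ⟨w, hw⟩ := hex t
    have h := hmemS t ht w hw
    by_cases hc : (Finset.univ.filter fun k => w k ∈ D₁).card = n
    · exact Or.inl (Set.mem_iUnion.2 ⟨⟨_, hc⟩, (t, w), h, rfl⟩)
    · exact Or.inr (Set.mem_iUnion.2 ⟨⟨_, hc⟩, (t, w), h, rfl⟩)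
  have h0 : (0 : ℝ) ∈ Set.Icc (0 : ℝ) 1 := by simp
  have h1 : (1 : ℝ) ∈ Set.Icc (0 : ℝ) 1 := by simp
  obtain ⟨t, -, ht₁, ht₂⟩ :=
    isPreconnected_closed_iff.1 (isPreconnected_Icc (a := (0 : ℝ)) (b := 1))
    _ _ (hS (· = n)) (hS (· ≠ n)) hcover
    ⟨0, h0, Set.mem_iUnion.2 ⟨⟨_, rfl⟩, (0, w₀), hmemS 0 h0 w₀ hw₀, rfl⟩⟩
    ⟨1, h1, Set.mem_iUnion.2 ⟨⟨_, fun h => hne h.symm⟩, (1, w₁), hmemS 1 h1 w₁ hw₁, rfl⟩⟩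
  obtain ⟨⟨I, hI⟩, ⟨t₁, u⟩, hu, rfl⟩ := Set.mem_iUnion.1 ht₁
  obtain ⟨⟨J, hJ⟩, ⟨t₂, v⟩, hv, hvt⟩ := Set.mem_iUnion.1 ht₂
  obtain rfl : t₂ = t₁ := hvt
  have := card_filter_eq_of_forall_prod_eq (w := u) (w' := v)
    (fun μ => by rw [← hu.2 μ, ← hv.2 μ]) D₁
  rw [hcount _ _ _ hu, hcount _ _ _ hv] at this
  exact hJ (this ▸ hI)

/-- The eigenvalues of a perturbed diagonal matrix can be matched with the diagonal entries. -/
lemma exists_perm_eigenvalues_le {z w : Fin K → ℂ} {B : Matrix (Fin K) (Fin K) ℂ} {η : ℝ}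
    (hB : specNorm B ≤ η)
    (hw : (Matrix.diagonal z + B).charpoly = ∏ k, (Polynomial.X - Polynomial.C (w k))) :
    ∃ ψ : Equiv.Perm (Fin K), ∀ k, ‖w (ψ k) - z k‖ ≤ (2 * K - 1) * η := by
  classical
  have hη : 0 ≤ η := (specNorm_nonneg B).trans hB
  set M : ℝ → Matrix (Fin K) (Fin K) ℂ := fun t => Matrix.diagonal z + (t : ℂ) • B with hMdef
  have hM : Continuous M := by fun_prop
  have hMη : ∀ t ∈ Set.Icc (0 : ℝ) 1, ∀ μ, (Matrix.scalar (Fin K) μ - M t).det = 0 →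
      ∃ k, ‖μ - z k‖ ≤ η := fun t ht μ hμ => by
    refine exists_norm_sub_le_of_det_eq_zero ?_ hμ
    rw [specNorm_smul, Complex.norm_real, Real.norm_of_nonneg ht.1]
    exact (mul_le_of_le_one_left (specNorm_nonneg B) ht.2).trans hB
  have hw₀ : ∀ μ, (Matrix.scalar (Fin K) μ - M 0).det = ∏ k, (μ - z k) := fun μ => by
    simp [hMdef, scalar_apply, diagonal_sub, det_diagonal]
  have hw₁ : ∀ μ, (Matrix.scalar (Fin K) μ - M 1).det = ∏ k, (μ - w k) := fun μ => by
    rw [← eval_charpoly]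
    simp [hMdef, hw, Polynomial.eval_prod]
  have hnear : ∀ k, ∃ j, ‖w k - z j‖ ≤ η := fun k => hMη 1 (by simp) _ (by
    rw [hw₁]; exact Finset.prod_eq_zero (Finset.mem_univ k) (sub_self _))
  choose j hj using hnear
  -- Two nodes are adjacent when their closed η-discs may meet, so the discs of different components
  -- are disjoint.
  let G : SimpleGraph (Fin K) := SimpleGraph.fromRel fun a b => ‖z a - z b‖ ≤ 2 * η
  have hadj : ∀ a b, G.Adj a b → ‖z a - z b‖ ≤ 2 * η := fun a b h => by
    rcases ((SimpleGraph.fromRel_adj _ _ _).1 h).2 with h | h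
    · exact h
    · rwa [norm_sub_rev]
  have hcomp : ∀ a b, ‖z a - z b‖ ≤ 2 * η →
      G.connectedComponentMk a = G.connectedComponentMk b := fun a b h => by
    by_cases hab : a = b
    · rw [hab]
    · exact SimpleGraph.ConnectedComponent.sound
        (SimpleGraph.Adj.reachable ((SimpleGraph.fromRel_adj _ _ _).2 ⟨hab, Or.inl h⟩))
  have hwalk : ∀ {a b} (p : G.Walk a b), ‖z a - z b‖ ≤ p.length * (2 * η) := by
    intro a b p
    induction p with
    | nil => simp
    | cons h p ih =>
      have h1 := hadj _ _ h
      have h2 := norm_sub_le_norm_sub_add_norm_sub (z _) (z _) (z _) |>.trans (add_le_add h1 ih)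
      rw [SimpleGraph.Walk.length_cons]
      push_cast
      linarith
  have hsame : ∀ a b, G.connectedComponentMk a = G.connectedComponentMk b →
      ‖z a - z b‖ ≤ (K - 1) * (2 * η) := fun a b h => by
    -- A path visits at most K nodes, hence has at most K - 1 edges, each of length at most 2η.
    obtain ⟨p, hp⟩ := (SimpleGraph.ConnectedComponent.exact h).exists_isPath
    have h1 := hp.length_lt
    rw [Fintype.card_fin] at h1
    refine (hwalk p).trans (mul_le_mul_of_nonneg_right ?_ (by linarith))
    have : ((p.length + 1 : ℕ) : ℝ) ≤ K := by exact_mod_cast h1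
    push_cast at this
    linarith
  have hfib : ∀ c : G.ConnectedComponent,
      (Finset.univ.filter fun k => G.connectedComponentMk (j k) = c).card =
      (Finset.univ.filter fun k => G.connectedComponentMk k = c).card := by
    intro c
    let D : (Fin K → Prop) → Set ℂ := fun p => ⋃ a : {a // p a}, Metric.closedBall (z a) η
    have hDc : ∀ p, IsCompact (D p) := fun p => isCompact_iUnion fun a => isCompact_closedBall _ _
    have hDmem : ∀ p μ, μ ∈ D p ↔ ∃ a, p a ∧ ‖μ - z a‖ ≤ η := fun p μ => by
      simp only [D, Set.mem_iUnion, Metric.mem_closedBall, dist_eq_norm, Subtype.exists,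
        exists_prop]
    have hDcomp : ∀ μ a b, ‖μ - z a‖ ≤ η → ‖μ - z b‖ ≤ η →
        G.connectedComponentMk a = G.connectedComponentMk b := fun μ a b ha hb => by
      refine hcomp a b ?_
      rw [norm_sub_rev] at ha
      linarith [norm_sub_le_norm_sub_add_norm_sub (z a) μ (z b)]
    have hiff : ∀ μ a, ‖μ - z a‖ ≤ η →
        (μ ∈ D (fun a => G.connectedComponentMk a = c) ↔ G.connectedComponentMk a = c) := by
      intro μ a ha
      rw [hDmem]
      exact ⟨fun ⟨b, hb, hμb⟩ => (hDcomp μ a b ha hμb).trans hb, fun h => ⟨a, h, ha⟩⟩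
    -- By Bauer–Fike the eigenvalues of Z + t B stay in the discs for all t in [0, 1]. So the discs
    -- of c contain as many eigenvalues at t = 1 as at t = 0, where the eigenvalues are the nodes.
    have key := card_eigenvalues_mem_eq hM (hDc fun a => G.connectedComponentMk a = c)
      (hDc fun a => ¬ G.connectedComponentMk a = c)
      (Set.disjoint_left.2 fun μ h h' => by
        obtain ⟨a, ha, hμa⟩ := (hDmem _ _).1 h
        obtain ⟨b, hb, hμb⟩ := (hDmem _ _).1 h'
        exact hb ((hDcomp μ b a hμb hμa).trans ha))
      (fun t ht μ hμ => by
        obtain ⟨a, ha⟩ := hMη t ht μ hμ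
        by_cases hac : G.connectedComponentMk a = c
        · exact Or.inl ((hDmem _ _).2 ⟨a, hac, ha⟩)
        · exact Or.inr ((hDmem _ _).2 ⟨a, hac, ha⟩)) hw₀ hw₁
    rw [Finset.filter_congr fun k _ => hiff (z k) k (by simpa using hη),
      Finset.filter_congr fun k _ => hiff (w k) (j k) (hj k)] at key
    exact key.symm
  obtain ⟨ψ, hψ⟩ := exists_perm_comp_eq hfib
  refine ⟨ψ, fun k => ?_⟩
  have h1 := hj (ψ k)
  have h2 := hsame _ _ (hψ k)
  have h3 := norm_sub_le_norm_sub_add_norm_sub (w (ψ k)) (z (j (ψ k))) (z k)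
  linarith

end Matching
end ESPRIT

namespace ESPRIT

/-! ### Deterministic bound for the frequencies. -/

section Output

variable {m K : ℕ}

/-- The chord has length 2 |sin(π |a - b|)|, and Jordan's inequality gives sin(π d) ≥ 2 d on [0,
1/2]; for larger arguments use the symmetry d ↦ 1 - d. -/
lemma four_mul_min_le_norm_expFreq_sub {a b : ℝ} (ha : a ∈ Set.Ico (0 : ℝ) 1)
    (hb : b ∈ Set.Ico (0 : ℝ) 1) :
    4 * min |a - b| (1 - |a - b|) ≤ ‖expFreq a - expFreq b‖ := by
  have h1 : ‖expFreq a - expFreq b‖ = 2 * |Real.sin (Real.pi * (a - b))| := by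
    have h : expFreq a - expFreq b =
        expFreq b * (Complex.exp (Complex.I * ((2 * Real.pi * (a - b) : ℝ) : ℂ)) - 1) := by
      rw [mul_sub, mul_one, expFreq, expFreq, ← Complex.exp_add]
      congr 2
      push_cast
      ring
    rw [h, norm_mul, norm_expFreq, one_mul, Complex.norm_exp_I_mul_ofReal_sub_one, norm_mul,
      Real.norm_ofNat, Real.norm_eq_abs]
    congr 3
    ring
  have h2 : |Real.sin (Real.pi * (a - b))| = |Real.sin (Real.pi * |a - b|)| := by
    rcases abs_choice (a - b) with h | h
    · rw [h]
    · rw [h, mul_neg, Real.sin_neg, abs_neg]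
  have ht : |a - b| < 1 := by rw [abs_lt]; constructor <;> linarith [ha.1, ha.2, hb.1, hb.2]
  have ht0 := abs_nonneg (a - b)
  rw [h1, h2]
  set t := |a - b|
  have hπ := Real.pi_pos
  have key : ∀ d, 0 ≤ d → d ≤ 1 / 2 → 2 * d ≤ Real.sin (Real.pi * d) := fun d h0 h1 => by
    have := Real.mul_le_sin (x := Real.pi * d) (by positivity) (by nlinarith)
    refine le_trans (le_of_eq ?_) this
    field_simp
  rcases le_total t (1 / 2) with h | h
  · linarith [key t ht0 h, le_abs_self (Real.sin (Real.pi * t)), min_le_left t (1 - t)]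
  · have h3 := key (1 - t) (by linarith) (by linarith)
    rw [show Real.pi * (1 - t) = Real.pi - Real.pi * t by ring, Real.sin_pi_sub] at h3
    linarith [le_abs_self (Real.sin (Real.pi * t)), min_le_right t (1 - t)]

/-- Normalizing z to the circle moves it by |1 - ‖z‖| ≤ ‖z - e^{2πib}‖, which doubles the distance;
the chord estimate then divides by 4. The case z = 0 with an arbitrary angle is included. -/
lemma min_le_norm_sub_expFreq {a b : ℝ} (ha : a ∈ Set.Ico (0 : ℝ) 1)
    (hb : b ∈ Set.Ico (0 : ℝ) 1) {z : ℂ} (hz : z = (‖z‖ : ℂ) * expFreq a) :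
    min |a - b| (1 - |a - b|) ≤ ‖z - expFreq b‖ / 2 := by
  have h1 := four_mul_min_le_norm_expFreq_sub ha hb
  have h2 : ‖expFreq a - z‖ ≤ ‖z - expFreq b‖ := by
    have h3 : expFreq a - z = ((1 - ‖z‖ : ℝ) : ℂ) * expFreq a := by
      push_cast
      linear_combination -hz
    rw [h3, norm_mul, norm_expFreq, mul_one, Complex.norm_real, Real.norm_eq_abs, abs_sub_comm]
    simpa [norm_expFreq] using abs_norm_sub_norm_le z (expFreq b)
  linarith [norm_sub_le_norm_sub_add_norm_sub (expFreq a) z (expFreq b)]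

lemma matchedDist_le {fhat f : Fin K → ℝ} (hK : 1 ≤ K) (ψ : Equiv.Perm (Fin K)) {c : ℝ}
    (h : ∀ k, min |fhat (ψ k) - f k| (1 - |fhat (ψ k) - f k|) ≤ c) : matchedDist fhat f ≤ c := by
  have : Nonempty (Fin K) := ⟨⟨0, hK⟩⟩
  exact (ciInf_le (Set.finite_range _).bddBelow ψ).trans (ciSup_le h)

lemma matchedDist_le_half (fhat f : Fin K → ℝ) (hK : 1 ≤ K) : matchedDist fhat f ≤ 1 / 2 := by
  refine matchedDist_le hK 1 fun k => ?_
  rw [min_le_iff]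
  by_contra! h
  linarith [h.1, h.2]

/-- Deterministic performance bound of ESPRIT. -/
theorem matchedDist_le_of_isOutput (hK : 1 ≤ K) (hKm : K + 1 ≤ m) {f : Fin K → ℝ}
    (hf : ∀ k, f k ∈ Set.Ico (0 : ℝ) 1) (hfinj : Function.Injective f)
    {R : Matrix (Fin m) (Fin m) ℂ} {T : Matrix (Fin K) (Fin K) ℂ} {t s ε : ℝ} (ht : 0 < t)
    (hT : ∀ x, t * vn x ^ 2 ≤ qf T x)
    (hε : specNorm (R - (vander m f * T * (vander m f)ᴴ + (s : ℂ) • 1)) ≤ ε)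
    (hsmall : 2 * ε / (singDesc (vander m f) K ^ 2 * t) * 2 ^ (K + 1) ≤ 1)
    {fhat : Fin K → ℝ} (hout : IsOutput (Nat.le_of_succ_le hKm) R fhat) :
    matchedDist fhat f ≤ (2 * K - 1) * (2 ^ (K + 2) * (2 * ε / (singDesc (vander m f) K ^ 2 * t)) *
      specNorm (vander m f) / singDesc (vander m f) K) / 2 := by
  obtain ⟨m, rfl⟩ : ∃ n, m = n + 1 := ⟨m - 1, by omega⟩
  have hKm' : K ≤ m := by omega
  obtain ⟨V, d, X, z, hVu, hd, hR, ⟨hX, hchar⟩, hz⟩ := hout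
  have hV : Vᴴ * V = 1 := (mem_unitaryGroup_iff').1 hVu
  have ha : 0 < singDesc (vander (m + 1) f) K :=
    singDesc_pos hK (vander_mulVec_eq_zero f hf hfinj (by omega))
  have hA := singDesc_mul_le (vander (m + 1) f) hK
  have hε0 := (specNorm_nonneg _).trans hε
  obtain ⟨B, hB, hBle⟩ := exists_charpoly_eq_diagonal_add f hKm' hV ha hA (by positivity) hsmall
    (vn_trailing_projection_le hV hd hR ht ha hT hA hε) rfl hX
  obtain ⟨ψ, hψ⟩ := exists_perm_eigenvalues_le hBle (hB.symm.trans hchar)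
  refine matchedDist_le hK ψ fun k => ?_
  have := min_le_norm_sub_expFreq (hz (ψ k)).1 (hf k) (hz (ψ k)).2
  linarith [hψ k]

/-- The bound of the main theorem follows from a bound on the perturbation of the covariance
matrix. -/
theorem matchedDist_le_min_of_isOutput (hK : 1 ≤ K) (hKm : K + 1 ≤ m) {f : Fin K → ℝ}
    (hf : ∀ k, f k ∈ Set.Ico (0 : ℝ) 1) (hfinj : Function.Injective f)
    {R : Matrix (Fin m) (Fin m) ℂ} {T : Matrix (Fin K) (Fin K) ℂ} {lam s ε q : ℝ} (hlam : 0 < lam)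
    (hT : ∀ x, lam / 8 * vn x ^ 2 ≤ qf T x)
    (hε : specNorm (R - (vander m f * T * (vander m f)ᴴ + (s : ℂ) • 1)) ≤ ε)
    (hq : ε ≤ 72 * √m * q)
    {fhat : Fin K → ℝ} (hout : IsOutput (Nat.le_of_succ_le hKm) R fhat) :
    matchedDist fhat f ≤ min 1 (72 * 2 ^ (2 * K + 5) * (K : ℝ) ^ (3 / 2 : ℝ) * m /
      (singDesc (vander m f) K ^ 3 * lam) * q) := by
  have hhalf := matchedDist_le_half fhat f hK
  refine le_min (by linarith) ?_
  set a := singDesc (vander m f) K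
  have ha : 0 < a := singDesc_pos hK (vander_mulVec_eq_zero f hf hfinj (by omega))
  have hK1 : (1 : ℝ) ≤ K := by exact_mod_cast hK
  have hm0 : (0 : ℝ) < m := by
    have : 0 < m := by omega
    exact_mod_cast this
  have hsm : 0 < √(m : ℝ) := Real.sqrt_pos.2 hm0
  have hsm2 : √(m : ℝ) * √m = m := Real.mul_self_sqrt hm0.le
  have hsK : 1 ≤ √(K : ℝ) := Real.one_le_sqrt.2 hK1
  have hpow : (K : ℝ) ^ (3 / 2 : ℝ) = K * √K := by
    rw [Real.sqrt_eq_rpow, ← Real.rpow_one_add' (by positivity) (by norm_num)]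
    norm_num
  have hAle : specNorm (vander m f) ≤ √m * √K := by
    rw [← Real.sqrt_mul hm0.le]; exact specNorm_vander_le f
  have haA : a ≤ specNorm (vander m f) := by
    have : Nonempty (Fin K) := ⟨⟨0, hK⟩⟩
    set e : Fin K → ℂ := Pi.single ⟨0, hK⟩ 1
    have he : 0 < vn e := vn_pos (by simp [e])
    exact le_of_mul_le_mul_right ((singDesc_mul_le _ hK e).trans (vn_mulVec_le _ e)) he
  have hε0 : 0 ≤ ε := (specNorm_nonneg _).trans hε
  have hq0 : 0 ≤ q := by
    by_contra! h
    have : 72 * √(m : ℝ) * q < 0 := mul_neg_of_pos_of_neg (by positivity) h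
    linarith
  have hp1 : (1 : ℝ) ≤ 2 ^ K := one_le_pow₀ (by norm_num)
  have h2K : (2 : ℝ) ^ (2 * K + 5) = 2 ^ K * 2 ^ K * 32 := by rw [two_mul]; ring
  set c := 72 * 2 ^ (2 * K + 5) * (K : ℝ) ^ (3 / 2 : ℝ) * m / (a ^ 3 * lam) * q with hc
  set p : ℝ := 2 ^ K
  have hcval : c * (a ^ 3 * lam) = 72 * (p * p * 32) * (K * √K) * m * q := by
    rw [hc, hpow, h2K]; field_simp
  -- The matched distance never exceeds 1/2, so only c < 1/2 needs an argument, and that inequality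
  -- supplies the smallness of ε.
  rcases le_or_gt (1 / 2) c with hbig | hlt
  · linarith
  have hg : 0 < a ^ 2 * (lam / 8) := by positivity
  have hsmall : 2 * ε / (a ^ 2 * (lam / 8)) * 2 ^ (K + 1) ≤ 1 := by
    rw [div_mul_eq_mul_div, div_le_one hg, pow_succ]
    change 2 * ε * (p * 2) ≤ _
    have h1 : 72 * (p * p * 32) * (K * √K) * m * q ≤ a ^ 3 * lam * (1 / 2) := by
      rw [← hcval]; nlinarith [mul_pos (pow_pos ha 3) hlam]
    -- One factor a is replaced by its upper bound ‖A‖ ≤ √(m K); it cancels a factor √m √K on the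
    -- other side.
    have h2 : a ^ 3 * lam * (1 / 2) ≤ a ^ 2 * lam * (√m * √K) * (1 / 2) := by
      have := haA.trans hAle
      have h3 : 0 ≤ a ^ 2 * lam * (1 / 2) := by positivity
      nlinarith
    have h3 : 72 * (p * p * 32) * K * √m * q ≤ a ^ 2 * lam * (1 / 2) := by
      refine le_of_mul_le_mul_right ?_ (mul_pos hsm (lt_of_lt_of_le one_pos hsK))
      calc _ = 72 * (p * p * 32) * (K * √K) * (√m * √m) * q := by ring
        _ ≤ _ := by rw [hsm2]; linarith
    have h4 : 72 * (p * 32) * √m * q ≤ 72 * (p * p * 32) * K * √m * q := by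
      have : p ≤ p * p * K := by nlinarith
      have h0 : 0 ≤ 72 * 32 * √m * q := by positivity
      nlinarith
    have h5 : 2 * ε * (p * 2) ≤ 2 * (72 * √m * q) * (p * 2) := by gcongr
    linarith
  refine (matchedDist_le_of_isOutput hK hKm hf hfinj (by positivity) hT hε hsmall hout).trans ?_
  have hc0 : 0 < a ^ 3 * lam := by positivity
  rw [← mul_le_mul_iff_left₀ hc0, hcval]
  have e1 : (2 * (K : ℝ) - 1) * (2 ^ (K + 2) * (2 * ε / (a ^ 2 * (lam / 8))) *
      specNorm (vander m f) / a) / 2 * (a ^ 3 * lam) =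
      (2 * K - 1) * (p * 32) * ε * specNorm (vander m f) := by
    rw [pow_add]; field_simp; ring
  rw [e1]
  calc (2 * (K : ℝ) - 1) * (p * 32) * ε * specNorm (vander m f)
      ≤ (2 * K) * (p * 32) * (72 * √m * q) * (√m * √K) := by
        gcongr
        · exact specNorm_nonneg _
        · linarith
    _ = 2 * (72 * (p * 32) * (K * √K) * (√m * √m) * q) := by ring
    _ ≤ _ := by
        rw [hsm2]
        -- The 2 left from bounding 2K - 1 by 2K is absorbed by the second factor 2 ^ K of the
        -- target.
        have h2p : 2 ≤ p := by
          calc (2 : ℝ) = 2 ^ 1 := by norm_num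
            _ ≤ 2 ^ K := pow_le_pow_right₀ (by norm_num) hK
        have h0 : 0 ≤ 72 * 32 * (K * √K) * m * q * p := by positivity
        nlinarith

end Output
end ESPRIT

namespace ESPRIT

/-! ### Nets of spheres. -/

section Net

open Metric Module

-- Volume comparison: the balls of radius 1/16 about the points are disjoint and lie in the ball of
-- radius 17/16.
open scoped ENNReal Function in
lemma card_le_of_separated_sphere {E : Type*} [NormedAddCommGroup E] [NormedSpace ℝ E]
    [FiniteDimensional ℝ E] (s : Finset E) (hs : ∀ c ∈ s, ‖c‖ = 1)
    (h : ∀ c ∈ s, ∀ d ∈ s, c ≠ d → 1 / 8 ≤ ‖c - d‖) : s.card ≤ 17 ^ finrank ℝ E := by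
  borelize E
  let μ : Measure E := Measure.addHaar
  have D : Set.Pairwise (s : Set E) (Disjoint on fun c => ball (c : E) (1 / 16)) := by
    rintro c hc d hd hcd
    apply ball_disjoint_ball
    rw [dist_eq_norm]
    refine le_trans ?_ (h c hc d hd hcd)
    norm_num
  have A_subset : (⋃ c ∈ s, ball (c : E) (1 / 16)) ⊆ ball (0 : E) (17 / 16) := by
    refine Set.iUnion₂_subset fun x hx => ball_subset_ball' ?_
    rw [dist_zero_right, hs x hx]
    norm_num
  have I : (s.card : ℝ≥0∞) * ENNReal.ofReal ((1 / 16) ^ finrank ℝ E) * μ (ball 0 1) ≤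
      ENNReal.ofReal ((17 / 16) ^ finrank ℝ E) * μ (ball 0 1) :=
    calc _ = μ (⋃ c ∈ s, ball (c : E) (1 / 16)) := by
          rw [measure_biUnion_finset D fun c _ => measurableSet_ball]
          have I : (0 : ℝ) < 1 / 16 := by norm_num
          simp only [μ.addHaar_ball_of_pos _ I, Finset.sum_const, nsmul_eq_mul, mul_assoc]
      _ ≤ μ (ball (0 : E) (17 / 16)) := measure_mono A_subset
      _ = _ := by rw [μ.addHaar_ball_of_pos _ (by norm_num)]
  have J := (ENNReal.mul_le_mul_iff_left (measure_ball_pos _ _ zero_lt_one).ne'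
    measure_ball_lt_top.ne).1 I
  have K : (s.card : ℝ) ≤ (17 : ℝ) ^ finrank ℝ E := by
    have := ENNReal.toReal_le_of_le_ofReal (by positivity) J
    rw [ENNReal.toReal_mul, ENNReal.toReal_natCast, ENNReal.toReal_ofReal (by positivity), div_pow,
      div_pow, one_pow, mul_one_div] at this
    exact (div_le_div_iff_of_pos_right (by positivity)).1 this
  exact_mod_cast K

/-- The unit sphere of a complex space of dimension `n` has a `1/8`-net with at most `17 ^ (2 n)`
points. -/
lemma exists_net (E : Type*) [NormedAddCommGroup E] [NormedSpace ℂ E] [FiniteDimensional ℂ E] :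
    ∃ s : Finset E, (∀ x ∈ s, ‖x‖ = 1) ∧ s.card ≤ 289 ^ finrank ℂ E ∧
      ∀ x : E, ‖x‖ = 1 → ∃ y ∈ s, ‖x - y‖ ≤ 1 / 8 := by
  classical
  let _ : NormedSpace ℝ E := NormedSpace.restrictScalars ℝ ℂ E
  have : FiniteDimensional ℝ E := FiniteDimensional.complexToReal E
  have hcard : (289 : ℕ) ^ finrank ℂ E = 17 ^ finrank ℝ E := by
    rw [finrank_real_of_complex, pow_mul]
    norm_num
  -- A separated set of greatest cardinality is a net, since a point at distance more than 1/8 from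
  -- it could be added. The volume bound makes the greatest cardinality exist.
  let P : ℕ → Prop := fun n => ∃ s : Finset E, (∀ x ∈ s, ‖x‖ = 1) ∧
    (∀ c ∈ s, ∀ d ∈ s, c ≠ d → 1 / 8 ≤ ‖c - d‖) ∧ s.card = n
  have hbound : ∀ n, P n → n ≤ 17 ^ finrank ℝ E := by
    rintro n ⟨s, h1, h2, rfl⟩
    exact card_le_of_separated_sphere s h1 h2
  have hP0 : P 0 := ⟨∅, by simp, by simp, rfl⟩
  set N := 17 ^ finrank ℝ E
  obtain ⟨s, h1, h2, h3⟩ : P (Nat.findGreatest P N) := Nat.findGreatest_spec (Nat.zero_le N) hP0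
  refine ⟨s, h1, hcard ▸ card_le_of_separated_sphere s h1 h2, fun x hx => ?_⟩
  by_contra! hcon
  have hxs : x ∉ s := fun h => by
    have := hcon x h
    rw [sub_self, norm_zero] at this
    norm_num at this
  have hP : P (Nat.findGreatest P N + 1) := by
    refine ⟨insert x s, fun y hy => ?_, fun c hc d hd hcd => ?_, ?_⟩
    · rcases Finset.mem_insert.1 hy with rfl | hy
      exacts [hx, h1 y hy]
    · rcases Finset.mem_insert.1 hc with rfl | hc' <;> rcases Finset.mem_insert.1 hd with rfl | hd'
      · exact absurd rfl hcd
      · exact (hcon d hd').le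
      · rw [norm_sub_rev]; exact (hcon c hc').le
      · exact h2 c hc' d hd' hcd
    · rw [Finset.card_insert_of_notMem hxs, h3]
  have := Nat.le_findGreatest (hbound _ hP) hP
  omega

/-- A `1/8`-net of the unit sphere of `ℂ ^ n`. -/
lemma exists_net_vn (n : ℕ) : ∃ s : Finset (Fin n → ℂ), (∀ x ∈ s, vn x = 1) ∧
    s.card ≤ 289 ^ n ∧ ∀ x, vn x = 1 → ∃ y ∈ s, vn (x - y) ≤ 1 / 8 := by
  obtain ⟨s, h1, h2, h3⟩ := exists_net (EuclideanSpace ℂ (Fin n))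
  refine ⟨s.map (WithLp.equiv 2 (Fin n → ℂ)).toEmbedding, ?_, ?_, fun x hx => ?_⟩
  · intro x hx
    obtain ⟨y, hy, rfl⟩ := Finset.mem_map.1 hx
    exact h1 y hy
  · simpa using h2
  · obtain ⟨y, hy, hxy⟩ := h3 (WithLp.toLp 2 x) hx
    exact ⟨y.ofLp, Finset.mem_map.2 ⟨y, hy, rfl⟩, hxy⟩

end Net

/-! ### Complex Gaussian variables and Chernoff bounds. -/

section Gaussian

instance (v : NNReal) : IsProbabilityMeasure (complexGaussian v) :=
  Measure.isProbabilityMeasure_map (by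
    have : Measurable fun p : ℝ × ℝ => Complex.measurableEquivRealProd.symm p :=
      Complex.measurableEquivRealProd.symm.measurable
    exact this.aemeasurable)

lemma measurable_complex_mk : Measurable fun p : ℝ × ℝ => (⟨p.1, p.2⟩ : ℂ) :=
  Complex.measurableEquivRealProd.symm.measurable

lemma integral_exp_mul_sq_gaussianReal {v : NNReal} {t : ℝ} (ht : 2 * v * t < 1) :
    ∫ x, Real.exp (t * x ^ 2) ∂gaussianReal 0 v = (√(1 - 2 * v * t))⁻¹ := by
  by_cases hv : v = 0
  · simp [hv]
  have hv' : (0 : ℝ) < v := lt_of_le_of_ne v.2 (fun h => hv (NNReal.coe_eq_zero.1 h.symm))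
  rw [integral_gaussianReal_eq_integral_smul hv]
  have h1 : ∀ x : ℝ, gaussianPDFReal 0 v x • Real.exp (t * x ^ 2) =
      (√(2 * Real.pi * v))⁻¹ * Real.exp (-((1 - 2 * v * t) / (2 * v)) * x ^ 2) := fun x => by
    rw [gaussianPDFReal, smul_eq_mul, mul_assoc, ← Real.exp_add]
    congr 2
    field_simp
    ring
  simp_rw [h1]
  rw [integral_const_mul, integral_gaussian, ← Real.sqrt_inv, ← Real.sqrt_inv, ← Real.sqrt_mul
    (by positivity)]
  congr 1
  have : 1 - 2 * v * t ≠ 0 := by linarith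
  field_simp

/-- Real and imaginary parts contribute equal factors (1 - v t)^(-1/2), so the square root
disappears. -/
lemma integral_exp_mul_norm_sq_complexGaussian {v : NNReal} {t : ℝ} (ht : v * t < 1) :
    ∫ z, Real.exp (t * ‖z‖ ^ 2) ∂complexGaussian v = (1 - v * t)⁻¹ := by
  rw [complexGaussian, integral_map measurable_complex_mk.aemeasurable
    (by fun_prop : Continuous fun z : ℂ => Real.exp (t * ‖z‖ ^ 2)).aestronglyMeasurable]
  have h1 : ∀ p : ℝ × ℝ, Real.exp (t * ‖(⟨p.1, p.2⟩ : ℂ)‖ ^ 2) =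
      Real.exp (t * p.1 ^ 2) * Real.exp (t * p.2 ^ 2) := fun p => by
    rw [← Real.exp_add, Complex.sq_norm, Complex.normSq_mk]
    ring_nf
  simp_rw [h1]
  have h2 : 2 * ((v / 2 : NNReal) : ℝ) * t = v * t := by push_cast; ring
  rw [integral_prod_mul (fun x => Real.exp (t * x ^ 2)) (fun x => Real.exp (t * x ^ 2)),
    integral_exp_mul_sq_gaussianReal (by rwa [h2]), h2, ← mul_inv,
    Real.mul_self_sqrt (by linarith)]

lemma charFun_complexGaussian (v : NNReal) (t : ℂ) :
    charFun (complexGaussian v) t = Complex.exp (-(v * ‖t‖ ^ 2 / 4 : ℝ)) := by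
  rw [charFun_apply, complexGaussian, integral_map measurable_complex_mk.aemeasurable
    (by fun_prop : Continuous fun z : ℂ => Complex.exp ((inner ℝ z t : ℝ) * Complex.I)
      ).aestronglyMeasurable]
  have h1 : ∀ p : ℝ × ℝ, Complex.exp ((inner ℝ (⟨p.1, p.2⟩ : ℂ) t : ℝ) * Complex.I) =
      Complex.exp (t.re * p.1 * Complex.I) * Complex.exp (t.im * p.2 * Complex.I) := fun p => by
    rw [← Complex.exp_add, Complex.inner]
    simp
    ring_nf
  simp_rw [h1]
  rw [integral_prod_mul (fun x : ℝ => Complex.exp (t.re * x * Complex.I))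
    (fun x : ℝ => Complex.exp (t.im * x * Complex.I)), ← charFun_apply_real, ← charFun_apply_real,
    charFun_gaussianReal, charFun_gaussianReal, ← Complex.exp_add, Complex.sq_norm,
    Complex.normSq_apply]
  congr 1
  push_cast
  ring

variable {Ω : Type*} [MeasurableSpace Ω] {μ : Measure Ω}

/-- A linear combination of independent circularly symmetric complex Gaussian variables is
circularly symmetric complex Gaussian. -/
lemma hasLaw_sum_mul_complexGaussian {ι : Type*} [Fintype ι] {X : ι → Ω → ℂ}
    {v w : NNReal} (hX : iIndepFun X μ) (hlaw : ∀ i, HasLaw (X i) (complexGaussian v) μ)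
    (a : ι → ℂ) (hw : (w : ℝ) = v * vn a ^ 2) :
    HasLaw (fun ω => ∑ i, a i * X i ω) (complexGaussian w) μ := by
  have := hX.isProbabilityMeasure
  have hm : ∀ i, AEMeasurable (fun ω => a i * X i ω) μ := fun i =>
    (hlaw i).aemeasurable.const_mul _
  have hms : AEMeasurable (fun ω => ∑ i, a i * X i ω) μ :=
    Finset.aemeasurable_fun_sum _ fun i _ => hm i
  have : IsProbabilityMeasure (μ.map fun ω => ∑ i, a i * X i ω) :=
    Measure.isProbabilityMeasure_map hms
  refine ⟨hms, Measure.ext_of_charFun ?_⟩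
  rw [(hX.comp (fun i x => a i * x) fun i => measurable_const_mul _).charFun_map_fun_sum_eq_prod hm]
  ext t
  rw [Finset.prod_apply, charFun_complexGaussian, hw, vn_sq, Finset.mul_sum, Finset.sum_mul,
    Finset.sum_div, Complex.ofReal_sum, ← Finset.sum_neg_distrib, Complex.exp_sum]
  refine Finset.prod_congr rfl fun i _ => ?_
  -- Multiplication by a i passes to the dual variable as its conjugate. The characteristic function
  -- sees only the modulus, so the phase of a i is irrelevant.
  have h1 : charFun (μ.map fun ω => a i * X i ω) t =
      charFun (complexGaussian v) (star (a i) * t) := by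
    change charFun (μ.map ((fun x => a i * x) ∘ X i)) t = _
    rw [← (hlaw i).map_eq, ← AEMeasurable.map_map_of_aemeasurable
      (measurable_const_mul (a i)).aemeasurable (hlaw i).aemeasurable, charFun_apply,
      integral_map (measurable_const_mul (a i)).aemeasurable (by fun_prop : Continuous fun z : ℂ =>
        Complex.exp ((inner ℝ z t : ℝ) * Complex.I)).aestronglyMeasurable, charFun_apply]
    congr 1
    ext z
    rw [Complex.inner, Complex.inner]
    simp only [map_mul, RCLike.star_def]
    ring_nf
  rw [h1, charFun_complexGaussian, norm_mul, norm_star]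
  congr 1
  push_cast
  ring

/-- The moment generating function of a sum of squares of independent complex Gaussians. -/
lemma mgf_sum_norm_sq {ι : Type*} [Fintype ι] {Y : ι → Ω → ℂ} {w : NNReal} (hY : iIndepFun Y μ)
    (hlaw : ∀ l, HasLaw (Y l) (complexGaussian w) μ) {t : ℝ} (ht : w * t < 1) :
    mgf (fun ω => ∑ l, ‖Y l ω‖ ^ 2) μ t = ((1 - w * t)⁻¹) ^ Fintype.card ι := by
  have h1 := (hY.comp (fun _ z => ‖z‖ ^ 2) fun _ => by fun_prop).mgf_sum₀ (t := t)
    (fun l => (by fun_prop : Measurable fun z : ℂ => ‖z‖ ^ 2).comp_aemeasurable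
      (hlaw l).aemeasurable) Finset.univ
  have h2 : (∑ l, (fun z : ℂ => ‖z‖ ^ 2) ∘ Y l) = fun ω => ∑ l, ‖Y l ω‖ ^ 2 := by
    ext ω; simp
  rw [h2] at h1
  rw [h1, Finset.prod_congr rfl (g := fun _ => (1 - w * t)⁻¹), Finset.prod_const, Finset.card_univ]
  intro l _
  rw [← integral_exp_mul_norm_sq_complexGaussian ht, mgf]
  exact (hlaw l).integral_comp (f := fun z : ℂ => Real.exp (t * ‖z‖ ^ 2))
    (by fun_prop : Continuous fun z : ℂ => Real.exp (t * ‖z‖ ^ 2)).aestronglyMeasurable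

lemma ae_eq_zero_of_hasLaw_complexGaussian_zero {Y : Ω → ℂ}
    (hY : HasLaw Y (complexGaussian 0) μ) : ∀ᵐ ω ∂μ, Y ω = 0 := by
  have h : complexGaussian 0 = Measure.dirac 0 := by
    rw [complexGaussian]
    simp only [zero_div, gaussianReal_zero_var, Measure.dirac_prod_dirac,
      Measure.map_dirac' measurable_complex_mk]
    rfl
  rw [h] at hY
  exact hY.ae_eq_of_dirac

/-- A non-integrable function has integral 0 by convention, so a nonzero value certifies
integrability. -/
lemma integrable_exp_of_mgf_ne_zero {X : Ω → ℝ} {t : ℝ} (h : mgf X μ t ≠ 0) :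
    Integrable (fun ω => Real.exp (t * X ω)) μ := by
  by_contra hcon
  exact h (integral_undef hcon)

/-- Upper tail of a sum of squares of independent complex Gaussian variables. -/
lemma measureReal_lt_sum_norm_sq_le {ι : Type*} [Fintype ι] {Y : ι → Ω → ℂ} {w : NNReal}
    (hY : iIndepFun Y μ) (hlaw : ∀ l, HasLaw (Y l) (complexGaussian w) μ) {θ : ℝ} (hθ0 : 0 ≤ θ)
    (hθ : θ < 1) (s : ℝ) :
    μ.real {ω | s * w < ∑ l, ‖Y l ω‖ ^ 2} ≤
      Real.exp (-θ * s) * ((1 - θ)⁻¹) ^ Fintype.card ι := by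
  have := hY.isProbabilityMeasure
  -- The Chernoff parameter below is θ / w. For w = 0 the threshold is 0 and the sum vanishes almost
  -- surely.
  by_cases hw : w = 0
  · subst hw
    have h0 : μ {ω | s * (0 : NNReal) < ∑ l, ‖Y l ω‖ ^ 2} = 0 := by
      refine measure_eq_zero_iff_ae_notMem.2 ?_
      filter_upwards [ae_all_iff.2 fun l => ae_eq_zero_of_hasLaw_complexGaussian_zero (hlaw l)]
        with ω hω
      simp [hω]
    rw [measureReal_def, h0, ENNReal.toReal_zero]
    have : 0 < (1 - θ)⁻¹ := inv_pos.2 (by linarith)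
    positivity
  have hw' : (0 : ℝ) < w := lt_of_le_of_ne w.2 (fun h => hw (NNReal.coe_eq_zero.1 h.symm))
  have hmul : (w : ℝ) * (θ / w) = θ := by field_simp
  have hmgf := mgf_sum_norm_sq hY hlaw (t := θ / w) (by rwa [hmul])
  rw [hmul] at hmgf
  have hpos : 0 < (1 - θ)⁻¹ := inv_pos.2 (by linarith)
  have h := measure_ge_le_exp_mul_mgf (s * w) (div_nonneg hθ0 hw'.le)
    (integrable_exp_of_mgf_ne_zero (by rw [hmgf]; positivity))
  rw [hmgf, show -(θ / w) * (s * w) = -θ * s by field_simp] at h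
  refine le_trans (measureReal_mono (fun ω hω => ?_) (measure_ne_top _ _)) h
  exact le_of_lt (Set.mem_ofPred_eq ▸ hω)

/-- Lower tail of a sum of squares of independent complex Gaussian variables. -/
lemma measureReal_sum_norm_sq_lt_le {ι : Type*} [Fintype ι] {Y : ι → Ω → ℂ} {w : NNReal}
    (hY : iIndepFun Y μ) (hlaw : ∀ l, HasLaw (Y l) (complexGaussian w) μ) {θ : ℝ} (hθ0 : 0 ≤ θ)
    (s : ℝ) :
    μ.real {ω | ∑ l, ‖Y l ω‖ ^ 2 < s * w} ≤
      Real.exp (θ * s) * ((1 + θ)⁻¹) ^ Fintype.card ι := by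
  have := hY.isProbabilityMeasure
  by_cases hw : w = 0
  · subst hw
    have h0 : {ω | ∑ l, ‖Y l ω‖ ^ 2 < s * (0 : NNReal)} = ∅ := by
      ext ω
      simp only [NNReal.coe_zero, mul_zero, Set.mem_ofPred_eq, Set.mem_empty_iff_false, iff_false,
        not_lt]
      positivity
    rw [h0, measureReal_empty]
    positivity
  have hw' : (0 : ℝ) < w := lt_of_le_of_ne w.2 (fun h => hw (NNReal.coe_eq_zero.1 h.symm))
  have hmul : (w : ℝ) * (-θ / w) = -θ := by field_simp
  have hmgf := mgf_sum_norm_sq hY hlaw (t := -θ / w) (by rw [hmul]; linarith)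
  rw [hmul, sub_neg_eq_add] at hmgf
  have h := measure_le_le_exp_mul_mgf (s * w)
    (div_nonpos_of_nonpos_of_nonneg (neg_nonpos.2 hθ0) hw'.le)
    (integrable_exp_of_mgf_ne_zero (by rw [hmgf]; positivity))
  rw [hmgf, show -(-θ / w) * (s * w) = θ * s by field_simp] at h
  refine le_trans (measureReal_mono (fun ω hω => ?_) (measure_ne_top _ _)) h
  exact le_of_lt (Set.mem_ofPred_eq ▸ hω)

/-- The rows of a doubly indexed independent family are independent. -/
lemma iIndepFun_curry {ι κ β : Type*} [Countable ι] [Countable κ] [MeasurableSpace β]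
    {X : ι → κ → Ω → β} (hm : ∀ i j, AEMeasurable (X i j) μ)
    (h : iIndepFun (fun (p : ι × κ) ω => X p.1 p.2 ω) μ) :
    iIndepFun (fun i ω j => X i j ω) μ := by
  have := h.isProbabilityMeasure
  have hprob : ∀ i j, IsProbabilityMeasure (μ.map (X i j)) := fun i j =>
    Measure.isProbabilityMeasure_map (hm i j)
  have hrow : ∀ i, AEMeasurable (fun ω j => X i j ω) μ := fun i => aemeasurable_pi_iff.2 (hm i)
  -- Independence is expressed as the joint law being a product; currying carries the product over
  -- pairs to a product of products.
  have h1 := h.map_fun_eq_infinitePi_map₀' (fun p : ι × κ => hm p.1 p.2)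
  have h2 : ∀ i, μ.map (fun ω j => X i j ω) = Measure.infinitePi fun j => μ.map (X i j) := fun i =>
    (h.precomp (g := fun j : κ => (i, j)) fun a b hab => by simpa using hab
      ).map_fun_eq_infinitePi_map₀' (hm i)
  rw [iIndepFun_iff_map_fun_eq_infinitePi_map₀' hrow]
  simp_rw [h2]
  rw [← Measure.infinitePi_map_curry (fun i j => μ.map (X i j)), ← h1,
    AEMeasurable.map_map_of_aemeasurable (by fun_prop)
      (aemeasurable_pi_iff.2 fun p : ι × κ => hm p.1 p.2)]
  rfl

end Gaussian
end ESPRIT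

namespace ESPRIT

/-! ### Norm estimates from nets. -/

section NetBounds

variable {m n : ℕ}

lemma specNorm_le_of_unit {A : Matrix (Fin m) (Fin n) ℂ} {c : ℝ} (hc : 0 ≤ c)
    (h : ∀ x, vn x = 1 → vn (A *ᵥ x) ≤ c) : specNorm A ≤ c := by
  refine specNorm_le hc fun x => ?_
  by_cases hx : x = 0
  · simp [hx]
  obtain ⟨u, hu, hxu⟩ := exists_unit_smul hx
  have h1 : vn (A *ᵥ x) = vn x * vn (A *ᵥ u) := by
    conv_lhs => rw [hxu, mulVec_smul, vn_smul, Complex.norm_real, Real.norm_of_nonneg (vn_nonneg x)]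
  rw [h1, mul_comm]
  exact mul_le_mul_of_nonneg_right (h u hu) (vn_nonneg x)

/-- The norm of a Hermitian matrix is controlled by its quadratic form on a net. -/
lemma specNorm_le_of_net_qf {H : Matrix (Fin n) (Fin n) ℂ} (hH : H.IsHermitian)
    {s : Finset (Fin n → ℂ)} (hs : ∀ x ∈ s, vn x = 1)
    (hnet : ∀ x, vn x = 1 → ∃ y ∈ s, vn (x - y) ≤ 1 / 8) {c : ℝ} (hc : 0 ≤ c)
    (h : ∀ y ∈ s, |qf H y| ≤ c) : specNorm H ≤ 4 / 3 * c := by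
  set N := specNorm H
  have hN : 0 ≤ N := specNorm_nonneg H
  -- Replacing a unit vector by a net point changes each of the two slots of the form by at most N /
  -- 8.
  suffices hle : N ≤ c + N / 4 by linarith
  refine specNorm_le_of_abs_qf_le hH (by positivity) fun x => ?_
  by_cases hx : x = 0
  · simp [hx, qf]
  obtain ⟨u, hu, hxu⟩ := exists_unit_smul hx
  have h1 : qf H x = vn x ^ 2 * qf H u := by
    conv_lhs => rw [hxu]
    simp only [qf, mulVec_smul, dotProduct_smul, star_smul, smul_dotProduct, smul_eq_mul,
      RCLike.star_def, Complex.conj_ofReal, Complex.re_ofReal_mul]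
    ring
  rw [h1, abs_mul, abs_of_nonneg (sq_nonneg (vn x)), mul_comm]
  refine mul_le_mul_of_nonneg_right ?_ (sq_nonneg _)
  obtain ⟨y, hy, huy⟩ := hnet u hu
  have h2 : qf H u - qf H y =
      (star u ⬝ᵥ (H *ᵥ (u - y))).re + (star (u - y) ⬝ᵥ (H *ᵥ y)).re := by
    simp only [qf, mulVec_sub, star_sub, sub_dotProduct, dotProduct_sub, Complex.sub_re]
    ring
  have hb : ∀ a b : Fin n → ℂ, |(star a ⬝ᵥ (H *ᵥ b)).re| ≤ N * (vn a * vn b) := fun a b => by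
    refine (Complex.abs_re_le_norm _).trans ((norm_dotProduct_le _ _).trans ?_)
    calc _ ≤ vn a * (N * vn b) := by gcongr; exacts [vn_nonneg a, vn_mulVec_le H b]
      _ = _ := by ring
  have h3 := hb u (u - y)
  have h4 := hb (u - y) y
  rw [hu, one_mul] at h3
  rw [hs y hy, mul_one] at h4
  have h5 : N * vn (u - y) ≤ N * (1 / 8) := mul_le_mul_of_nonneg_left huy hN
  have h6 := h y hy
  rw [abs_le] at h3 h4 h6 ⊢
  constructor <;> linarith [h3.1, h3.2, h4.1, h4.2, h6.1, h6.2]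

/-- The norm of a matrix is controlled by its bilinear form on nets. -/
lemma specNorm_le_of_net_bilin {A : Matrix (Fin m) (Fin n) ℂ}
    {s : Finset (Fin n → ℂ)} {t : Finset (Fin m → ℂ)}
    (hs : ∀ x, vn x = 1 → ∃ y ∈ s, vn (x - y) ≤ 1 / 8)
    (ht : ∀ x, vn x = 1 → ∃ y ∈ t, vn (x - y) ≤ 1 / 8) {c : ℝ} (hc : 0 ≤ c)
    (h : ∀ x ∈ s, ∀ y ∈ t, ‖star y ⬝ᵥ (A *ᵥ x)‖ ≤ c) : specNorm A ≤ 64 / 49 * c := by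
  have h1 : ∀ x ∈ s, vn (A *ᵥ x) ≤ 8 / 7 * c := fun x hx => by
    by_cases h0 : A *ᵥ x = 0
    · rw [h0, vn_zero]; positivity
    obtain ⟨u, hu, hxu⟩ := exists_unit_smul h0
    obtain ⟨y, hy, huy⟩ := ht u hu
    have h2 : ‖star u ⬝ᵥ (A *ᵥ x)‖ = vn (A *ᵥ x) := by
      conv_lhs => rw [hxu]
      rw [dotProduct_smul, star_dotProduct_self, hu, norm_smul, Complex.norm_real,
        Real.norm_of_nonneg (vn_nonneg _)]
      simp
    have h3 : star u ⬝ᵥ (A *ᵥ x) = star y ⬝ᵥ (A *ᵥ x) + star (u - y) ⬝ᵥ (A *ᵥ x) := by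
      rw [← add_dotProduct, ← star_add, add_sub_cancel]
    have h4 := (norm_add_le _ _).trans (add_le_add (h x hx y hy)
      (norm_dotProduct_le (u - y) (A *ᵥ x)))
    rw [← h3, h2] at h4
    have := mul_le_mul_of_nonneg_right huy (vn_nonneg (A *ᵥ x))
    linarith
  set N := specNorm A
  have hN : 0 ≤ N := specNorm_nonneg A
  -- The second net costs another factor 8/7, whence 64/49.
  suffices hle : N ≤ 8 / 7 * c + N / 8 by linarith
  refine specNorm_le_of_unit (by positivity) fun x hx => ?_
  obtain ⟨y, hy, hxy⟩ := hs x hx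
  have h2 : A *ᵥ x = A *ᵥ y + A *ᵥ (x - y) := by rw [← mulVec_add, add_sub_cancel]
  rw [h2]
  have h3 := (vn_mulVec_le A (x - y)).trans (mul_le_mul_of_nonneg_left hxy hN)
  linarith [vn_add_le (A *ᵥ y) (A *ᵥ (x - y)), h1 y hy]

/-- Two-sided bounds for a linear map from its values on a net. -/
lemma norm_bounds_of_net {E F : Type*} [NormedAddCommGroup E] [NormedSpace ℂ E]
    [NormedAddCommGroup F] [NormedSpace ℂ F] (T : E →L[ℂ] F) {s : Finset E}
    (hnet : ∀ x, ‖x‖ = 1 → ∃ y ∈ s, ‖x - y‖ ≤ 1 / 8) {a b : ℝ} (hb : 0 ≤ b)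
    (h : ∀ y ∈ s, a ≤ ‖T y‖ ∧ ‖T y‖ ≤ b) (x : E) :
    (a - b / 7) * ‖x‖ ≤ ‖T x‖ ∧ ‖T x‖ ≤ 8 / 7 * b * ‖x‖ := by
  have hunit : ∀ x : E, ‖x‖ = 1 → ∃ y ∈ s, ‖T x - T y‖ ≤ ‖T‖ / 8 := fun x hx => by
    obtain ⟨y, hy, hxy⟩ := hnet x hx
    refine ⟨y, hy, ?_⟩
    rw [← map_sub]
    exact (T.le_opNorm _).trans ((mul_le_mul_of_nonneg_left hxy (norm_nonneg T)).trans_eq (by ring))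
  have hscale : ∀ x : E, x ≠ 0 → ∃ u : E, ‖u‖ = 1 ∧ ‖T x‖ = ‖x‖ * ‖T u‖ := fun x hx => by
    have hx' : ‖x‖ ≠ 0 := norm_ne_zero_iff.2 hx
    refine ⟨((‖x‖ : ℝ) : ℂ)⁻¹ • x, ?_, ?_⟩
    · rw [norm_smul, norm_inv, Complex.norm_real, norm_norm, inv_mul_cancel₀ hx']
    · rw [map_smul, norm_smul, norm_inv, Complex.norm_real, norm_norm, mul_inv_cancel_left₀ hx']
  have hT : ‖T‖ ≤ 8 / 7 * b := by
    -- The upper bound comes first: the lower bound loses ‖T‖ / 8 ≤ b / 7 on passing to a net point.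
    suffices hle : ‖T‖ ≤ b + ‖T‖ / 8 by linarith
    refine T.opNorm_le_bound (by positivity) fun x => ?_
    by_cases hx : x = 0
    · simp [hx]
    obtain ⟨u, hu, hxu⟩ := hscale x hx
    obtain ⟨y, hy, huy⟩ := hunit u hu
    rw [hxu, mul_comm]
    refine mul_le_mul_of_nonneg_right ?_ (norm_nonneg x)
    linarith [norm_sub_norm_le (T u) (T y), (h y hy).2]
  refine ⟨?_, (T.le_opNorm x).trans (mul_le_mul_of_nonneg_right hT (norm_nonneg x))⟩
  by_cases hx : x = 0
  · simp [hx]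
  obtain ⟨u, hu, hxu⟩ := hscale x hx
  obtain ⟨y, hy, huy⟩ := hunit u hu
  rw [hxu, mul_comm]
  refine mul_le_mul_of_nonneg_left ?_ (norm_nonneg x)
  rw [norm_sub_rev] at huy
  linarith [norm_sub_norm_le (T y) (T u), (h y hy).1]

end NetBounds

/-! ### Concentration of the noise covariance and of the cross term. -/

section Noise

variable {Ω : Type*} [MeasurableSpace Ω] {μ : Measure Ω} {M L : ℕ} {σ : NNReal}
  {E : Ω → Matrix (Fin M) (Fin L) ℂ}

/-- Second-order bound of -log(1 - θ): in the Chernoff estimate the term linear in θ cancels the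
mean, leaving θ² L. -/
lemma inv_one_sub_le_exp {θ : ℝ} (h0 : 0 ≤ θ) (h1 : θ ≤ 1 / 2) :
    (1 - θ)⁻¹ ≤ Real.exp (θ + θ ^ 2) := by
  rw [inv_le_iff_one_le_mul₀ (by linarith)]
  have h2 := Real.quadratic_le_exp_of_nonneg (x := θ + θ ^ 2) (by positivity)
  have h3 := mul_le_mul_of_nonneg_right h2 (show 0 ≤ 1 - θ by linarith)
  refine le_trans ?_ h3
  have h4 : 0 ≤ θ ^ 2 * (1 / 2 - θ) := by
    have : 0 ≤ 1 / 2 - θ := by linarith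
    positivity
  nlinarith [mul_nonneg h0 h4, mul_nonneg (mul_nonneg h0 h0) h4]

lemma inv_one_add_le_exp {θ : ℝ} (h0 : 0 ≤ θ) (h1 : θ ≤ 1) :
    (1 + θ)⁻¹ ≤ Real.exp (-θ + θ ^ 2) := by
  rw [show -θ + θ ^ 2 = -(θ - θ ^ 2) by ring, Real.exp_neg]
  refine inv_anti₀ (Real.exp_pos _) ?_
  have hu0 : 0 ≤ θ - θ ^ 2 := by nlinarith
  have hu1 : |θ - θ ^ 2| ≤ 1 := by rw [abs_of_nonneg hu0]; nlinarith [sq_nonneg θ]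
  have h2 := (abs_le.1 (Real.abs_exp_sub_one_sub_id_le hu1)).2
  have h3 : (θ - θ ^ 2) ^ 2 ≤ θ ^ 2 := by
    refine pow_le_pow_left₀ hu0 ?_ 2
    linarith [sq_nonneg θ]
  linarith

lemma hasLaw_noise_bilin (hE : iIndepFun (fun (q : Fin M × Fin L) ω => E ω q.1 q.2) μ)
    (hlaw : ∀ n l, HasLaw (fun ω => E ω n l) (complexGaussian (σ ^ 2)) μ)
    (x : Fin M → ℂ) (y : Fin L → ℂ) {w : NNReal} (hw : (w : ℝ) = σ ^ 2 * (vn x ^ 2 * vn y ^ 2)) :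
    HasLaw (fun ω => ∑ q : Fin M × Fin L, (star (x q.1) * y q.2) * E ω q.1 q.2)
      (complexGaussian w) μ := by
  refine hasLaw_sum_mul_complexGaussian hE (fun q => hlaw q.1 q.2) _ ?_
  rw [hw, vn_sq, vn_sq, vn_sq, Finset.sum_mul_sum, ← Finset.sum_product']
  push_cast
  congr 1
  refine Finset.sum_congr rfl fun q _ => ?_
  rw [norm_mul, norm_star, mul_pow]

lemma iIndepFun_noise_columns (hE : iIndepFun (fun (q : Fin M × Fin L) ω => E ω q.1 q.2) μ)
    (hlaw : ∀ n l, HasLaw (fun ω => E ω n l) (complexGaussian (σ ^ 2)) μ) :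
    iIndepFun (fun (l : Fin L) ω (n : Fin M) => E ω n l) μ :=
  iIndepFun_curry (X := fun l n ω => E ω n l) (fun l n => (hlaw n l).aemeasurable)
    (hE.precomp (g := Prod.swap) Prod.swap_injective)

lemma vn_conjTranspose_mulVec_sq (A : Matrix (Fin M) (Fin L) ℂ) (x : Fin M → ℂ) :
    vn (Aᴴ *ᵥ x) ^ 2 = ∑ l, ‖∑ n, star (x n) * A n l‖ ^ 2 := by
  rw [vn_sq]
  refine Finset.sum_congr rfl fun l _ => ?_
  rw [mulVec, dotProduct, ← norm_star, star_sum]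
  congr 2
  exact Finset.sum_congr rfl fun n _ => by simp [mul_comm]

/-- Tails of the quadratic form of the noise sample covariance matrix. -/
lemma measureReal_noise_qf_le (hM : 1 ≤ M) (hML : M ≤ L)
    (hE : iIndepFun (fun (q : Fin M × Fin L) ω => E ω q.1 q.2) μ)
    (hlaw : ∀ n l, HasLaw (fun ω => E ω n l) (complexGaussian (σ ^ 2)) μ)
    {x : Fin M → ℂ} (hx : vn x = 1) :
    μ.real {ω | 13 * √(M * L) * σ ^ 2 < |vn ((E ω)ᴴ *ᵥ x) ^ 2 - L * σ ^ 2|} ≤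
      2 * Real.exp (-(25 / 4) * M) := by
  have := hE.isProbabilityMeasure
  have hM0 : (0 : ℝ) < M := by exact_mod_cast hM
  have hML' : (M : ℝ) ≤ L := by exact_mod_cast hML
  have hL0 : (0 : ℝ) < L := by linarith
  set Y : Fin L → Ω → ℂ := fun l ω => ∑ n, star (x n) * E ω n l
  have hYlaw : ∀ l, HasLaw (Y l) (complexGaussian (σ ^ 2)) μ := fun l =>
    hasLaw_sum_mul_complexGaussian
      (hE.precomp (g := fun n : Fin M => (n, l)) fun a b hab => by simpa using hab)
      (fun n => hlaw n l) (fun n => star (x n)) (by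
        have : vn (fun n => star (x n)) = vn x := vn_eq_of_forall_norm_eq fun n => norm_star _
        rw [this, hx]; simp)
  have hYind : iIndepFun Y μ :=
    (iIndepFun_noise_columns hE hlaw).comp (fun _ v => ∑ n, star (x n) * v n) fun _ => by fun_prop
  -- With this θ one has θ² L = M / 4 and θ √(M L) = M / 2, so both tails have exponent M / 4 - 13 M
  -- / 2 = -25 M / 4. The assumption M ≤ L gives θ ≤ 1/2.
  set θ : ℝ := √(M / L) / 2 with hθ
  have hsq : √((M : ℝ) / L) ^ 2 = M / L := Real.sq_sqrt (by positivity)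
  have hθ0 : 0 ≤ θ := by positivity
  have hθ1 : θ ≤ 1 / 2 := by
    have : √((M : ℝ) / L) ≤ 1 := Real.sqrt_le_one.2 ((div_le_one hL0).2 hML')
    rw [hθ]; linarith
  have hθL : θ ^ 2 * L = M / 4 := by rw [hθ, div_pow, hsq]; field_simp; norm_num
  have hθML : θ * √(M * L) = M / 2 := by
    rw [hθ, div_mul_eq_mul_div, ← Real.sqrt_mul (by positivity),
      show (M : ℝ) / L * (M * L) = M * M by field_simp, Real.sqrt_mul_self hM0.le]
  have h1 : μ.real {ω | (L + 13 * √(M * L)) * ((σ ^ 2 : NNReal) : ℝ) < ∑ l, ‖Y l ω‖ ^ 2} ≤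
      Real.exp (-(25 / 4) * M) := by
    refine (measureReal_lt_sum_norm_sq_le hYind hYlaw hθ0 (by linarith) _).trans ?_
    rw [Fintype.card_fin]
    calc _ ≤ Real.exp (-θ * (L + 13 * √(M * L))) * Real.exp (θ + θ ^ 2) ^ L := by
          have := inv_nonneg.2 (show 0 ≤ 1 - θ by linarith)
          gcongr
          exact inv_one_sub_le_exp hθ0 hθ1
      _ = _ := by
          rw [← Real.exp_nat_mul, ← Real.exp_add]
          congr 1
          linear_combination hθL - 13 * hθML
  have h2 : μ.real {ω | ∑ l, ‖Y l ω‖ ^ 2 < (L - 13 * √(M * L)) * ((σ ^ 2 : NNReal) : ℝ)} ≤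
      Real.exp (-(25 / 4) * M) := by
    refine (measureReal_sum_norm_sq_lt_le hYind hYlaw hθ0 _).trans ?_
    rw [Fintype.card_fin]
    calc _ ≤ Real.exp (θ * (L - 13 * √(M * L))) * Real.exp (-θ + θ ^ 2) ^ L := by
          gcongr
          exact inv_one_add_le_exp hθ0 (by linarith)
      _ = _ := by
          rw [← Real.exp_nat_mul, ← Real.exp_add]
          congr 1
          linear_combination hθL - 13 * hθML
  refine (measureReal_mono ?_ (measure_ne_top _ _)).trans ((measureReal_union_le
    {ω | (L + 13 * √(M * L)) * ((σ ^ 2 : NNReal) : ℝ) < ∑ l, ‖Y l ω‖ ^ 2}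
    {ω | ∑ l, ‖Y l ω‖ ^ 2 < (L - 13 * √(M * L)) * ((σ ^ 2 : NNReal) : ℝ)}).trans (by linarith))
  intro ω hω
  simp only [Set.mem_ofPred_eq, vn_conjTranspose_mulVec_sq, lt_abs] at hω
  simp only [Set.mem_union, Set.mem_ofPred_eq, NNReal.coe_pow]
  rcases hω with hω | hω
  · left; change _ < ∑ l, ‖∑ n, star (x n) * E ω n l‖ ^ 2; linarith
  · right; change ∑ l, ‖∑ n, star (x n) * E ω n l‖ ^ 2 < _; linarith

lemma exp_one_pow_le : (2.718 : ℝ) ≤ Real.exp 1 := by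
  linarith [Real.exp_one_gt_d9]

/-- Concentration of the noise sample covariance matrix. -/
lemma measureReal_noise_cov_le (hM : 1 ≤ M) (hML : M ≤ L)
    (hE : iIndepFun (fun (q : Fin M × Fin L) ω => E ω q.1 q.2) μ)
    (hlaw : ∀ n l, HasLaw (fun ω => E ω n l) (complexGaussian (σ ^ 2)) μ) :
    μ.real {ω | ¬ specNorm (E ω * (E ω)ᴴ - ((L * σ ^ 2 : ℝ) : ℂ) • 1) ≤
      52 / 3 * √(M * L) * σ ^ 2} ≤ 2 * Real.exp (-(M : ℝ) / 2) := by
  have := hE.isProbabilityMeasure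
  obtain ⟨s, hs, hcard, hnet⟩ := exists_net_vn M
  set B : (Fin M → ℂ) → Set Ω := fun x =>
    {ω | 13 * √(M * L) * σ ^ 2 < |vn ((E ω)ᴴ *ᵥ x) ^ 2 - L * σ ^ 2|}
  have hsub : {ω | ¬ specNorm (E ω * (E ω)ᴴ - ((L * σ ^ 2 : ℝ) : ℂ) • 1) ≤
      52 / 3 * √(M * L) * σ ^ 2} ⊆ ⋃ x ∈ s, B x := by
    intro ω hω
    by_contra hcon
    refine hω ?_
    have hgood : ∀ x ∈ s, |vn ((E ω)ᴴ *ᵥ x) ^ 2 - L * σ ^ 2| ≤ 13 * √(M * L) * σ ^ 2 :=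
      fun x hx => not_lt.1 fun h => hcon (Set.mem_iUnion₂.2 ⟨x, hx, h⟩)
    have hherm : (E ω * (E ω)ᴴ - ((L * σ ^ 2 : ℝ) : ℂ) • 1).IsHermitian := by
      refine (isHermitian_mul_conjTranspose_self _).sub ?_
      rw [IsHermitian, conjTranspose_smul, conjTranspose_one, RCLike.star_def, Complex.conj_ofReal]
    refine (specNorm_le_of_net_qf hherm hs hnet (by positivity) (c := 13 * √(M * L) * σ ^ 2)
      fun y hy => ?_).trans_eq (by ring)
    rw [qf_sub, qf_mul_conjTranspose, qf_smul, qf_one, hs y hy, one_pow, mul_one]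
    exact hgood y hy
  -- The net has at most exp(23 M / 4) points, and 23/4 - 25/4 = -1/2 is the final exponent.
  have h289 : (289 : ℝ) ≤ Real.exp (23 / 4) := by
    refine le_of_pow_le_pow_left₀ (n := 4) (by norm_num) (Real.exp_pos _).le ?_
    rw [← Real.exp_nat_mul, show ((4 : ℕ) : ℝ) * (23 / 4) = (23 : ℕ) * 1 by norm_num,
      Real.exp_nat_mul]
    calc (289 : ℝ) ^ 4 ≤ 2.718 ^ 23 := by norm_num
      _ ≤ _ := by gcongr; exact exp_one_pow_le
  calc _ ≤ μ.real (⋃ x ∈ s, B x) := measureReal_mono hsub (measure_ne_top _ _)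
    _ ≤ ∑ x ∈ s, μ.real (B x) := measureReal_biUnion_finset_le _ _
    _ ≤ ∑ _x ∈ s, 2 * Real.exp (-(25 / 4) * M) :=
        Finset.sum_le_sum fun x hx => measureReal_noise_qf_le hM hML hE hlaw (hs x hx)
    _ = s.card * (2 * Real.exp (-(25 / 4) * M)) := by rw [Finset.sum_const, nsmul_eq_mul]
    _ ≤ Real.exp (23 / 4) ^ M * (2 * Real.exp (-(25 / 4) * M)) := by
        gcongr
        calc (s.card : ℝ) ≤ (289 : ℝ) ^ M := by exact_mod_cast hcard
          _ ≤ _ := by gcongr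
    _ = 2 * (Real.exp (M * (23 / 4)) * Real.exp (-(25 / 4) * M)) := by
        rw [← Real.exp_nat_mul]; ring
    _ = _ := by rw [← Real.exp_add]; congr 2; ring

/-- Bound of the product of a fixed matrix and the noise. -/
lemma measureReal_cross_le {K : ℕ} (hM : 1 ≤ M) (hKM : K ≤ M)
    (hE : iIndepFun (fun (q : Fin M × Fin L) ω => E ω q.1 q.2) μ)
    (hlaw : ∀ n l, HasLaw (fun ω => E ω n l) (complexGaussian (σ ^ 2)) μ)
    (S : Matrix (Fin K) (Fin L) ℂ) :
    μ.real {ω | 384 / 49 * √M * σ * specNorm S < specNorm (S * (E ω)ᴴ)} ≤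
      Real.exp (-(M : ℝ) / 2) := by
  have := hE.isProbabilityMeasure
  obtain ⟨s, hs, hscard, hsnet⟩ := exists_net_vn M
  obtain ⟨t, ht, htcard, htnet⟩ := exists_net_vn K
  set Y : (Fin M → ℂ) → (Fin K → ℂ) → Ω → ℂ := fun x y ω =>
    ∑ q : Fin M × Fin L, (star (x q.1) * (Sᴴ *ᵥ y) q.2) * E ω q.1 q.2
  set w : (Fin K → ℂ) → NNReal := fun y => σ ^ 2 * ⟨vn (Sᴴ *ᵥ y) ^ 2, sq_nonneg _⟩ with hw
  -- The bilinear form is one complex Gaussian of variance w y, a sum over `Unit` for the tail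
  -- bound. The threshold 36 M with θ = 1/2 gives 2 exp(-18 M), and 6 · 64/49 = 384/49.
  set B : (Fin M → ℂ) → (Fin K → ℂ) → Set Ω := fun x y =>
    {ω | (36 * M) * (w y : ℝ) < ∑ _l : Unit, ‖Y x y ω‖ ^ 2}
  have hB : ∀ x ∈ s, ∀ y ∈ t, μ.real (B x y) ≤ 2 * Real.exp (-18 * M) := fun x hx y _ => by
    have h := measureReal_lt_sum_norm_sq_le (ι := Unit) (Y := fun _ => Y x y) (w := w y)
      iIndepFun.of_subsingleton (fun _ => hasLaw_noise_bilin hE hlaw x _ (by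
        rw [hs x hx, one_pow, one_mul, hw]; rfl)) (θ := 1 / 2) (by norm_num) (by norm_num) (36 * M)
    refine h.trans_eq ?_
    rw [Fintype.card_unit, pow_one, mul_comm]
    congr 1
    · norm_num
    · congr 1; ring
  have hYeq : ∀ x y ω, ‖Y x y ω‖ = ‖star y ⬝ᵥ ((S * (E ω)ᴴ) *ᵥ x)‖ := fun x y ω => by
    have : Y x y ω = star (star y ⬝ᵥ ((S * (E ω)ᴴ) *ᵥ x)) := by
      rw [← mulVec_mulVec, star_dotProduct_mulVec, dotProduct, star_sum]
      simp only [Y]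
      rw [Fintype.sum_prod_type_right]
      refine Finset.sum_congr rfl fun l _ => ?_
      have h1 : star (((E ω)ᴴ *ᵥ x) l) = ∑ n, star (x n) * E ω n l := by
        change star (∑ n, star (E ω n l) * x n) = _
        rw [star_sum]
        exact Finset.sum_congr rfl fun n _ => by rw [star_mul', star_star, mul_comm]
      rw [star_mul', Pi.star_apply, star_star, h1, Finset.mul_sum]
      exact Finset.sum_congr rfl fun n _ => by ring
    rw [this, norm_star]
  have hsub : {ω | 384 / 49 * √M * σ * specNorm S < specNorm (S * (E ω)ᴴ)} ⊆
      ⋃ x ∈ s, ⋃ y ∈ t, B x y := by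
    intro ω hω
    by_contra hcon
    refine absurd (Set.mem_ofPred_eq ▸ hω : _ < _) (not_lt.2 ?_)
    have hgood : ∀ x ∈ s, ∀ y ∈ t,
        ‖star y ⬝ᵥ ((S * (E ω)ᴴ) *ᵥ x)‖ ≤ 6 * √M * σ * specNorm S := by
      intro x hx y hy
      have h1 : ω ∉ B x y := fun h => hcon
        (Set.mem_iUnion₂.2 ⟨x, hx, Set.mem_iUnion₂.2 ⟨y, hy, h⟩⟩)
      have h2 : ∑ _l : Unit, ‖Y x y ω‖ ^ 2 ≤ (36 * M) * (w y : ℝ) := not_lt.1 h1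
      rw [Finset.sum_const, Finset.card_univ, Fintype.card_unit, one_smul, hYeq] at h2
      have h3 : vn (Sᴴ *ᵥ y) ≤ specNorm S := by
        have := vn_mulVec_le Sᴴ y
        rwa [ht y hy, mul_one, specNorm_conjTranspose] at this
      have h4 : (w y : ℝ) ≤ σ ^ 2 * specNorm S ^ 2 := by
        rw [hw]
        push_cast
        exact mul_le_mul_of_nonneg_left (pow_le_pow_left₀ (vn_nonneg _) h3 2) (sq_nonneg _)
      have h5 := specNorm_nonneg S
      refine le_of_sq_le_sq (h2.trans ?_) (mul_nonneg (by positivity) h5)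
      calc _ ≤ 36 * M * (σ ^ 2 * specNorm S ^ 2) := by gcongr
        _ = _ := by
          rw [mul_pow, mul_pow, mul_pow, Real.sq_sqrt (Nat.cast_nonneg M)]; ring
    refine (specNorm_le_of_net_bilin hsnet htnet ?_ hgood).trans_eq (by ring)
    have := specNorm_nonneg S
    positivity
  calc _ ≤ μ.real (⋃ x ∈ s, ⋃ y ∈ t, B x y) := measureReal_mono hsub (measure_ne_top _ _)
    _ ≤ ∑ x ∈ s, ∑ y ∈ t, μ.real (B x y) :=
        (measureReal_biUnion_finset_le _ _).trans
          (Finset.sum_le_sum fun x _ => measureReal_biUnion_finset_le _ _)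
    _ ≤ ∑ _x ∈ s, ∑ _y ∈ t, 2 * Real.exp (-18 * M) :=
        Finset.sum_le_sum fun x hx => Finset.sum_le_sum fun y hy => hB x hx y hy
    _ = s.card * t.card * (2 * Real.exp (-18 * M)) := by
        simp only [Finset.sum_const, nsmul_eq_mul]; ring
    -- The size of the second net is bounded through K ≤ M, and the factor 2 through M ≥ 1, so that
    -- everything is an M-th power; then 35/2 - 18 = -1/2.
    _ ≤ 289 ^ M * 289 ^ M * (2 ^ M * Real.exp (-18 * M)) := by
        gcongr
        · exact_mod_cast hscard
        · calc (t.card : ℝ) ≤ 289 ^ K := by exact_mod_cast htcard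
            _ ≤ _ := pow_le_pow_right₀ (by norm_num) hKM
        · calc (2 : ℝ) = 2 ^ 1 := by norm_num
            _ ≤ _ := pow_le_pow_right₀ (by norm_num) hM
    _ = (289 * 289 * 2) ^ M * Real.exp (-18 * M) := by rw [mul_pow, mul_pow]; ring
    _ ≤ Real.exp (35 / 2) ^ M * Real.exp (-18 * M) := by
        gcongr
        refine le_of_pow_le_pow_left₀ (n := 2) (by norm_num) (Real.exp_pos _).le ?_
        rw [← Real.exp_nat_mul, show ((2 : ℕ) : ℝ) * (35 / 2) = (35 : ℕ) * 1 by norm_num,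
          Real.exp_nat_mul]
        calc (289 * 289 * 2 : ℝ) ^ 2 ≤ 2.718 ^ 35 := by norm_num
          _ ≤ _ := by gcongr; exact exp_one_pow_le
    _ = _ := by rw [← Real.exp_nat_mul, ← Real.exp_add]; congr 1; ring

end Noise
end ESPRIT

namespace ESPRIT

variable {Ω : Type*} [MeasurableSpace Ω] {μ : Measure Ω} {M K L : ℕ} {σ : NNReal}

/-! ### The cross term with random sources. -/

section Cross

open scoped Matrix.Norms.L2Operator in
lemma continuous_specNorm {m n : ℕ} :
    Continuous (specNorm : Matrix (Fin m) (Fin n) ℂ → ℝ) := continuous_norm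

/-- Bound of the product of the sources and the independent noise. -/
lemma measureReal_cross_random_le (hM : 1 ≤ M) (hKM : K ≤ M)
    {S : Ω → Matrix (Fin K) (Fin L) ℂ} {E : Ω → Matrix (Fin M) (Fin L) ℂ}
    (hE : iIndepFun (fun (q : Fin M × Fin L) ω => E ω q.1 q.2) μ)
    (hlaw : ∀ n l, HasLaw (fun ω => E ω n l) (complexGaussian (σ ^ 2)) μ)
    (hS : AEMeasurable (fun ω (q : Fin K × Fin L) => S ω q.1 q.2) μ)
    (hSE : IndepFun (fun ω (q : Fin K × Fin L) => S ω q.1 q.2)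
      (fun ω (q : Fin M × Fin L) => E ω q.1 q.2) μ) :
    μ.real {ω | 384 / 49 * √M * σ * specNorm (S ω) < specNorm (S ω * (E ω)ᴴ)} ≤
      Real.exp (-(M : ℝ) / 2) := by
  have := hE.isProbabilityMeasure
  have hN : AEMeasurable (fun ω (q : Fin M × Fin L) => E ω q.1 q.2) μ :=
    aemeasurable_pi_iff.2 fun q => (hlaw q.1 q.2).aemeasurable
  have hprob : IsProbabilityMeasure (μ.map fun ω (q : Fin K × Fin L) => S ω q.1 q.2) :=
    Measure.isProbabilityMeasure_map hS
  let A : (Fin K × Fin L → ℂ) → Matrix (Fin K) (Fin L) ℂ := fun s => of fun k l => s (k, l)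
  let B : (Fin M × Fin L → ℂ) → Matrix (Fin M) (Fin L) ℂ := fun s => of fun k l => s (k, l)
  have hA : Continuous A := continuous_matrix fun k l => continuous_apply (k, l)
  have hB : Continuous B := continuous_matrix fun k l => continuous_apply (k, l)
  let D : Set ((Fin K × Fin L → ℂ) × (Fin M × Fin L → ℂ)) :=
    {p | 384 / 49 * √M * σ * specNorm (A p.1) < specNorm (A p.1 * (B p.2)ᴴ)}
  have hD : MeasurableSet D := by
    refine (isOpen_lt ?_ ?_).measurableSet
    · exact continuous_const.mul (continuous_specNorm.comp (hA.comp continuous_fst))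
    · exact continuous_specNorm.comp ((hA.comp continuous_fst).matrix_mul
        (hB.comp continuous_snd).matrix_conjTranspose)
  have h1 : μ {ω | 384 / 49 * √M * σ * specNorm (S ω) < specNorm (S ω * (E ω)ᴴ)} ≤
      ENNReal.ofReal (Real.exp (-(M : ℝ) / 2)) := by
    calc _ = (μ.map fun ω => ((fun (q : Fin K × Fin L) => S ω q.1 q.2),
          (fun (q : Fin M × Fin L) => E ω q.1 q.2))) D :=
          (Measure.map_apply_of_aemeasurable (hS.prodMk hN) hD).symm
      _ = ∫⁻ s, (μ.map fun ω (q : Fin M × Fin L) => E ω q.1 q.2) (Prod.mk s ⁻¹' D)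
          ∂(μ.map fun ω (q : Fin K × Fin L) => S ω q.1 q.2) := by
          rw [(indepFun_iff_map_prod_eq_prod_map_map hS hN).1 hSE, Measure.prod_apply hD]
      _ ≤ ∫⁻ _s, ENNReal.ofReal (Real.exp (-(M : ℝ) / 2))
          ∂(μ.map fun ω (q : Fin K × Fin L) => S ω q.1 q.2) := by
          -- By independence the joint law is a product, so the bound for a fixed source matrix
          -- applies to each slice.
          refine lintegral_mono fun s => ?_
          rw [Measure.map_apply_of_aemeasurable hN (measurable_prodMk_left hD)]
          exact (ENNReal.le_ofReal_iff_toReal_le (measure_ne_top _ _) (Real.exp_pos _).le).2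
            (measureReal_cross_le hM hKM hE hlaw (A s))
      _ = _ := by rw [lintegral_const, measure_univ, mul_one]
  exact (ENNReal.le_ofReal_iff_toReal_le (measure_ne_top _ _) (Real.exp_pos _).le).1 h1

end Cross

/-! ### Two-sided control of the source sample covariance. -/

section Signal

/-- Since uᴴ D w = (D u)ᴴ w, the form is a unit linear combination of independent CN(0, 1)
variables. -/
lemma hasLaw_signal_form {D : Matrix (Fin K) (Fin K) ℂ} (hD : D.IsHermitian)
    {X : Ω → Fin K → ℂ}
    (hX : HasLaw X ((Measure.pi fun _ : Fin K => complexGaussian 1).map fun w => D *ᵥ w) μ)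
    (u : Fin K → ℂ) (hu : vn (D *ᵥ u) = 1) :
    HasLaw (fun ω => star u ⬝ᵥ X ω) (complexGaussian 1) μ := by
  have hφ : Measurable fun v : Fin K → ℂ => star u ⬝ᵥ v :=
    (continuous_const.dotProduct continuous_id).measurable
  have hDm : Measurable fun w : Fin K → ℂ => D *ᵥ w :=
    (Continuous.matrix_mulVec continuous_const continuous_id).measurable
  have h1 : HasLaw (fun w : Fin K → ℂ => ∑ k, star (D *ᵥ u) k * w k) (complexGaussian 1)
      (Measure.pi fun _ : Fin K => complexGaussian 1) :=
    hasLaw_sum_mul_complexGaussian (X := fun k (w : Fin K → ℂ) => w k) (v := 1)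
      (iIndepFun_pi (X := fun _ x => x) fun _ => aemeasurable_id)
      (fun k => (measurePreserving_eval (fun _ : Fin K => complexGaussian 1) k).hasLaw) _ (by
        have : vn (star (D *ᵥ u)) = vn (D *ᵥ u) := vn_eq_of_forall_norm_eq fun k => norm_star _
        rw [this, hu]; simp)
  refine HasLaw.comp (X := X) ⟨hφ.aemeasurable, ?_⟩ hX
  rw [Measure.map_map hφ hDm]
  refine Eq.trans ?_ h1.map_eq
  congr 1
  ext w
  change star u ⬝ᵥ (D *ᵥ w) = star (D *ᵥ u) ⬝ᵥ w
  rw [star_dotProduct_mulVec, hD.eq]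

/-- After raising to the 16th power, 16 r ≤ L turns the net size 289 ^ (16 r) into at most 289 ^ L,
and the claim reduces to one numerical inequality per sample. -/
lemma pow_rank_mul_pow_le {r L : ℕ} (hr : 16 * r ≤ L) {q : ℝ} (hq0 : 0 ≤ q)
    (hq : 289 * q ^ 16 * Real.exp (1 / 2) ≤ 1) :
    (289 : ℝ) ^ r * q ^ L ≤ Real.exp (-(L : ℝ) / 32) := by
  refine le_of_pow_le_pow_left₀ (n := 16) (by norm_num) (Real.exp_pos _).le ?_
  rw [← Real.exp_nat_mul, mul_pow, ← pow_mul, ← pow_mul,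
    show ((16 : ℕ) : ℝ) * (-(L : ℝ) / 32) = -((L : ℝ) * (1 / 2)) by push_cast; ring, Real.exp_neg,
    ← one_div, le_div_iff₀ (Real.exp_pos _), Real.exp_nat_mul]
  calc (289 : ℝ) ^ (r * 16) * q ^ (L * 16) * Real.exp (1 / 2) ^ L
      ≤ 289 ^ L * q ^ (L * 16) * Real.exp (1 / 2) ^ L := by
        gcongr
        · norm_num
        · omega
    _ = (289 * q ^ 16 * Real.exp (1 / 2)) ^ L := by
        rw [mul_pow, mul_pow, ← pow_mul, mul_comm L 16]
    _ ≤ 1 := pow_le_one₀ (by positivity) hq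

/-- Two-sided comparison of the source sample covariance matrix with the source covariance
matrix. -/
lemma measureReal_signal_le {D : Matrix (Fin K) (Fin K) ℂ} (hD : D.IsHermitian)
    {S : Ω → Matrix (Fin K) (Fin L) ℂ}
    (hS : iIndepFun (fun (l : Fin L) ω => (fun k => S ω k l : Fin K → ℂ)) μ)
    (hlaw : ∀ l, HasLaw (fun ω => (fun k => S ω k l : Fin K → ℂ))
      ((Measure.pi fun _ : Fin K => complexGaussian 1).map fun w => D *ᵥ w) μ)
    (hr : 16 * D.rank ≤ L) :
    μ.real {ω | ¬ ∀ u, √(L / 8) * vn (D *ᵥ u) ≤ vn ((S ω)ᴴ *ᵥ u) ∧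
      vn ((S ω)ᴴ *ᵥ u) ≤ 12 / 7 * √L * vn (D *ᵥ u)} ≤ 2 * Real.exp (-(L : ℝ) / 32) := by
  classical
  have := hS.isProbabilityMeasure
  -- The net is taken in the range of D, so its size depends on the rank and not on K.
  let V := LinearMap.range (toEuclideanLin D)
  have hVrank : Module.finrank ℂ V = D.rank := by
    rw [rank_eq_finrank_range_toLin D (EuclideanSpace.basisFun (Fin K) ℂ).toBasis
      (EuclideanSpace.basisFun (Fin K) ℂ).toBasis]
    rfl
  obtain ⟨s, hs, hcard, hnet⟩ := exists_net V
  rw [hVrank] at hcard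
  have hu : ∀ x : V, ∃ u : Fin K → ℂ, D *ᵥ u = (x : EuclideanSpace ℂ (Fin K)).ofLp := fun x => by
    obtain ⟨y, hy⟩ := x.2
    exact ⟨y.ofLp, by rw [← hy]; rfl⟩
  choose u hu using hu
  set Y : V → Fin L → Ω → ℂ := fun x l ω => star (u x) ⬝ᵥ fun k => S ω k l
  have hYind : ∀ x, iIndepFun (Y x) μ := fun x =>
    hS.comp (fun _ v => star (u x) ⬝ᵥ v) fun _ =>
      (continuous_const.dotProduct continuous_id).measurable
  have hYlaw : ∀ x ∈ s, ∀ l, HasLaw (Y x l) (complexGaussian 1) μ := fun x hx l =>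
    hasLaw_signal_form hD (hlaw l) (u x) (by
      rw [hu]; exact hs x hx)
  set Blow : V → Set Ω := fun x => {ω | ∑ l, ‖Y x l ω‖ ^ 2 < (1 / 3 * L) * ((1 : NNReal) : ℝ)}
  set Bup : V → Set Ω := fun x => {ω | (9 / 4 * L) * ((1 : NNReal) : ℝ) < ∑ l, ‖Y x l ω‖ ^ 2}
  -- The null event that some column of S leaves the range of D.
  set Z : Set Ω := {ω | ¬ ∀ l, ∃ w : Fin K → ℂ, (fun k => S ω k l) = D *ᵥ w} with hZdef
  have hZ : μ.real Z = 0 := by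
    have h0 : ∀ᵐ ω ∂μ, ∀ l, ∃ w : Fin K → ℂ, (fun k => S ω k l) = D *ᵥ w := by
      refine ae_all_iff.2 fun l => ?_
      have hDm : Measurable fun w : Fin K → ℂ => D *ᵥ w :=
        (Continuous.matrix_mulVec continuous_const continuous_id).measurable
      have hcl : MeasurableSet {v : Fin K → ℂ | ∃ w : Fin K → ℂ, v = D *ᵥ w} := by
        have : {v : Fin K → ℂ | ∃ w : Fin K → ℂ, v = D *ᵥ w} =
            (LinearMap.range (mulVecLin D) : Set (Fin K → ℂ)) := by
          ext v
          simp only [Set.mem_ofPred_eq, SetLike.mem_coe, LinearMap.mem_range, mulVecLin_apply]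
          exact ⟨fun ⟨w, hw⟩ => ⟨w, hw.symm⟩, fun ⟨w, hw⟩ => ⟨w, hw.symm⟩⟩
        rw [this]
        exact (Submodule.closed_of_finiteDimensional _).measurableSet
      have h1 : ∀ᵐ v ∂((Measure.pi fun _ : Fin K => complexGaussian 1).map fun w => D *ᵥ w),
          v ∈ {v : Fin K → ℂ | ∃ w : Fin K → ℂ, v = D *ᵥ w} :=
        (ae_map_iff hDm.aemeasurable hcl).2 (ae_of_all _ fun w => ⟨w, rfl⟩)
      rw [← (hlaw l).map_eq] at h1
      exact ae_of_ae_map (hlaw l).aemeasurable h1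
    rw [measureReal_def, ENNReal.toReal_eq_zero_iff]
    exact Or.inl h0
  have hsub : {ω | ¬ ∀ u, √(L / 8) * vn (D *ᵥ u) ≤ vn ((S ω)ᴴ *ᵥ u) ∧
      vn ((S ω)ᴴ *ᵥ u) ≤ 12 / 7 * √L * vn (D *ᵥ u)} ⊆
      Z ∪ ((⋃ x ∈ s, Blow x) ∪ ⋃ x ∈ s, Bup x) := by
    intro ω hω
    by_contra hcon
    refine hω ?_
    simp only [Set.mem_union, not_or] at hcon
    obtain ⟨hcZ, hclow, hcup⟩ := hcon
    have hex : ∀ l, ∃ w : Fin K → ℂ, (fun k => S ω k l) = D *ᵥ w := not_not.1 hcZ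
    choose w hw using hex
    set W : Matrix (Fin K) (Fin L) ℂ := of fun k l => w l k with hWdef
    have hSW : S ω = D * W := by
      ext k l
      exact congrFun (hw l) k
    -- Sᴴ v depends on v only through D v, so it defines a map T on V and one preimage u x per net
    -- point suffices.
    have hSu : ∀ v, (S ω)ᴴ *ᵥ v = Wᴴ *ᵥ (D *ᵥ v) := fun v => by
      rw [hSW, conjTranspose_mul, hD.eq, mulVec_mulVec]
    let T : V →L[ℂ] EuclideanSpace ℂ (Fin L) :=
      ((toEuclideanLin Wᴴ).comp V.subtype).toContinuousLinearMap
    have hT : ∀ (x : V) v, D *ᵥ v = (x : EuclideanSpace ℂ (Fin K)).ofLp →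
        ‖T x‖ = vn ((S ω)ᴴ *ᵥ v) := fun x v hv => by
      rw [hSu, hv]; rfl
    have hTY : ∀ x, ‖T x‖ ^ 2 = ∑ l, ‖Y x l ω‖ ^ 2 := fun x => by
      rw [hT x (u x) (hu x), vn_conjTranspose_mulVec_sq]
      rfl
    have hL0 : (0 : ℝ) ≤ L := Nat.cast_nonneg L
    have hbd : ∀ y ∈ s, √(L / 3) ≤ ‖T y‖ ∧ ‖T y‖ ≤ 3 / 2 * √L := fun y hy => by
      have h1 : ¬ ∑ l, ‖Y y l ω‖ ^ 2 < (1 / 3 * L) * ((1 : NNReal) : ℝ) := fun h =>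
        hclow (Set.mem_iUnion₂.2 ⟨y, hy, h⟩)
      have h2 : ¬ (9 / 4 * L) * ((1 : NNReal) : ℝ) < ∑ l, ‖Y y l ω‖ ^ 2 := fun h =>
        hcup (Set.mem_iUnion₂.2 ⟨y, hy, h⟩)
      rw [← hTY, NNReal.coe_one, mul_one, not_lt] at h1 h2
      constructor
      · refine Real.sqrt_le_iff.2 ⟨norm_nonneg _, ?_⟩
        linarith
      · refine le_of_sq_le_sq ?_ (by positivity)
        rw [mul_pow, Real.sq_sqrt hL0]
        linarith
    intro v
    have hx : WithLp.toLp 2 (D *ᵥ v) ∈ V := ⟨WithLp.toLp 2 v, rfl⟩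
    have h3 := norm_bounds_of_net T hnet (by positivity) hbd ⟨_, hx⟩
    rw [hT ⟨_, hx⟩ v rfl] at h3
    have h4 : ‖(⟨WithLp.toLp 2 (D *ᵥ v), hx⟩ : V)‖ = vn (D *ᵥ v) := rfl
    rw [h4] at h3
    refine ⟨le_trans (mul_le_mul_of_nonneg_right ?_ (vn_nonneg _)) h3.1, h3.2.trans_eq (by ring)⟩
    -- Numerically 1/√3 - (3/2)/7 > 0.577 - 0.215 exceeds 0.355 ≥ 1/√8.
    have e1 : √((L : ℝ) / 8) ≤ 71 / 200 * √L := by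
      refine Real.sqrt_le_iff.2 ⟨by positivity, ?_⟩
      rw [mul_pow, Real.sq_sqrt hL0]
      linarith
    have e2 : 577 / 1000 * √(L : ℝ) ≤ √(L / 3) := by
      refine Real.le_sqrt_of_sq_le ?_
      rw [mul_pow, Real.sq_sqrt hL0]
      linarith
    have := Real.sqrt_nonneg (L : ℝ)
    linarith
  -- θ = 2 is optimal for the level 1/3: it solves 1 / (1 + θ) = 1/3.
  have hlowp : ∀ x ∈ s, μ.real (Blow x) ≤ (Real.exp (2 / 3) / 3) ^ L := fun x hx => by
    refine (measureReal_sum_norm_sq_lt_le (hYind x) (hYlaw x hx) (θ := 2) (by norm_num) _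
      ).trans_eq ?_
    rw [Fintype.card_fin, div_eq_mul_inv (Real.exp (2 / 3)) 3, mul_pow, ← Real.exp_nat_mul]
    congr 2
    · ring
    · norm_num
  -- θ = 5/9 is optimal for the level 9/4: it solves 1 / (1 - θ) = 9/4.
  have hupp : ∀ x ∈ s, μ.real (Bup x) ≤ (Real.exp (-(5 / 4)) * (9 / 4)) ^ L := fun x hx => by
    refine (measureReal_lt_sum_norm_sq_le (hYind x) (hYlaw x hx) (θ := 5 / 9) (by norm_num)
      (by norm_num) _).trans_eq ?_
    rw [Fintype.card_fin, mul_pow, ← Real.exp_nat_mul]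
    congr 2
    · ring
    · norm_num
  have hunion : ∀ (B : V → Set Ω) (q : ℝ), 0 ≤ q → 289 * q ^ 16 * Real.exp (1 / 2) ≤ 1 →
      (∀ x ∈ s, μ.real (B x) ≤ q ^ L) → μ.real (⋃ x ∈ s, B x) ≤ Real.exp (-(L : ℝ) / 32) := by
    intro B q hq0 hq hB
    calc _ ≤ ∑ x ∈ s, μ.real (B x) := measureReal_biUnion_finset_le _ _
      _ ≤ ∑ _x ∈ s, q ^ L := Finset.sum_le_sum hB
      _ = s.card * q ^ L := by rw [Finset.sum_const, nsmul_eq_mul]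
      _ ≤ 289 ^ D.rank * q ^ L := by
          gcongr
          exact_mod_cast hcard
      _ ≤ _ := pow_rank_mul_pow_le hr hq0 hq
  have hq1 : 289 * (Real.exp (2 / 3) / 3) ^ 16 * Real.exp (1 / 2) ≤ 1 := by
    have h1 : (Real.exp (2 / 3)) ^ 16 * Real.exp (1 / 2) ≤ 148900 := by
      refine le_of_sq_le_sq ?_ (by norm_num)
      calc _ ≤ Real.exp 1 ^ 23 := by
            rw [← Real.exp_nat_mul, ← Real.exp_add, ← Real.exp_nat_mul, ← Real.exp_nat_mul,
              Real.exp_le_exp]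
            norm_num
        _ ≤ 2.7183 ^ 23 := by
            gcongr; linarith [Real.exp_one_lt_d9]
        _ ≤ _ := by norm_num
    rw [div_pow]
    calc _ = 289 / 3 ^ 16 * (Real.exp (2 / 3) ^ 16 * Real.exp (1 / 2)) := by ring
      _ ≤ 289 / 3 ^ 16 * 148900 := by gcongr
      _ ≤ 1 := by norm_num
  have hq2 : 289 * (Real.exp (-(5 / 4)) * (9 / 4)) ^ 16 * Real.exp (1 / 2) ≤ 1 := by
    have h1 : (Real.exp (-(5 / 4))) ^ 16 * Real.exp (1 / 2) ≤ (Real.exp 1 ^ 19)⁻¹ := by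
      rw [← Real.exp_nat_mul, ← Real.exp_add, ← Real.exp_nat_mul, ← Real.exp_neg, Real.exp_le_exp]
      norm_num
    have h2 : (Real.exp 1 ^ 19)⁻¹ ≤ (2.718 ^ 19)⁻¹ := by
      gcongr; exact exp_one_pow_le
    rw [mul_pow]
    calc _ = 289 * (9 / 4) ^ 16 * (Real.exp (-(5 / 4)) ^ 16 * Real.exp (1 / 2)) := by ring
      _ ≤ 289 * (9 / 4) ^ 16 * (2.718 ^ 19)⁻¹ := by gcongr; exact h1.trans h2
      _ ≤ 1 := by norm_num
  calc _ ≤ μ.real (Z ∪ ((⋃ x ∈ s, Blow x) ∪ ⋃ x ∈ s, Bup x)) :=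
        measureReal_mono hsub (measure_ne_top _ _)
    _ ≤ μ.real Z + (μ.real (⋃ x ∈ s, Blow x) + μ.real (⋃ x ∈ s, Bup x)) :=
        (measureReal_union_le _ _).trans (add_le_add_right (measureReal_union_le _ _) _)
    _ ≤ 0 + (Real.exp (-(L : ℝ) / 32) + Real.exp (-(L : ℝ) / 32)) := by
        rw [hZ]
        gcongr
        · exact hunion Blow _ (by positivity) hq1 hlowp
        · exact hunion Bup _ (by positivity) hq2 hupp
    _ = _ := by ring

end Signal
end ESPRIT

namespace ESPRIT

variable {N M K L : ℕ} (f : Fin K → ℝ)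

/-! ### Modulation by powers of Z and smoothed quadratic forms. -/

section Modulation

lemma zPow_conjTranspose (e : ℤ) : (zPow f e)ᴴ = zPow f (-e) := by
  rw [zPow, diagonal_conjTranspose, zPow]
  congr 1
  ext k
  rw [Pi.star_apply, star_zpow₀, _root_.zpow_neg, ← _root_.inv_zpow]
  congr 1
  exact (Complex.inv_eq_conj (norm_expFreq _)).symm

lemma vn_zPow_mulVec (e : ℤ) (x : Fin K → ℂ) : vn (zPow f e *ᵥ x) = vn x :=
  vn_eq_of_forall_norm_eq fun k => by
    rw [zPow, mulVec_diagonal, norm_mul, norm_zpow, norm_expFreq, _root_.one_zpow, one_mul]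

lemma specNorm_mul_zPow_mul_le (A : Matrix (Fin M) (Fin K) ℂ) (e : ℤ)
    (B : Matrix (Fin K) (Fin N) ℂ) : specNorm (A * zPow f e * B) ≤ specNorm A * specNorm B := by
  refine specNorm_le (mul_nonneg (specNorm_nonneg A) (specNorm_nonneg B)) fun x => ?_
  rw [← mulVec_mulVec, ← mulVec_mulVec, mul_assoc]
  refine (vn_mulVec_le _ _).trans (mul_le_mul_of_nonneg_left ?_ (specNorm_nonneg A))
  rw [vn_zPow_mulVec]
  exact vn_mulVec_le _ _

/-- Shift structure: z ^ (p + i) = z ^ i z ^ p, so an offset of the rows is a modulation of the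
sources. -/
lemma subarray_vander_mul_add (hM : M ≤ N) (p : Fin (N - M + 1)) (S : Matrix (Fin K) (Fin L) ℂ)
    (E : Matrix (Fin N) (Fin L) ℂ) :
    subarray hM p (vander N f * S + E) = vander M f * zPow f (p.val : ℤ) * S + subarray hM p E := by
  ext i l
  rw [subarray, of_apply, Matrix.add_apply, Matrix.add_apply, subarray, of_apply, mul_apply,
    mul_apply]
  congr 1
  refine Finset.sum_congr rfl fun k _ => ?_
  rw [zPow, mul_diagonal, vander, vander, of_apply, of_apply, pow_add, _root_.zpow_natCast,
    mul_comm (expFreq (f k) ^ p.val)]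

lemma qf_zPow_mul_mul_zPow (C : Matrix (Fin K) (Fin K) ℂ) (e : ℤ) (x : Fin K → ℂ) :
    qf (zPow f e * C * zPow f (-e)) x = qf C (zPow f (-e) *ᵥ x) := by
  rw [← zPow_conjTranspose, qf_mul_mul_conjTranspose]

lemma qf_map_conj (H : Matrix (Fin K) (Fin K) ℂ) (x : Fin K → ℂ) :
    qf (H.map (starRingEnd ℂ)) x = qf H (star x) := by
  have h : star x ⬝ᵥ (H.map (starRingEnd ℂ) *ᵥ x) = star (star (star x) ⬝ᵥ (H *ᵥ star x)) := by
    simp only [dotProduct, mulVec, star_sum, star_mul', Pi.star_apply, star_star, map_apply]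
    rfl
  rw [qf, h]
  exact Complex.conj_re _

lemma qf_covSS (P : ℕ) (C : Matrix (Fin K) (Fin K) ℂ) (x : Fin K → ℂ) :
    qf (covSS P f C) x = 1 / P * ∑ p : Fin P, qf C (zPow f (-(p.val : ℤ)) *ᵥ x) := by
  rw [covSS, show (1 / (P : ℂ)) = ((1 / P : ℝ) : ℂ) by push_cast; rfl, qf_smul, qf_sum]
  simp only [qf_zPow_mul_mul_zPow]

lemma qf_covFB (P : ℕ) (C : Matrix (Fin K) (Fin K) ℂ) (x : Fin K → ℂ) :
    qf (covFB M P f C) x = 1 / 2 * (qf (covSS P f C) x +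
      qf (covSS P f C) (star (zPow f ((M : ℤ) - 1) *ᵥ x))) := by
  have h := qf_zPow_mul_mul_zPow f ((covSS P f C).map (starRingEnd ℂ)) (1 - M) x
  rw [neg_sub] at h
  rw [covFB, show (1 / 2 : ℂ) = ((1 / 2 : ℝ) : ℂ) by push_cast; rfl, qf_smul, qf_add, h,
    qf_map_conj]

variable {f} {C D : Matrix (Fin K) (Fin K) ℂ} {c : ℝ}

/-- The smoothed form is an average of the original form at modulated vectors, so inequalities
between forms survive. -/
lemma mul_qf_covSS_le (h : ∀ x, c * qf C x ≤ qf D x) (P : ℕ) (x : Fin K → ℂ) :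
    c * qf (covSS P f C) x ≤ qf (covSS P f D) x := by
  rw [qf_covSS, qf_covSS, mul_left_comm, Finset.mul_sum]
  exact mul_le_mul_of_nonneg_left (Finset.sum_le_sum fun p _ => h _) (by positivity)

lemma mul_qf_covFB_le (h : ∀ x, c * qf C x ≤ qf D x) (P : ℕ) (x : Fin K → ℂ) :
    c * qf (covFB M P f C) x ≤ qf (covFB M P f D) x := by
  rw [qf_covFB, qf_covFB]
  linarith [mul_qf_covSS_le (f := f) h P x,
    mul_qf_covSS_le (f := f) h P (star (zPow f ((M : ℤ) - 1) *ᵥ x))]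

lemma eigDesc_div_le_qf {T T' : Matrix (Fin K) (Fin K) ℂ} (hT : T.IsHermitian) (hK : 1 ≤ K)
    (h : ∀ x, 1 / 8 * qf T x ≤ qf T' x) (x : Fin K → ℂ) :
    eigDesc T K / 8 * vn x ^ 2 ≤ qf T' x := by
  linarith [h x, eigDesc_mul_le_qf hT hK x]

end Modulation

/-! ### Conjugate reversal. -/

section Reversal

lemma reversal_mul_apply (B : Matrix (Fin M) (Fin K) ℂ) (i : Fin M) (k : Fin K) :
    (reversal M * B) i k = B i.rev k := by
  simp [mul_apply, reversal]

lemma reversal_mul_self : reversal M * reversal M = 1 := by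
  ext i j
  rw [reversal_mul_apply, reversal, of_apply, Fin.rev_rev, one_apply]
  simp only [eq_comm]

lemma reversal_conjTranspose : (reversal M)ᴴ = reversal M := by
  ext i j
  have h : i = j.rev ↔ j = i.rev := by rw [← Fin.rev_inj, Fin.rev_rev, eq_comm]
  simp only [conjTranspose_apply, reversal, of_apply, h]
  split_ifs <;> simp

lemma vn_reversal_mulVec (x : Fin M → ℂ) : vn (reversal M *ᵥ x) = vn x := by
  have h : vn (reversal M *ᵥ x) ^ 2 = vn x ^ 2 := by
    rw [vn_sq, vn_sq, ← Equiv.sum_comp Fin.revPerm]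
    refine Finset.sum_congr rfl fun i _ => ?_
    simp [mulVec, dotProduct, reversal]
  exact (pow_left_inj₀ (vn_nonneg _) (vn_nonneg _) two_ne_zero).1 h

lemma vn_star (x : Fin M → ℂ) : vn (star x) = vn x :=
  vn_eq_of_forall_norm_eq fun _ => norm_star _

/-- Reversal and entrywise conjugation of vectors are isometries. -/
lemma specNorm_reversal_conj_le (B : Matrix (Fin M) (Fin M) ℂ) :
    specNorm (reversal M * B.map (starRingEnd ℂ) * reversal M) ≤ specNorm B := by
  refine specNorm_le (specNorm_nonneg B) fun x => ?_
  have h : ∀ y : Fin M → ℂ, B.map (starRingEnd ℂ) *ᵥ y = star (B *ᵥ star y) := fun y => by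
    ext i
    simp only [mulVec, dotProduct, Pi.star_apply, star_sum, star_mul', star_star, map_apply]
    rfl
  rw [← mulVec_mulVec, ← mulVec_mulVec, vn_reversal_mulVec, h, vn_star]
  refine (vn_mulVec_le _ _).trans_eq ?_
  rw [vn_star, vn_reversal_mulVec]

/-- On the unit circle conjugation is inversion, so row i becomes z ^ (-(M - 1 - i)) = z ^ i z ^ (1
- M). -/
lemma reversal_mul_vander_conj :
    reversal M * (vander M f).map (starRingEnd ℂ) = vander M f * zPow f (1 - (M : ℤ)) := by
  ext i k
  have h := expFreq_ne_zero (f k)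
  rw [reversal_mul_apply, map_apply, zPow, mul_diagonal, vander, of_apply, of_apply, map_pow,
    ← Complex.inv_eq_conj (norm_expFreq _), inv_pow, ← _root_.zpow_natCast, ← _root_.zpow_natCast,
    ← _root_.zpow_neg,
    ← zpow_add₀ h, Fin.val_rev]
  congr 1
  have := i.2
  omega

/-- The backward model has the same array matrix and noise term; only T changes, into the second
summand of `covFB`. -/
lemma reversal_conj_signal (T : Matrix (Fin K) (Fin K) ℂ) (s : ℝ) :
    reversal M * (vander M f * T * (vander M f)ᴴ + (s : ℂ) • 1).map (starRingEnd ℂ) * reversal M =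
      vander M f * (zPow f (1 - (M : ℤ)) * T.map (starRingEnd ℂ) * zPow f ((M : ℤ) - 1)) *
        (vander M f)ᴴ + (s : ℂ) • 1 := by
  have h1 : (vander M f * T * (vander M f)ᴴ + (s : ℂ) • 1).map (starRingEnd ℂ) =
      (vander M f).map (starRingEnd ℂ) * T.map (starRingEnd ℂ) *
        ((vander M f).map (starRingEnd ℂ))ᴴ + (s : ℂ) • 1 := by
    rw [Matrix.map_add _ (map_add _), Matrix.map_mul, Matrix.map_mul]
    congr 1
    ext i j
    rw [map_apply, Matrix.smul_apply, one_apply]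
    split_ifs <;> simp
  have h2 : ((vander M f).map (starRingEnd ℂ))ᴴ * reversal M =
      zPow f ((M : ℤ) - 1) * (vander M f)ᴴ := by
    conv_lhs => rw [← reversal_conjTranspose, ← conjTranspose_mul, reversal_mul_vander_conj,
      conjTranspose_mul, zPow_conjTranspose, neg_sub]
  rw [h1, Matrix.mul_add, Matrix.add_mul, Matrix.mul_smul, Matrix.smul_mul, Matrix.mul_one,
    reversal_mul_self]
  congr 1
  rw [← Matrix.mul_assoc, ← Matrix.mul_assoc, reversal_mul_vander_conj, Matrix.mul_assoc _ _ᴴ, h2]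
  simp only [Matrix.mul_assoc]

end Reversal

/-! ### Errors of the smoothed covariance matrices. -/

section Averaging

variable {f} {Y : Matrix (Fin N) (Fin L) ℂ} {C : Matrix (Fin K) (Fin K) ℂ} {s ε : ℝ}

/-- The model is linear in the source covariance, so the smoothed error is the average of the
subarray errors. -/
lemma specNorm_sampleCovSS_sub_le (hM : M ≤ N)
    (h : ∀ p : Fin (N - M + 1), specNorm (sampleCov (subarray hM p Y) -
      (vander M f * (zPow f (p.val : ℤ) * C * zPow f (-(p.val : ℤ))) * (vander M f)ᴴ +
        (s : ℂ) • 1)) ≤ ε) :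
    specNorm (sampleCovSS hM Y -
      (vander M f * covSS (N - M + 1) f C * (vander M f)ᴴ + (s : ℂ) • 1)) ≤ ε := by
  have hP : (((N - M + 1 : ℕ) : ℝ)) ≠ 0 := Nat.cast_ne_zero.2 (Nat.succ_ne_zero _)
  have hP' : (((N - M + 1 : ℕ) : ℂ)) ≠ 0 := Nat.cast_ne_zero.2 (Nat.succ_ne_zero _)
  have e : sampleCovSS hM Y -
      (vander M f * covSS (N - M + 1) f C * (vander M f)ᴴ + (s : ℂ) • 1) =
      (1 / ((N - M + 1 : ℕ) : ℂ)) • ∑ p : Fin (N - M + 1), (sampleCov (subarray hM p Y) -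
      (vander M f * (zPow f (p.val : ℤ) * C * zPow f (-(p.val : ℤ))) * (vander M f)ᴴ +
        (s : ℂ) • 1)) := by
    rw [sampleCovSS, covSS, Finset.sum_sub_distrib, Finset.sum_add_distrib, Finset.sum_const,
      Finset.card_univ, Fintype.card_fin, smul_sub, smul_add, Matrix.mul_smul, Matrix.smul_mul,
      Matrix.mul_sum,
      Matrix.sum_mul, ← Nat.cast_smul_eq_nsmul ℂ, smul_smul (1 / _), one_div_mul_cancel hP',
      one_smul]
  rw [e, specNorm_smul]
  calc _ ≤ ‖1 / ((N - M + 1 : ℕ) : ℂ)‖ * ∑ _p : Fin (N - M + 1), ε :=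
        mul_le_mul_of_nonneg_left ((specNorm_sum_le _ _).trans (Finset.sum_le_sum fun p _ => h p))
          (norm_nonneg _)
    _ = ε := by
        rw [Finset.sum_const, Finset.card_univ, Fintype.card_fin, nsmul_eq_mul, norm_div, norm_one,
          Complex.norm_natCast, ← mul_assoc, one_div_mul_cancel hP, one_mul]

lemma specNorm_sampleCovFB_sub_le (hM : M ≤ N)
    (h : specNorm (sampleCovSS hM Y -
      (vander M f * covSS (N - M + 1) f C * (vander M f)ᴴ + (s : ℂ) • 1)) ≤ ε) :
    specNorm (sampleCovFB hM Y -
      (vander M f * covFB M (N - M + 1) f C * (vander M f)ᴴ + (s : ℂ) • 1)) ≤ ε := by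
  set R := sampleCovSS hM Y
  set T := covSS (N - M + 1) f C with hT
  set Q := vander M f * T * (vander M f)ᴴ + (s : ℂ) • 1 with hQ
  have e : sampleCovFB hM Y -
      (vander M f * covFB M (N - M + 1) f C * (vander M f)ᴴ + (s : ℂ) • 1) =
      (1 / 2 : ℂ) • ((R - Q) + reversal M * (R - Q).map (starRingEnd ℂ) * reversal M) := by
    have h1 : reversal M * (R - Q).map (starRingEnd ℂ) * reversal M =
        reversal M * R.map (starRingEnd ℂ) * reversal M -
          reversal M * Q.map (starRingEnd ℂ) * reversal M := by
      rw [Matrix.map_sub _ (map_sub _), Matrix.mul_sub, Matrix.sub_mul]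
    rw [h1, hQ, reversal_conj_signal, sampleCovFB, covFB, ← hT, Matrix.mul_smul, Matrix.smul_mul,
      Matrix.mul_add,
      Matrix.add_mul]
    module
  rw [e, specNorm_smul]
  have h2 := specNorm_add_le (R - Q) (reversal M * (R - Q).map (starRingEnd ℂ) * reversal M)
  have h3 := specNorm_reversal_conj_le (R - Q)
  have h4 : ‖(1 / 2 : ℂ)‖ = 1 / 2 := by norm_num
  rw [h4]
  linarith

end Averaging

/-! ### Error of one subarray. -/

section SampleCovariance

lemma qf_sampleCov (S : Matrix (Fin K) (Fin L) ℂ) (x : Fin K → ℂ) :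
    qf (sampleCov S) x = 1 / L * vn (Sᴴ *ᵥ x) ^ 2 := by
  rw [sampleCov, show (1 / (L : ℂ)) = ((1 / L : ℝ) : ℂ) by push_cast; rfl, qf_smul,
    qf_mul_conjTranspose]

/-- Deviation of the sample covariance matrix of a modulated signal in noise. -/
lemma specNorm_sampleCov_sub_le (hL : 0 < L) (A : Matrix (Fin M) (Fin K) ℂ) (e : ℤ)
    (S : Matrix (Fin K) (Fin L) ℂ) (E : Matrix (Fin M) (Fin L) ℂ) {σ c : ℝ} (hσ : 0 ≤ σ)
    (hS : specNorm S ≤ 12 / 7 * √L * c)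
    (hSE : specNorm (S * Eᴴ) ≤ 384 / 49 * √M * σ * specNorm S)
    (hE : specNorm (E * Eᴴ - ((L * σ ^ 2 : ℝ) : ℂ) • 1) ≤ 52 / 3 * √(M * L) * σ ^ 2) :
    specNorm (sampleCov (A * zPow f e * S + E) -
      (A * (zPow f e * sampleCov S * zPow f (-e)) * Aᴴ + ((σ ^ 2 : ℝ) : ℂ) • 1)) ≤
      72 * √M * (max (σ * specNorm A * c) (σ ^ 2) / √L) := by
  have hL0 : (0 : ℝ) < L := by exact_mod_cast hL
  have hLC : (L : ℂ) ≠ 0 := by exact_mod_cast hL.ne'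
  -- Expanding the product, the pure signal term cancels against the model, leaving B, Bᴴ and the
  -- centred noise covariance.
  set B := A * zPow f e * (S * Eᴴ) with hB
  have hBn : specNorm B ≤ specNorm A * (384 / 49 * √M * σ * (12 / 7 * √L * c)) := by
    refine (specNorm_mul_zPow_mul_le f A e _).trans
      (mul_le_mul_of_nonneg_left (hSE.trans ?_) (specNorm_nonneg A))
    gcongr
  have eq1 : sampleCov (A * zPow f e * S + E) -
      (A * (zPow f e * sampleCov S * zPow f (-e)) * Aᴴ + ((σ ^ 2 : ℝ) : ℂ) • 1) =
      (1 / (L : ℂ)) • ((B + Bᴴ) + (E * Eᴴ - ((L * σ ^ 2 : ℝ) : ℂ) • 1)) := by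
    have h1 : ((σ ^ 2 : ℝ) : ℂ) • (1 : Matrix (Fin M) (Fin M) ℂ) =
        (1 / (L : ℂ)) • ((L * σ ^ 2 : ℝ) : ℂ) • 1 := by
      rw [smul_smul]
      congr 1
      push_cast
      field_simp
    rw [h1, sampleCov, sampleCov, hB]
    simp only [conjTranspose_add, conjTranspose_mul, conjTranspose_conjTranspose,
      zPow_conjTranspose, Matrix.mul_add, Matrix.add_mul, Matrix.mul_smul, Matrix.smul_mul,
      Matrix.mul_assoc]
    module
  rw [eq1, specNorm_smul, norm_div, norm_one, Complex.norm_natCast]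
  have h2 : specNorm ((B + Bᴴ) + (E * Eᴴ - ((L * σ ^ 2 : ℝ) : ℂ) • 1)) ≤
      (specNorm B + specNorm B) + 52 / 3 * √(M * L) * σ ^ 2 := by
    refine (specNorm_add_le _ _).trans (add_le_add ((specNorm_add_le _ _).trans_eq ?_) hE)
    rw [specNorm_conjTranspose]
  set m := max (σ * specNorm A * c) (σ ^ 2)
  have hm1 : σ * specNorm A * c ≤ m := le_max_left _ _
  have hm2 : σ ^ 2 ≤ m := le_max_right _ _
  have hm0 : 0 ≤ m := (sq_nonneg σ).trans hm2
  calc _ ≤ 1 / L * (2 * (specNorm A * (384 / 49 * √M * σ * (12 / 7 * √L * c))) +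
        52 / 3 * √(M * L) * σ ^ 2) := by gcongr; linarith
    -- 9216/343 = 2 · (384/49) · (12/7); together with 52/3 this is below 45, well within 72.
    _ = √M / √L * (9216 / 343 * (σ * specNorm A * c) + 52 / 3 * σ ^ 2) := by
        rw [Real.sqrt_mul (Nat.cast_nonneg M), one_div_mul_eq_div, div_eq_iff hL0.ne']
        linear_combination (-(√M * (9216 / 343 * (σ * specNorm A * c) + 52 / 3 * σ ^ 2))) *
          Real.div_sqrt (x := (L : ℝ))
    _ ≤ √M / √L * (72 * m) := by gcongr; linarith
    _ = _ := by ring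

end SampleCovariance

end ESPRIT

namespace ESPRIT

/-! ### Square root of the covariance and the good event. -/

section SquareRoot

open scoped MatrixOrder

variable {K : ℕ} {C : Matrix (Fin K) (Fin K) ℂ}

/-- Square root of the covariance matrix, as used for complex Gaussian vectors. -/
lemma exists_sqrt_complexGaussianVec (hC : C.PosSemidef) :
    ∃ D : Matrix (Fin K) (Fin K) ℂ, D.IsHermitian ∧ D * D = C ∧
      complexGaussianVec C =
        (Measure.pi fun _ : Fin K => complexGaussian 1).map fun w => D *ᵥ w :=
  ⟨CFC.sqrt C, (nonneg_iff_posSemidef.1 (CFC.sqrt_nonneg C)).1,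
    CFC.sqrt_mul_sqrt_self C hC.nonneg, rfl⟩

end SquareRoot

section GoodEvent

variable {Ω : Type*} [MeasurableSpace Ω] {μ : Measure Ω} {N M K L : ℕ} {σ : NNReal}
  {f : Fin K → ℝ} {C : Matrix (Fin K) (Fin K) ℂ}
  {S : Ω → Matrix (Fin K) (Fin L) ℂ} {E : Ω → Matrix (Fin N) (Fin L) ℂ}

/-- The event on which the sources are well excited and all the subarray sample covariance
matrices are close to their signal-plus-noise models. -/
lemma exists_good_event (hK : 1 ≤ K) (hC : C.PosSemidef)
    (hE_indep : iIndepFun (fun (q : Fin N × Fin L) ω => E ω q.1 q.2) μ)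
    (hE_law : ∀ n l, HasLaw (fun ω => E ω n l) (complexGaussian (σ ^ 2)) μ)
    (hS_indep : iIndepFun (fun (l : Fin L) ω => (fun k => S ω k l : Fin K → ℂ)) μ)
    (hS_law : ∀ l, HasLaw (fun ω => (fun k => S ω k l : Fin K → ℂ)) (complexGaussianVec C) μ)
    (hSE : IndepFun (fun ω (q : Fin K × Fin L) => S ω q.1 q.2)
      (fun ω (q : Fin N × Fin L) => E ω q.1 q.2) μ)
    (hMN : M ≤ N) (hKM : K + 1 ≤ M) (hL : max M (16 * C.rank) ≤ L) :
    ∃ G : Set Ω, MeasurableSet G ∧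
      1 - 3 * ((N - M + 1 : ℕ) : ℝ) * Real.exp (-(M : ℝ) / 2) - 2 * Real.exp (-(L : ℝ) / 32)
        ≤ μ.real G ∧
      ∀ ω ∈ G, (∀ x, 1 / 8 * qf C x ≤ qf (sampleCov (S ω)) x) ∧
        ∀ p : Fin (N - M + 1), specNorm (sampleCov (subarray hMN p (vander N f * S ω + E ω)) -
          (vander M f * (zPow f (p.val : ℤ) * sampleCov (S ω) * zPow f (-(p.val : ℤ))) *
            (vander M f)ᴴ + (((σ : ℝ) ^ 2 : ℝ) : ℂ) • 1)) ≤
          72 * √M * (max (σ * specNorm (vander M f) * √(specNorm C)) (σ ^ 2) / √L) := by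
  have := hE_indep.isProbabilityMeasure
  have hML : M ≤ L := (le_max_left _ _).trans hL
  have hM : 1 ≤ M := by omega
  have hLpos : 0 < L := by omega
  have hL0 : (0 : ℝ) < L := by exact_mod_cast hLpos
  obtain ⟨D, hD, hDD, hlaw⟩ := exists_sqrt_complexGaussianVec hC
  simp only [hlaw] at hS_law
  -- C = Dᴴ D, so the rank condition on C is the one needed for the net in the range of D.
  have hrank : D.rank = C.rank := by rw [← hDD, ← rank_conjTranspose_mul_self, hD.eq]
  have hqD : ∀ x, qf C x = vn (D *ᵥ x) ^ 2 := fun x => by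
    have h := qf_mul_conjTranspose D x
    rwa [hD.eq, hDD] at h
  let E' : Fin (N - M + 1) → Ω → Matrix (Fin M) (Fin L) ℂ := fun p ω => subarray hMN p (E ω)
  let g : Fin (N - M + 1) → Fin M × Fin L → Fin N × Fin L := fun p q =>
    (⟨p.val + q.1.val, by omega⟩, q.2)
  have hg : ∀ p, Function.Injective (g p) := fun p a b h => by
    simp only [g, Prod.mk.injEq, Fin.mk.injEq, Nat.add_left_cancel_iff] at h
    exact Prod.ext (Fin.ext h.1) h.2
  have hE' : ∀ p, iIndepFun (fun (q : Fin M × Fin L) ω => E' p ω q.1 q.2) μ := fun p =>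
    hE_indep.precomp (hg p)
  have hE'law : ∀ p n l, HasLaw (fun ω => E' p ω n l) (complexGaussian (σ ^ 2)) μ := fun p n l =>
    hE_law _ l
  have hSE' : ∀ p, IndepFun (fun ω (q : Fin K × Fin L) => S ω q.1 q.2)
      (fun ω (q : Fin M × Fin L) => E' p ω q.1 q.2) μ := fun p =>
    hSE.comp (ψ := fun (e : Fin N × Fin L → ℂ) q => e (g p q)) measurable_id
      (measurable_pi_lambda _ fun q => measurable_pi_apply _)
  have hSm : AEMeasurable (fun ω (q : Fin K × Fin L) => S ω q.1 q.2) μ :=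
    aemeasurable_pi_iff.2 fun q => aemeasurable_pi_iff.1 (hS_law q.2).aemeasurable q.1
  let B₁ : Fin (N - M + 1) → Set Ω := fun p =>
    {ω | ¬ specNorm (E' p ω * (E' p ω)ᴴ - ((L * (σ : ℝ) ^ 2 : ℝ) : ℂ) • 1) ≤
      52 / 3 * √(M * L) * (σ : ℝ) ^ 2}
  let B₂ : Fin (N - M + 1) → Set Ω := fun p =>
    {ω | 384 / 49 * √M * σ * specNorm (S ω) < specNorm (S ω * (E' p ω)ᴴ)}
  let B₃ : Set Ω := {ω | ¬ ∀ u, √(L / 8) * vn (D *ᵥ u) ≤ vn ((S ω)ᴴ *ᵥ u) ∧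
    vn ((S ω)ᴴ *ᵥ u) ≤ 12 / 7 * √L * vn (D *ᵥ u)}
  let B : Set Ω := (⋃ p, B₁ p ∪ B₂ p) ∪ B₃
  have hB : μ.real B ≤ 3 * ((N - M + 1 : ℕ) : ℝ) * Real.exp (-(M : ℝ) / 2) +
      2 * Real.exp (-(L : ℝ) / 32) := by
    refine (measureReal_union_le _ _).trans (add_le_add ?_
      (measureReal_signal_le hD hS_indep hS_law
        (by rw [hrank]; exact (le_max_right _ _).trans hL)))
    calc _ ≤ ∑ p, μ.real (B₁ p ∪ B₂ p) := measureReal_iUnion_fintype_le _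
      _ ≤ ∑ _p : Fin (N - M + 1), 3 * Real.exp (-(M : ℝ) / 2) := by
          refine Finset.sum_le_sum fun p _ => (measureReal_union_le _ _).trans ?_
          have h1 := measureReal_noise_cov_le hM hML (hE' p) (hE'law p)
          have h2 := measureReal_cross_random_le hM (by omega) (hE' p) (hE'law p) hSm (hSE' p)
          exact (add_le_add h1 h2).trans_eq (by ring)
      _ = _ := by
          rw [Finset.sum_const, Finset.card_univ, Fintype.card_fin, nsmul_eq_mul]
          ring
  -- The data are only almost everywhere measurable, so the bad event is replaced by a measurable
  -- hull of the same measure.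
  refine ⟨(toMeasurable μ B)ᶜ, (measurableSet_toMeasurable _ _).compl, ?_, fun ω hω => ?_⟩
  · rw [probReal_compl_eq_one_sub (measurableSet_toMeasurable _ _), measureReal_def,
      measure_toMeasurable, ← measureReal_def]
    linarith
  have hωB : ω ∉ B := fun h => hω (subset_toMeasurable μ B h)
  have h3 : ∀ u, √(L / 8) * vn (D *ᵥ u) ≤ vn ((S ω)ᴴ *ᵥ u) ∧
      vn ((S ω)ᴴ *ᵥ u) ≤ 12 / 7 * √L * vn (D *ᵥ u) := not_not.1 fun h => hωB (Or.inr h)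
  -- Uses ‖D x‖² = xᴴ C x ≤ ‖C‖ ‖x‖², which brings in ‖Σ‖^(1/2).
  have hSn : specNorm (S ω) ≤ 12 / 7 * √L * √(specNorm C) := by
    rw [← specNorm_conjTranspose]
    refine specNorm_le (by positivity) fun x =>
      (h3 x).2.trans ?_
    rw [mul_assoc (12 / 7 * √(L : ℝ))]
    refine mul_le_mul_of_nonneg_left ?_ (by positivity)
    refine le_of_sq_le_sq ?_ (mul_nonneg (Real.sqrt_nonneg _) (vn_nonneg x))
    rw [← hqD, mul_pow, Real.sq_sqrt (specNorm_nonneg C)]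
    exact (le_abs_self _).trans (abs_qf_le C x)
  refine ⟨fun x => ?_, fun p => ?_⟩
  · rw [qf_sampleCov, hqD]
    have h := pow_le_pow_left₀ (mul_nonneg (Real.sqrt_nonneg _) (vn_nonneg _)) (h3 x).1 2
    rw [mul_pow, Real.sq_sqrt (by positivity)] at h
    rw [one_div_mul_eq_div, one_div_mul_eq_div, le_div_iff₀ hL0]
    linarith
  · have hp : ω ∉ B₁ p ∪ B₂ p := fun h => hωB (Or.inl (Set.mem_iUnion.2 ⟨p, h⟩))
    rw [subarray_vander_mul_add]
    refine specNorm_sampleCov_sub_le _ hLpos _ _ _ _ σ.2 hSn ?_ ?_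
    · exact not_lt.1 fun h => hp (Or.inr h)
    · exact not_not.1 fun h => hp (Or.inl h)

end GoodEvent

/-! ### The case of a single subarray. -/

section FullAperture

variable {K N L : ℕ}

lemma covSS_one (f : Fin K → ℝ) (C : Matrix (Fin K) (Fin K) ℂ) : covSS 1 f C = C := by
  simp [covSS, zPow]

lemma sampleCovSS_self (Y : Matrix (Fin N) (Fin L) ℂ) :
    sampleCovSS le_rfl Y = sampleCov Y := by
  have h : N - N + 1 = 1 := by omega
  have hsub : ∀ p : Fin (N - N + 1), subarray le_rfl p Y = Y := fun p => by
    ext i l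
    have hp : p.val = 0 := by omega
    simp [subarray, hp]
  simp only [sampleCovSS, hsub, Finset.sum_const, Finset.card_univ, Fintype.card_fin, h]
  simp

end FullAperture

end ESPRIT

/-! ### Assembly of the three estimators. -/

theorem theorem8 {Ω : Type*} [MeasurableSpace Ω] (μ : Measure Ω) [IsProbabilityMeasure μ]
    (N K L : ℕ) (hK : 1 ≤ K)
    -- distinct frequencies in [0, 1)
    (f : Fin K → ℝ) (hf : ∀ k, f k ∈ Set.Ico (0 : ℝ) 1) (hfinj : Function.Injective f)
    -- noise level and source covariance
    (σ : NNReal) (C : Matrix (Fin K) (Fin K) ℂ) (hC : C.PosSemidef)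
    (S : Ω → Matrix (Fin K) (Fin L) ℂ) (E Y : Ω → Matrix (Fin N) (Fin L) ℂ)
    -- the entries of the noise are i.i.d. CN(0, σ²)
    (hE_indep : iIndepFun (fun (q : Fin N × Fin L) ω => E ω q.1 q.2) μ)
    (hE_law : ∀ n l, HasLaw (fun ω => E ω n l) (ESPRIT.complexGaussian (σ ^ 2)) μ)
    -- the columns of the source matrix are i.i.d. CN(0, C)
    (hS_indep : iIndepFun (fun (l : Fin L) ω => (fun k => S ω k l : Fin K → ℂ)) μ)
    (hS_law : ∀ l, HasLaw (fun ω => (fun k => S ω k l : Fin K → ℂ))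
      (ESPRIT.complexGaussianVec C) μ)
    -- sources and noise are independent
    (hSE : IndepFun (fun ω (q : Fin K × Fin L) => S ω q.1 q.2)
      (fun ω (q : Fin N × Fin L) => E ω q.1 q.2) μ)
    -- the data
    (hY : ∀ ω, Y ω = ESPRIT.vander N f * S ω + E ω) :
    -- ESPRIT
    (∀ hN : K + 1 ≤ N, C.PosDef → max N (16 * K) ≤ L →
      ∃ G : Set Ω, MeasurableSet G ∧
        1 - 3 * Real.exp (-(N : ℝ) / 2) - 2 * Real.exp (-(L : ℝ) / 32) ≤ μ.real G ∧
        ∀ ω ∈ G, ∀ fhat : Fin K → ℝ,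
          ESPRIT.IsOutput (Nat.le_of_succ_le hN) (ESPRIT.sampleCov (Y ω)) fhat →
          ESPRIT.matchedDist fhat f ≤ min 1
            (72 * 2 ^ (2 * K + 5) * (K : ℝ) ^ (3 / 2 : ℝ) * N
                / (ESPRIT.singDesc (ESPRIT.vander N f) K ^ 3 * ESPRIT.eigDesc C K)
              * (max (σ * ESPRIT.specNorm (ESPRIT.vander N f) * √(ESPRIT.specNorm C)) (σ ^ 2)
                / √L))) ∧
    -- FOSS-ESPRIT
    (∀ (M : ℕ) (hMN : M ≤ N) (hM : K + 1 ≤ M), (ESPRIT.covSS (N - M + 1) f C).PosDef →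
      max M (16 * C.rank) ≤ L →
      ∃ G : Set Ω, MeasurableSet G ∧
        1 - 3 * ((N - M + 1 : ℕ) : ℝ) * Real.exp (-(M : ℝ) / 2) - 2 * Real.exp (-(L : ℝ) / 32)
          ≤ μ.real G ∧
        ∀ ω ∈ G, ∀ fhat : Fin K → ℝ,
          ESPRIT.IsOutput (Nat.le_of_succ_le hM) (ESPRIT.sampleCovSS hMN (Y ω)) fhat →
          ESPRIT.matchedDist fhat f ≤ min 1
            (72 * 2 ^ (2 * K + 5) * (K : ℝ) ^ (3 / 2 : ℝ) * M
                / (ESPRIT.singDesc (ESPRIT.vander M f) K ^ 3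
                  * ESPRIT.eigDesc (ESPRIT.covSS (N - M + 1) f C) K)
              * (max (σ * ESPRIT.specNorm (ESPRIT.vander M f) * √(ESPRIT.specNorm C)) (σ ^ 2)
                / √L))) ∧
    -- FBSS-ESPRIT
    (∀ (M : ℕ) (hMN : M ≤ N) (hM : K + 1 ≤ M), (ESPRIT.covFB M (N - M + 1) f C).PosDef →
      max M (16 * C.rank) ≤ L →
      ∃ G : Set Ω, MeasurableSet G ∧
        1 - 3 * ((N - M + 1 : ℕ) : ℝ) * Real.exp (-(M : ℝ) / 2) - 2 * Real.exp (-(L : ℝ) / 32)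
          ≤ μ.real G ∧
        ∀ ω ∈ G, ∀ fhat : Fin K → ℝ,
          ESPRIT.IsOutput (Nat.le_of_succ_le hM) (ESPRIT.sampleCovFB hMN (Y ω)) fhat →
          ESPRIT.matchedDist fhat f ≤ min 1
            (72 * 2 ^ (2 * K + 5) * (K : ℝ) ^ (3 / 2 : ℝ) * M
                / (ESPRIT.singDesc (ESPRIT.vander M f) K ^ 3
                  * ESPRIT.eigDesc (ESPRIT.covFB M (N - M + 1) f C) K)
              * (max (σ * ESPRIT.specNorm (ESPRIT.vander M f) * √(ESPRIT.specNorm C)) (σ ^ 2)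
                / √L))) := by
  have hY' : Y = fun ω => ESPRIT.vander N f * S ω + E ω := funext hY
  subst hY'
  have forward : ∀ (M : ℕ) (hMN : M ≤ N) (hM : K + 1 ≤ M),
      (ESPRIT.covSS (N - M + 1) f C).PosDef → max M (16 * C.rank) ≤ L →
      ∃ G : Set Ω, MeasurableSet G ∧
        1 - 3 * ((N - M + 1 : ℕ) : ℝ) * Real.exp (-(M : ℝ) / 2) - 2 * Real.exp (-(L : ℝ) / 32)
          ≤ μ.real G ∧
        ∀ ω ∈ G, ∀ fhat : Fin K → ℝ,
          ESPRIT.IsOutput (Nat.le_of_succ_le hM)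
            (ESPRIT.sampleCovSS hMN (ESPRIT.vander N f * S ω + E ω)) fhat →
          ESPRIT.matchedDist fhat f ≤ min 1
            (72 * 2 ^ (2 * K + 5) * (K : ℝ) ^ (3 / 2 : ℝ) * M
                / (ESPRIT.singDesc (ESPRIT.vander M f) K ^ 3
                  * ESPRIT.eigDesc (ESPRIT.covSS (N - M + 1) f C) K)
              * (max (σ * ESPRIT.specNorm (ESPRIT.vander M f) * √(ESPRIT.specNorm C)) (σ ^ 2)
                / √L)) := by
    intro M hMN hM hpos hL
    obtain ⟨G, hG, hGμ, hgood⟩ := ESPRIT.exists_good_event (f := f) hK hC hE_indep hE_law hS_indep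
      hS_law hSE hMN hM hL
    refine ⟨G, hG, hGμ, fun ω hω fhat hout => ?_⟩
    obtain ⟨hsrc, hcov⟩ := hgood ω hω
    exact ESPRIT.matchedDist_le_min_of_isOutput hK hM hf hfinj (ESPRIT.eigDesc_pos hpos hK)
      (ESPRIT.eigDesc_div_le_qf hpos.1 hK (ESPRIT.mul_qf_covSS_le hsrc _))
      (ESPRIT.specNorm_sampleCovSS_sub_le hMN hcov) le_rfl hout
  refine ⟨fun hN hpos hL => ?_, forward, fun M hMN hM hpos hL => ?_⟩
  -- Plain ESPRIT is forward smoothing with M = N; L ≥ 16 K suffices because the rank is at most K.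
  · have hP : N - N + 1 = 1 := by omega
    have hrank : C.rank ≤ K := by simpa using C.rank_le_width
    have h := forward N le_rfl hN
    simp only [hP, ESPRIT.covSS_one, ESPRIT.sampleCovSS_self, Nat.cast_one, mul_one] at h
    exact h hpos (by omega)
  · obtain ⟨G, hG, hGμ, hgood⟩ := ESPRIT.exists_good_event (f := f) hK hC hE_indep hE_law hS_indep
      hS_law hSE hMN hM hL
    refine ⟨G, hG, hGμ, fun ω hω fhat hout => ?_⟩
    obtain ⟨hsrc, hcov⟩ := hgood ω hω
    exact ESPRIT.matchedDist_le_min_of_isOutput hK hM hf hfinj (ESPRIT.eigDesc_pos hpos hK)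
      (ESPRIT.eigDesc_div_le_qf hpos.1 hK (ESPRIT.mul_qf_covFB_le hsrc _))
      (ESPRIT.specNorm_sampleCovFB_sub_le hMN (ESPRIT.specNorm_sampleCovSS_sub_le hMN hcov))
      le_rfl hout
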